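/- Let $J\subseteq\mathbb R$ be an open interval containing $0$, let $r_0,v_0\in\mathbb R^3$, and set $$\alpha=|r_0|^2,\quad \beta=r_0\cdot v_0,\quad b=|v_0|,\quad \chi(t)=\alpha+2\beta t+b^2t^2,\qquad a=\beta/b,\quad c=|r_0\wedge v_0|/b .$$ Consider the equation of motion $$\ddot r=\hat h\,r\wedge\dot r,\qquad r(0)=r_0,\ \dot r(0)=v_0,\tag{1}$$ on $J$, where the real coefficient $\hat h=\hat h(t,r^2)$ may depend on $r^2=|r|^2$ (for instance $\hat h=\hat h(r^2)$) and on $t$. Put $h(t)=\hat h(t,\chi(t))$. **(i)** Every solution of (1) satisfies on $J$: $|\dot r(t)|=b$, $|r(t)|^2=\chi(t)$, $r(t)\cdot\dot r(t)=\beta+b^2t$. In (ii)–(iv) assume that $h$ is differentiable and nowhere zero on $J$. **(ii)** The equation $\dddot F=(\dot h/h)\ddot F+h^2\left[\tfrac12\dot\chi F-\chi\dot F\right]$ has on $J$ solutions $F_0,F_1,F_2$ with $(F,\dot F,\ddot F)(0)=(1,0,0)$, $(0,1,0)$, $(0,0,h(0))$ respectively, and for any such $F_0,F_1,F_2$ a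 function $r$ on $J$ solves (1) if and only if $$r(t)=r_0F_0(t)+v_0F_1(t)+(r_0\wedge v_0)F_2(t)\qquad(t\in J).\tag{2}$$ **(iii)** Let $r_0\wedge v_0\ne0$. The linear problem $$\ddot f=\frac{\dot h}{h}\dot f+\left[-\chi\frac{h^2}{4}+\frac{ibh}{2}\right]f,\qquad f(0)=1,\quad \dot f(0)=\frac{i\,a\,h(0)}{2}\tag{3}$$ has exactly one solution $f:J\to\mathbb C$. With $g=-[(a+bt)f+i(2/h)\dot f]/c$, the pair $(f,g)$ is the solution of $\dot f=\tfrac{ih}{2}[(a+bt)f+cg]$, $\dot g=\tfrac{ih}{2}[-(a+bt)g+cf]$, $f(0)=1$, $g(0)=0$ (and every solution of this system arises so), $|f|^2+|g|^2=1$, and the functions $F_j$ of (ii), which give the solution of (1) by (2), are $$F_0=\tfrac1{2c}\{-2(a+bt)[fg+f^*g^*]+c[f^2+f^{*2}-g^2-g^{*2}]\}=\tfrac1{2c^2h^2}\{h^2[c^2+(a+bt)^2][f^2+f^{*2}]+4[\dot f^2+\dot f^{*2}]\},$$ $$F_1=\tfrac1b\{-aF_0+(a+bt)[ff^*-gg^*]+c[fg^*+f^*g]\}=\tfrac1b\{-(a+bt)-aF_0+\tfrac{2i}{h}[f\dot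 f^*-f^*\dot f]\},$$ $$F_2=-\tfrac{i}{2cb}\{2(a+bt)[fg-f^*g^*]-c[f^2-f^{*2}-g^2+g^{*2}]\}=\tfrac{i}{2bc^2h^2}\{h^2[c^2+(a+bt)^2][f^2-f^{*2}]+4[\dot f^2-\dot f^{*2}]\}.$$ **(iv)** If $h$ is moreover twice differentiable on $J$ and $f=h^{1/2}\varphi$ (principal root), then $f$ solves (3) if and only if $$\ddot\varphi=\varphi\left[\tfrac{ibh}2-\chi\tfrac{h^2}4+\tfrac34\left(\tfrac{\dot h}h\right)^2-\tfrac12\tfrac{\ddot h}h\right],\quad \varphi(0)=h(0)^{-1/2},\quad \dot\varphi(0)=\tfrac12h(0)^{-3/2}[i\,a\,h(0)^2-\dot h(0)].\tag{4}$$ In (v)–(vii) let $r_0\wedge v_0\neq0$ and let $k\ne0$ be real. For functions $u,w$ write $\mathrm{Wr}=uw'-wu'$. **(v)** Let $\hat h=k$. Put $p=-\left(1+\frac{ikc^2}{4b}\right)$, $\tau(t)=(ikb)^{1/2}(t+\beta/b^2)$, $\tilde k=\frac a2(ik/b)^{1/2}$, $u(\tau)=D_p(\tau)$, $w(\tau)=D_p(-\tau)$,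 where $D_p$ is the parabolic cylinder function. Then $\mathrm{Wr}$ has no zero and $f$ solves (3) on $J$ if and only if $f(t)=A\,u(\tau(t))+B\,w(\tau(t))$ on $J$, with $A=\frac{w'-\tilde k w}{\mathrm{Wr}}$ and $B=\frac{\tilde k u-u'}{\mathrm{Wr}}$ evaluated at $\tau(0)$. **(vi)** Let $\hat h=k/r^2$, so $h=k/\chi$. Under the substitution $t=-(2ibcz+\beta-ibc)/b^2$, $f(t)=\hat f(z)$ with $\hat f$ holomorphic near the points $z(t)$, $t\in J$, the differential equation in (3) becomes $z(1-z)\hat f''+(1-2z)\hat f'-\frac{k(k-2ib)}{(2b)^2}\hat f=0$. Let $F$ be the hypergeometric function $F\left(-\frac{ik}{2b},1+\frac{ik}{2b};1;z\right)$, continued analytically to $\mathbb C\setminus[1,\infty)$. Then $F(z)$ and $F(1-z)$ solve this equation on $\mathbb C\setminus((-\infty,0]\cup[1,\infty))$ with nowhere vanishing Wronskian, and $f$ solves (3) on $J$ if and only if $f(t)=A\,F(z(t))+B\,F(1-z(t))$ on $J$, where $A,B$ are the constants for which $AF(z)+BF(1-z)$ has value $1$ and derivative $ack/(b\alpha)$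 at $z=z(0)$. **(vii)** Let $\hat h=h(t)=2k/(1+2\omega t)$ with $\omega\neq0$ real and $1+2\omega t\ne0$ on $J$. Put $\lambda=\frac{2b\omega^2-ik(b^2-2\beta\omega)}{4b\omega^2}$ and let $\mu\in\mathbb C$ satisfy $\mu^2=\frac{k^2(4\beta\omega-b^2-4\alpha\omega^2)}{16\omega^4}$. Under the substitution $t=(2i\omega^2z-bk)/(2bk\omega)$, $\varphi(t)=\hat\varphi(z)$ with $\hat\varphi$ holomorphic near the points $z(t)$, $t\in J$, the differential equation in (4) becomes Whittaker's equation $\hat\varphi''+\left[\frac14\left(\frac1{z^2}-1\right)+\frac\lambda z-\frac{\mu^2}{z^2}\right]\hat\varphi=0$. The functions $u(z)=W_{\lambda,\mu}(z)$ and $w(z)=W_{-\lambda,\mu}(-z)$ (principal branches) solve it for $\operatorname{Im}z\ne0$ with nowhere vanishing Wronskian, and $f$ solves (3) on $J$ if and only if $f(t)=h(t)^{1/2}[A\,u(z(t))+B\,w(z(t))]$ on $J$, where $A,B$ are the constants for which $Au+Bw$ has value $\varphi(0)$ and derivative $\dot\varphi(0)\,i\omega/(bk)$ at $z=z(0)$,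 with $\varphi(0),\dot\varphi(0)$ as in (4). -/

import Mathlib

noncomputable section

namespace VectorNewton

open Complex ComplexConjugate

/-- Ordinary three-dimensional space with its Euclidean norm. -/
abbrev E3 := EuclideanSpace ℝ (Fin 3)

/-- The vector product `x ∧ y` in `ℝ³`. -/
def wedge (x y : E3) : E3 := WithLp.toLp 2 (crossProduct x.ofLp y.ofLp)

/-- `r` is, on the (open) set `J`, a solution of `r̈ = H(t, |r|²) r ∧ ṙ`.  The autonomous equation
`r̈ = ĥ(r²) r ∧ ṙ` is the case `H t s = ĥ s`, the equation `r̈ = h(t) r ∧ ṙ` the case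
`H t s = h t`. -/
def IsMotion (H : ℝ → ℝ → ℝ) (J : Set ℝ) (r : ℝ → E3) : Prop :=
  ∀ t ∈ J, DifferentiableAt ℝ r t ∧
    HasDerivAt (deriv r) (H t (‖r t‖ ^ 2) • wedge (r t) (deriv r t)) t

/-! ### Constants attached to initial data `r(0) = r₀`, `ṙ(0) = v₀` -/

/-- `α = |r(0)|²` -/
def alpha (r₀ : E3) : ℝ := ‖r₀‖ ^ 2

/-- `β = r(0) · ṙ(0)` -/
def beta (r₀ v₀ : E3) : ℝ := inner ℝ r₀ v₀

/-- `b = |ṙ(0)|` -/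
def speed (v₀ : E3) : ℝ := ‖v₀‖

/-- `a = r(0) · ṙ(0) / |ṙ(0)|` -/
def parA (r₀ v₀ : E3) : ℝ := beta r₀ v₀ / speed v₀

/-- `c = |r(0) ∧ ṙ(0)| / |ṙ(0)|` -/
def parC (r₀ v₀ : E3) : ℝ := ‖wedge r₀ v₀‖ / speed v₀

/-- `χ(t) = α + 2 β t + b² t²` -/
def chi (r₀ v₀ : E3) (t : ℝ) : ℝ := alpha r₀ + 2 * beta r₀ v₀ * t + speed v₀ ^ 2 * t ^ 2

/-! ### The third-order linear equation for `F₀, F₁, F₂` -/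

/-- On `J` the function `F` solves
`F⃛ = (ḣ/h) F̈ + h² (½ χ̇ F - χ Ḟ)`, with `F(0) = x₀`, `Ḟ(0) = x₁`, `F̈(0) = x₂`. -/
def SolvesThirdOrder (h : ℝ → ℝ) (r₀ v₀ : E3) (J : Set ℝ) (x₀ x₁ x₂ : ℝ) (F : ℝ → ℝ) : Prop :=
  (∀ t ∈ J, DifferentiableAt ℝ F t ∧ DifferentiableAt ℝ (deriv F) t ∧
    HasDerivAt (deriv (deriv F))
      (deriv h t / h t * deriv (deriv F) t
        + h t ^ 2 * (1 / 2 * deriv (chi r₀ v₀) t * F t - chi r₀ v₀ t * deriv F t)) t) ∧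
  F 0 = x₀ ∧ deriv F 0 = x₁ ∧ deriv (deriv F) 0 = x₂

/-! ### The linear second-order equation for `f` -/

/-- On `J` the function `f` solves `f̈ = (ḣ/h) ḟ + [-χ (h/2)² + i b h/2] f`. -/
def SolvesLinear (h : ℝ → ℝ) (r₀ v₀ : E3) (J : Set ℝ) (f : ℝ → ℂ) : Prop :=
  ∀ t ∈ J, DifferentiableAt ℝ f t ∧
    HasDerivAt (deriv f)
      (((deriv h t / h t : ℝ) : ℂ) * deriv f t
        + (-(chi r₀ v₀ t : ℂ) * ((h t : ℂ) / 2) ^ 2 + I * speed v₀ * h t / 2) * f t) t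

/-- `f` solves the linear equation with `f(0) = 1`, `ḟ(0) = i a h(0)/2`. -/
def IsGenerating (h : ℝ → ℝ) (r₀ v₀ : E3) (J : Set ℝ) (f : ℝ → ℂ) : Prop :=
  SolvesLinear h r₀ v₀ J f ∧ f 0 = 1 ∧ deriv f 0 = I * parA r₀ v₀ * h 0 / 2

/-- The companion function `g = -[(a + b t) f + i (2/h) ḟ] / c`. -/
def companion (h : ℝ → ℝ) (r₀ v₀ : E3) (f : ℝ → ℂ) (t : ℝ) : ℂ :=
  -(((parA r₀ v₀ + speed v₀ * t : ℝ) : ℂ) * f t + I * (2 / (h t : ℂ)) * deriv f t) / parC r₀ v₀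

/-- The first-order system
`ḟ = i (h/2) [(a + b t) f + c g]`, `ġ = i (h/2) [-(a + b t) g + c f]`, `f(0) = 1`, `g(0) = 0`. -/
def SolvesSystem (h : ℝ → ℝ) (r₀ v₀ : E3) (J : Set ℝ) (f g : ℝ → ℂ) : Prop :=
  (∀ t ∈ J,
    HasDerivAt f (I * ((h t : ℂ) / 2) *
      (((parA r₀ v₀ + speed v₀ * t : ℝ) : ℂ) * f t + parC r₀ v₀ * g t)) t ∧
    HasDerivAt g (I * ((h t : ℂ) / 2) *
      (-((parA r₀ v₀ + speed v₀ * t : ℝ) : ℂ) * g t + parC r₀ v₀ * f t)) t) ∧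
  f 0 = 1 ∧ g 0 = 0

/-! The expressions of `F₀, F₁, F₂` through `f` and `g` (with `z`, `w` the values `f(t)`, `g(t)`). -/

/-- `F₀ = (1/2c) {-2 (a+bt) [f g + f* g*] + c [f² + f*² - g² - g*²]}` -/
def pairF0 (r₀ v₀ : E3) (t : ℝ) (z w : ℂ) : ℂ :=
  1 / (2 * (parC r₀ v₀ : ℂ)) *
    (-2 * ((parA r₀ v₀ + speed v₀ * t : ℝ) : ℂ) * (z * w + conj z * conj w)
      + parC r₀ v₀ * (z ^ 2 + conj z ^ 2 - w ^ 2 - conj w ^ 2))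

/-- `F₁ = (1/b) {-a F₀ + (a+bt) [f f* - g g*] + c [f g* + f* g]}` -/
def pairF1 (r₀ v₀ : E3) (t : ℝ) (z w : ℂ) : ℂ :=
  1 / (speed v₀ : ℂ) *
    (-(parA r₀ v₀ : ℂ) * pairF0 r₀ v₀ t z w
      + ((parA r₀ v₀ + speed v₀ * t : ℝ) : ℂ) * (z * conj z - w * conj w)
      + parC r₀ v₀ * (z * conj w + conj z * w))

/-- `F₂ = -(i/2cb) {2 (a+bt) [f g - f* g*] - c [f² - f*² - g² + g*²]}` -/
def pairF2 (r₀ v₀ : E3) (t : ℝ) (z w : ℂ) : ℂ :=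
  -(I / (2 * parC r₀ v₀ * speed v₀)) *
    (2 * ((parA r₀ v₀ + speed v₀ * t : ℝ) : ℂ) * (z * w - conj z * conj w)
      - parC r₀ v₀ * (z ^ 2 - conj z ^ 2 - w ^ 2 + conj w ^ 2))

/-! The expressions of `F₀, F₁, F₂` through `f` alone (`η`, `z`, `z'` are the values `h(t)`, `f(t)`,
`ḟ(t)`). -/

/-- `F₀ = (1/2c²h²) {h² [c² + (a+bt)²] [f² + f*²] + 4 [ḟ² + ḟ*²]}` -/
def singleF0 (r₀ v₀ : E3) (t : ℝ) (η : ℝ) (z z' : ℂ) : ℂ :=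
  1 / (2 * (parC r₀ v₀ : ℂ) ^ 2 * (η : ℂ) ^ 2) *
    ((η : ℂ) ^ 2 * ((parC r₀ v₀ ^ 2 + (parA r₀ v₀ + speed v₀ * t) ^ 2 : ℝ) : ℂ)
        * (z ^ 2 + conj z ^ 2)
      + 4 * (z' ^ 2 + conj z' ^ 2))

/-- `F₁ = (1/b) {-(a+bt) - a F₀ + i (2/h) [f ḟ* - f* ḟ]}` -/
def singleF1 (r₀ v₀ : E3) (t : ℝ) (η : ℝ) (z z' : ℂ) : ℂ :=
  1 / (speed v₀ : ℂ) *
    (-((parA r₀ v₀ + speed v₀ * t : ℝ) : ℂ) - parA r₀ v₀ * singleF0 r₀ v₀ t η z z'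
      + I * (2 / (η : ℂ)) * (z * conj z' - conj z * z'))

/-- `F₂ = (i/2bc²h²) {h² [c² + (a+bt)²] [f² - f*²] + 4 [ḟ² - ḟ*²]}` -/
def singleF2 (r₀ v₀ : E3) (t : ℝ) (η : ℝ) (z z' : ℂ) : ℂ :=
  I / (2 * speed v₀ * (parC r₀ v₀ : ℂ) ^ 2 * (η : ℂ) ^ 2) *
    ((η : ℂ) ^ 2 * ((parC r₀ v₀ ^ 2 + (parA r₀ v₀ + speed v₀ * t) ^ 2 : ℝ) : ℂ)
        * (z ^ 2 - conj z ^ 2)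
      + 4 * (z' ^ 2 - conj z' ^ 2))

/-! ### The Schrödinger form -/

/-- On `J` the function `φ` solves
`φ̈ = φ [i b h/2 - χ (h/2)² + (3/4) (ḣ/h)² - (1/2) ḧ/h]`. -/
def SolvesSchroedinger (h : ℝ → ℝ) (r₀ v₀ : E3) (J : Set ℝ) (φ : ℝ → ℂ) : Prop :=
  ∀ t ∈ J, DifferentiableAt ℝ φ t ∧
    HasDerivAt (deriv φ)
      (φ t * (I * speed v₀ * h t / 2 - (chi r₀ v₀ t : ℂ) * ((h t : ℂ) / 2) ^ 2
        + 3 / 4 * ((deriv h t / h t : ℝ) : ℂ) ^ 2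
        - 1 / 2 * ((deriv (deriv h) t / h t : ℝ) : ℂ))) t

/-- The initial value `φ(0) = h(0)^(-1/2)`. -/
def phiInit (h : ℝ → ℝ) : ℂ := (h 0 : ℂ) ^ (-1 / 2 : ℂ)

/-- The initial value `φ̇(0) = h(0)^(-3/2) [i a h(0)² - ḣ(0)] / 2`. -/
def phiDerivInit (h : ℝ → ℝ) (r₀ v₀ : E3) : ℂ :=
  (h 0 : ℂ) ^ (-3 / 2 : ℂ) * (I * parA r₀ v₀ * (h 0 : ℂ) ^ 2 - ((deriv h 0 : ℝ) : ℂ)) / 2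

/-! ### Solving for the coefficients of a linear combination -/

/-- The Wronskian `u w' - w u'` at `z`. -/
def wronsk (u w : ℂ → ℂ) (z : ℂ) : ℂ := u z * deriv w z - w z * deriv u z

/-- The coefficient of `u` in the combination of `u` and `w` with value `x` and derivative `y`
at `z`. -/
def coeffFst (u w : ℂ → ℂ) (z x y : ℂ) : ℂ := (x * deriv w z - y * w z) / wronsk u w z

/-- The coefficient of `w` in the combination of `u` and `w` with value `x` and derivative `y`
at `z`. -/
def coeffSnd (u w : ℂ → ℂ) (z x y : ℂ) : ℂ := (y * u z - x * deriv u z) / wronsk u w z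

/-! ### Special functions -/

/-- Kummer's confluent hypergeometric function `Φ(a, c; z) = ∑ (a)ₙ zⁿ / ((c)ₙ n!)`, for `c` not a
non-positive integer (Mathlib's function is the one divided by `Γ(c)`). -/
def kummer (a c z : ℂ) : ℂ := Gamma c * regularizedHGFun {a} {c} z

/-- The parabolic cylinder function
`D_p(z) = 2^(p/2) e^(-z²/4) [√π / Γ((1-p)/2) Φ(-p/2, 1/2; z²/2)
  - √(2π) z / Γ(-p/2) Φ((1-p)/2, 3/2; z²/2)]`. -/
def parabolicCylinder (p z : ℂ) : ℂ :=
  (2 : ℂ) ^ (p / 2) * exp (-z ^ 2 / 4) *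
    ((Real.sqrt Real.pi : ℂ) / Gamma ((1 - p) / 2) * kummer (-p / 2) (1 / 2) (z ^ 2 / 2)
      - (Real.sqrt (2 * Real.pi) : ℂ) * z / Gamma (-p / 2)
        * kummer ((1 - p) / 2) (3 / 2) (z ^ 2 / 2))

/-- `F` is the Gauss hypergeometric function `F(a, b; c; ·)`, that is, the analytic continuation of
the hypergeometric series from the unit disc to `ℂ` cut along `[1, ∞)`. -/
def IsGaussHypergeometric (a b c : ℂ) (F : ℂ → ℂ) : Prop :=
  DifferentiableOn ℂ F {z | 1 - z ∈ slitPlane} ∧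
    ∀ z : ℂ, ‖z‖ < 1 → F z = ordinaryHypergeometric a b c z

/-- The Whittaker function `M_{λ,μ}(z) = z^(μ+1/2) e^(-z/2) Φ(μ-λ+1/2, 2μ+1; z)`. -/
def whittakerM (l m z : ℂ) : ℂ :=
  z ^ (m + 1 / 2) * exp (-z / 2) * kummer (m - l + 1 / 2) (2 * m + 1) z

/-- The Whittaker function `W_{λ,μ}(z)`, for `2μ` not an integer. -/
def whittakerW (l m z : ℂ) : ℂ :=
  Gamma (-2 * m) / Gamma (1 / 2 - m - l) * whittakerM l m z
    + Gamma (2 * m) / Gamma (1 / 2 + m - l) * whittakerM l (-m) z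

/-! ### The three explicit cases: parameters and changes of variable -/

/-- `p = -(1 + i k c² / (4 b))` -/
def cylP (k : ℝ) (r₀ v₀ : E3) : ℂ := -(1 + I * k * (parC r₀ v₀ : ℂ) ^ 2 / (4 * speed v₀))

/-- `τ(t) = (i k b)^(1/2) (t + β / b²)` -/
def cylTau (k : ℝ) (r₀ v₀ : E3) (t : ℝ) : ℂ :=
  (I * k * speed v₀) ^ (1 / 2 : ℂ) * ((t + beta r₀ v₀ / speed v₀ ^ 2 : ℝ) : ℂ)

/-- `k̃ = (a/2) (i k / b)^(1/2)` -/
def cylK (k : ℝ) (r₀ v₀ : E3) : ℂ := (parA r₀ v₀ : ℂ) / 2 * (I * k / speed v₀) ^ (1 / 2 : ℂ)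

/-- `z(t)`, the solution of `t = -(2 i b c z + β - i b c) / b²`. -/
def hypZ (r₀ v₀ : E3) (t : ℝ) : ℂ :=
  (I * speed v₀ * parC r₀ v₀ - beta r₀ v₀ - (speed v₀ : ℂ) ^ 2 * t)
    / (2 * I * speed v₀ * parC r₀ v₀)

/-- The hypergeometric equation
`z (1 - z) u'' + (1 - 2 z) u' - k (k - 2 i b) (2 b)⁻² u = 0` at the point `z`. -/
def HypEqAt (k b : ℝ) (u : ℂ → ℂ) (z : ℂ) : Prop :=
  z * (1 - z) * deriv (deriv u) z + (1 - 2 * z) * deriv u z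
    - k * (k - 2 * I * b) * ((2 * b : ℂ) ^ 2)⁻¹ * u z = 0

/-- `z(t)`, the solution of `t = (2 i ω² z - b k) / (2 b k ω)`. -/
def whitZ (k ω : ℝ) (v₀ : E3) (t : ℝ) : ℂ :=
  (2 * speed v₀ * k * ω * t + speed v₀ * k) / (2 * I * (ω : ℂ) ^ 2)

/-- `λ = [2 b ω² - i k (b² - 2 β ω)] / (4 b ω²)` -/
def whitL (k ω : ℝ) (r₀ v₀ : E3) : ℂ :=
  (2 * speed v₀ * (ω : ℂ) ^ 2 - I * k * ((speed v₀ : ℂ) ^ 2 - 2 * beta r₀ v₀ * ω))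
    / (4 * speed v₀ * (ω : ℂ) ^ 2)

/-- `μ² = k² (4 β ω - b² - 4 α ω²) / (16 ω⁴)` -/
def whitMuSq (k ω : ℝ) (r₀ v₀ : E3) : ℝ :=
  k ^ 2 * (4 * beta r₀ v₀ * ω - speed v₀ ^ 2 - 4 * alpha r₀ * ω ^ 2) / (16 * ω ^ 4)

/-- The Whittaker equation `u'' + [(1/4) (1/z² - 1) + λ/z - μ²/z²] u = 0` at the point `z`. -/
def WhittakerEqAt (l m : ℂ) (u : ℂ → ℂ) (z : ℂ) : Prop :=
  deriv (deriv u) z + (1 / 4 * (1 / z ^ 2 - 1) + l / z - m ^ 2 / z ^ 2) * u z = 0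

end VectorNewton

end

open VectorNewton

/-! The force is orthogonal to `r` and `ṙ`, so |ṙ|² is constant, r·ṙ is affine and |r|² is the
quadratic χ; along a solution the coefficient ĥ is therefore the known function h(t). By the triple
product expansion, r, ṙ and r ∧ ṙ then satisfy a linear system with scalar coefficients, F' = D, D'
= hG, G' = h[(β + b²t)F - χD]. Eliminating D and G gives the third-order equation, and its three
basic solutions are the coefficients of r₀, v₀, r₀ ∧ v₀. Conversely, a solution of the vector system
with these initial vectors is a motion: its Gram matrix is forced (`SolvesThirdSystem.gram`), hence
G = F ∧ D (`SolvesThirdSystem.eq_wedge`). Both facts hold because a quantity that obeys a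
homogeneous linear equation and vanishes at 0 vanishes identically (`eqOn_zero_of_norm_deriv_le`).
Existence on all of J comes from the Peano–Baker series.

If r₀ ∧ v₀ ≠ 0, then χ = c² + (a+bt)², so M = ((a+bt, c), (c, -(a+bt))) is a hermitian matrix with
M² = χ. The system for (f, g) has the matrix (ih/2)M, hence preserves |f|² + |g|². Eliminating g
gives the equation for f: M² contributes -χh²/4 and the derivative of M contributes ibh/2. In the
orthonormal frame made of v₀/b, the normalised part of r₀ orthogonal to v₀, and their vector
product, ṙ/b is the Hopf image (|f|² - |g|², -2 Re fg, -2 Im fg) of the spinor. So the F_j are real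
quadratic expressions in (f, g), and they are checked directly against the linear system
(`solvesThirdSystem_realF0` and its two companions).

In the explicit cases an affine complex change of variable leads to a classical equation. By
uniqueness (`isGenerating_iff_eqOn`) it suffices to exhibit one solution with the right initial
values, so each case needs only a pair of solutions whose Wronskian does not vanish. For D_p(τ),
D_p(-τ) the Wronskian is constant and is read off at 0; it is nonzero because p is not real. Both
Whittaker functions are expanded in M_{λ,±μ}, and the determinant of the coefficients follows from
the reflection formula; it is nonzero because μ is not real. The Gauss function is continued through
Euler's integral for its derivative. If its Wronskian with F(1-z) vanished, F(1-z) would be a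
multiple of F(z), and F would extend to an entire function although its series has radius of
convergence 1. -/

namespace VectorNewton

open Set Filter Topology MeasureTheory intervalIntegral
open scoped Nat

/-! ### Linear differential equations on an open interval: uniqueness and global existence. -/

section LinearODE

variable {E : Type*} [NormedAddCommGroup E] [NormedSpace ℝ E]

/-- A solution of a linear differential inequality that vanishes at `0` vanishes. -/
theorem eqOn_zero_of_norm_deriv_le {J : Set ℝ} (hJc : J.OrdConnected) (hJ0 : (0 : ℝ) ∈ J)
    {x x' : ℝ → E} {K : ℝ → ℝ} (hK : ContinuousOn K J)
    (hx : ∀ t ∈ J, HasDerivAt x (x' t) t) (hb : ∀ t ∈ J, ‖x' t‖ ≤ K t * ‖x t‖) (h0 : x 0 = 0) :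
    ∀ t ∈ J, x t = 0 := by
  intro t ht
  rcases le_total 0 t with h | h
  · have hs : Icc 0 t ⊆ J := hJc.out hJ0 ht
    obtain ⟨C, hC⟩ := isCompact_Icc.bddAbove_image (hK.mono hs)
    refine eq_zero_of_abs_deriv_le_mul_abs_self_of_eq_zero_right (f' := x') (K := C)
      (fun s hs' => (hx s (hs hs')).continuousAt.continuousWithinAt)
      (fun s hs' => (hx s (hs (Ico_subset_Icc_self hs'))).hasDerivWithinAt) h0
      (fun s hs' => (hb s (hs (Ico_subset_Icc_self hs'))).trans ?_) t ⟨h, le_rfl⟩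
    gcongr
    exact hC (mem_image_of_mem _ (Ico_subset_Icc_self hs'))
  -- Negative times are reduced to positive ones by the reflection s ↦ -s.
  · have hs : Icc t 0 ⊆ J := hJc.out ht hJ0
    obtain ⟨C, hC⟩ := isCompact_Icc.bddAbove_image (hK.mono hs)
    have hm : ∀ s ∈ Icc 0 (-t), -s ∈ Icc t 0 := fun s hs' =>
      ⟨by linarith [hs'.2], by linarith [hs'.1]⟩
    have hd : ∀ s ∈ Icc 0 (-t), HasDerivAt (fun s => x (-s)) (-x' (-s)) s := fun s hs' => by
      simpa using! (hx (-s) (hs (hm s hs'))).scomp s (hasDerivAt_neg s)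
    have := eq_zero_of_abs_deriv_le_mul_abs_self_of_eq_zero_right (f := fun s => x (-s))
      (f' := fun s => -x' (-s)) (K := C) (a := 0) (b := -t)
      (fun s hs' => (hd s hs').continuousAt.continuousWithinAt)
      (fun s hs' => (hd s (Ico_subset_Icc_self hs')).hasDerivWithinAt) (by simpa using h0)
      (fun s hs' => by
        rw [norm_neg]
        refine (hb _ (hs (hm s (Ico_subset_Icc_self hs')))).trans ?_
        gcongr
        exact hC (mem_image_of_mem _ (hm s (Ico_subset_Icc_self hs')))) (-t)
        ⟨by linarith, le_rfl⟩
    simpa using this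

/-- Uniqueness for linear systems with continuous coefficients. -/
theorem eqOn_of_linear {J : Set ℝ} (hJc : J.OrdConnected) (hJ0 : (0 : ℝ) ∈ J)
    {A : ℝ → E →L[ℝ] E} (hA : ContinuousOn A J) {x y : ℝ → E}
    (hx : ∀ t ∈ J, HasDerivAt x (A t (x t)) t) (hy : ∀ t ∈ J, HasDerivAt y (A t (y t)) t)
    (h0 : x 0 = y 0) : EqOn x y J := by
  intro t ht
  refine sub_eq_zero.1 (eqOn_zero_of_norm_deriv_le hJc hJ0 (x := fun t => x t - y t)
    (x' := fun t => A t (x t - y t)) hA.norm (fun t ht => ?_)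
    (fun t _ => (A t).le_opNorm _) (sub_eq_zero.2 h0) t ht)
  simpa using! (hx t ht).sub (hy t ht)

/-- The terms of the Peano–Baker series of `x' = A x`, `x 0 = x₀`. -/
noncomputable def peanoBaker (A : ℝ → E →L[ℝ] E) (x₀ : E) : ℕ → ℝ → E
  | 0 => fun _ => x₀
  | n + 1 => fun t => ∫ s in (0 : ℝ)..t, A s (peanoBaker A x₀ n s)

variable {J : Set ℝ} {A : ℝ → E →L[ℝ] E} {x₀ : E}

/-- Each integration of |s|^n contributes a factor 1/(n+1), which builds up the factorial. The
unordered interval between 0 and t treats both signs of t at once. -/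
theorem norm_peanoBaker_le {a b C : ℝ} (h0 : (0 : ℝ) ∈ Icc a b)
    (hC : ∀ t ∈ Icc a b, ‖A t‖ ≤ C) (hC0 : 0 ≤ C) (n : ℕ) :
    ∀ t ∈ Icc a b, ‖peanoBaker A x₀ n t‖ ≤ (C * |t|) ^ n / n ! * ‖x₀‖ := by
  induction n with
  | zero => intro t _; simp [peanoBaker]
  | succ n ih =>
    intro t ht
    calc ‖peanoBaker A x₀ (n + 1) t‖
        ≤ ∫ s in uIoc 0 t, C ^ (n + 1) * |s - 0| ^ n / n ! * ‖x₀‖ := by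
          rw [peanoBaker, intervalIntegral.norm_intervalIntegral_eq]
          apply MeasureTheory.norm_integral_le_of_norm_le (Continuous.integrableOn_uIoc (by fun_prop))
          apply ae_restrict_mem measurableSet_uIoc |>.mono
          intro s hs
          have hs' : s ∈ Icc a b := uIcc_subset_Icc h0 ht (uIoc_subset_uIcc hs)
          refine ((A s).le_opNorm _).trans ?_
          calc _ ≤ C * ((C * |s|) ^ n / n ! * ‖x₀‖) := by
                gcongr
                exacts [hC s hs', ih s hs']
            _ = _ := by rw [sub_zero]; ring
      _ = (C * |t|) ^ (n + 1) / (n + 1)! * ‖x₀‖ := by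
          rw [MeasureTheory.integral_mul_const, MeasureTheory.integral_div,
            MeasureTheory.integral_const_mul, integral_pow_abs_sub_uIoc, sub_zero,
            Nat.factorial_succ, mul_pow]
          push_cast
          field_simp

variable [CompleteSpace E]

theorem hasDerivAt_integral_of_continuousOn (hJ : IsOpen J) (hJc : J.OrdConnected)
    (hJ0 : (0 : ℝ) ∈ J) {v : ℝ → E} (hv : ContinuousOn v J) {t : ℝ} (ht : t ∈ J) :
    HasDerivAt (fun t => ∫ s in (0 : ℝ)..t, v s) (v t) t :=
  integral_hasDerivAt_right
    ((hv.mono (hJc.uIcc_subset hJ0 ht)).intervalIntegrable)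
    (hv.stronglyMeasurableAtFilter hJ t ht) (hv.continuousAt (hJ.mem_nhds ht))

theorem continuousOn_peanoBaker (hJ : IsOpen J) (hJc : J.OrdConnected) (hJ0 : (0 : ℝ) ∈ J)
    (hA : ContinuousOn A J) (n : ℕ) : ContinuousOn (peanoBaker A x₀ n) J := by
  induction n with
  | zero => exact continuousOn_const
  | succ n ih => exact fun t ht => (hasDerivAt_integral_of_continuousOn hJ hJc hJ0
      (hA.clm_apply ih) ht).continuousAt.continuousWithinAt

/-- Global existence for linear systems with continuous coefficients on an open interval. -/
theorem exists_solution_linear (hJ : IsOpen J) (hJc : J.OrdConnected) (hJ0 : (0 : ℝ) ∈ J)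
    (hA : ContinuousOn A J) (x₀ : E) :
    ∃ x : ℝ → E, x 0 = x₀ ∧ ∀ t ∈ J, HasDerivAt x (A t (x t)) t := by
  refine ⟨fun t => ∑' n, peanoBaker A x₀ n t, ?_, ?_⟩
  · beta_reduce
    rw [tsum_eq_single 0]
    · rfl
    · intro n hn
      obtain ⟨m, rfl⟩ := Nat.exists_eq_succ_of_ne_zero hn
      simp [peanoBaker]
  · intro t ht
    -- The series is one function on the whole line, so nothing has to be glued. At each t it is
    -- enough to work on a compact interval in J with 0 and t in its interior, where ‖A‖ is bounded.
    obtain ⟨a, b, hab, habJ⟩ : ∃ a b, 0 ∈ Ioo a b ∧ t ∈ Ioo a b ∧ Icc a b ⊆ J := by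
      obtain ⟨ε, hε, h1⟩ := Metric.isOpen_iff.1 hJ 0 hJ0
      obtain ⟨δ, hδ, h2⟩ := Metric.isOpen_iff.1 hJ t ht
      have hm : ∀ s ∈ J, ∀ η > 0, Metric.ball s η ⊆ J → s - η / 2 ∈ J ∧ s + η / 2 ∈ J := by
        intro s _ η hη hs
        constructor <;> apply hs <;> rw [Metric.mem_ball, Real.dist_eq] <;> ring_nf <;>
          simp [abs_div, abs_of_pos hη] <;> linarith
      obtain ⟨p1, p2⟩ := hm 0 hJ0 ε hε h1
      obtain ⟨q1, q2⟩ := hm t ht δ hδ h2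
      refine ⟨min (0 - ε / 2) (t - δ / 2), max (0 + ε / 2) (t + δ / 2), ⟨?_, ?_⟩, ⟨?_, ?_⟩,
        hJc.out ?_ ?_⟩
      · exact min_lt_of_left_lt (by linarith)
      · exact lt_max_of_lt_left (by linarith)
      · exact min_lt_of_right_lt (by linarith)
      · exact lt_max_of_lt_right (by linarith)
      · rcases min_choice (0 - ε / 2) (t - δ / 2) with h | h <;> rw [h] <;> assumption
      · rcases max_choice (0 + ε / 2) (t + δ / 2) with h | h <;> rw [h] <;> assumption
    obtain ⟨htab, hsub⟩ := habJ
    obtain ⟨C, hC⟩ := isCompact_Icc.bddAbove_image (hA.norm.mono hsub)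
    have hC' : ∀ t ∈ Icc a b, ‖A t‖ ≤ C := fun s hs => hC (mem_image_of_mem _ hs)
    have h0I : (0 : ℝ) ∈ Icc a b := Ioo_subset_Icc_self hab
    have hC0 : 0 ≤ C := (norm_nonneg _).trans (hC' 0 h0I)
    set M : ℝ := max |a| |b|
    have hM : ∀ s ∈ Icc a b, |s| ≤ M := fun s hs => abs_le_max_abs_abs hs.1 hs.2
    have hbd : ∀ n, ∀ s ∈ Icc a b, ‖peanoBaker A x₀ n s‖ ≤ (C * M) ^ n / n ! * ‖x₀‖ := by
      intro n s hs
      refine (norm_peanoBaker_le h0I hC' hC0 n s hs).trans ?_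
      gcongr
      exact hM s hs
    have hsum : Summable fun n : ℕ => (C * M) ^ n / n ! * ‖x₀‖ :=
      (Real.summable_pow_div_factorial _).mul_right _
    have hsumt : ∀ s ∈ Icc a b, Summable fun n => peanoBaker A x₀ n s := fun s hs =>
      .of_norm_bounded hsum fun n => hbd n s hs
    -- The term of index n+1 has derivative A applied to the term of index n. Differentiating the
    -- series without its constant term therefore gives A applied to the full series.
    have key := hasDerivAt_tsum_of_isPreconnected (𝕜 := ℝ)
      (g := fun n s => peanoBaker A x₀ (n + 1) s) (g' := fun n s => A s (peanoBaker A x₀ n s))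
      (hsum.mul_left C) isOpen_Ioo isPreconnected_Ioo (t := Ioo a b)
      (fun n s hs => hasDerivAt_integral_of_continuousOn hJ hJc hJ0
        (hA.clm_apply (continuousOn_peanoBaker hJ hJc hJ0 hA n)) (hsub (Ioo_subset_Icc_self hs)))
      (fun n s hs => ((A s).le_opNorm _).trans (by
        have hs' := Ioo_subset_Icc_self hs
        gcongr
        exacts [hC' s hs', hbd n s hs'])) hab
      ((summable_nat_add_iff 1).2 (hsumt 0 h0I)) htab
    have hmap : ∑' n, A t (peanoBaker A x₀ n t) = A t (∑' n, peanoBaker A x₀ n t) :=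
      ((A t).map_tsum (hsumt t (Ioo_subset_Icc_self htab))).symm
    rw [hmap] at key
    refine (key.const_add x₀).congr_of_eventuallyEq ?_
    filter_upwards [isOpen_Ioo.mem_nhds htab] with s hs
    rw [(hsumt s (Ioo_subset_Icc_self hs)).tsum_eq_zero_add]
    rfl

end LinearODE

end VectorNewton

/-! ### Vector algebra in ℝ³ and the constants of the motion. -/

namespace VectorNewton

open Set Filter Topology

section Wedge

theorem wedge_zero_apply (x y : E3) : wedge x y 0 = x 1 * y 2 - x 2 * y 1 := by
  simp [wedge, cross_apply]

theorem wedge_one_apply (x y : E3) : wedge x y 1 = x 2 * y 0 - x 0 * y 2 := by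
  simp [wedge, cross_apply]

theorem wedge_two_apply (x y : E3) : wedge x y 2 = x 0 * y 1 - x 1 * y 0 := by
  simp [wedge, cross_apply]

theorem ext_E3 {x y : E3} (h0 : x 0 = y 0) (h1 : x 1 = y 1) (h2 : x 2 = y 2) : x = y := by
  ext i
  fin_cases i <;> assumption

theorem inner_E3 (x y : E3) : inner ℝ x y = x 0 * y 0 + x 1 * y 1 + x 2 * y 2 := by
  simp [PiLp.inner_apply, Fin.sum_univ_three, mul_comm]

theorem inner_wedge_left (x y : E3) : inner ℝ x (wedge x y) = 0 := by
  rw [inner_E3, wedge_zero_apply, wedge_one_apply, wedge_two_apply]; ring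

theorem inner_wedge_right (x y : E3) : inner ℝ y (wedge x y) = 0 := by
  rw [inner_E3, wedge_zero_apply, wedge_one_apply, wedge_two_apply]; ring

theorem inner_wedge_wedge (x y : E3) :
    inner ℝ (wedge x y) (wedge x y) = inner ℝ x x * inner ℝ y y - inner ℝ x y ^ 2 := by
  simp only [inner_E3, wedge_zero_apply, wedge_one_apply, wedge_two_apply]; ring

/-- This expansion writes the derivative of r ∧ ṙ as a combination of r and ṙ, which closes the
linear system for r, ṙ, r ∧ ṙ. -/
theorem wedge_wedge (x y : E3) :
    wedge x (wedge x y) = inner ℝ x y • x - inner ℝ x x • y := by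
  apply ext_E3 <;>
  simp only [inner_E3, wedge_zero_apply, wedge_one_apply, wedge_two_apply, PiLp.sub_apply,
    PiLp.smul_apply, smul_eq_mul] <;> ring

theorem wedge_self (x : E3) : wedge x x = 0 := by
  simp [wedge]

/-- The vector product as a continuous bilinear map. -/
noncomputable def wedgeL : E3 →L[ℝ] E3 →L[ℝ] E3 :=
  LinearMap.toContinuousBilinearMap (LinearMap.mk₂ ℝ wedge
    (fun x y z => by simp [wedge]) (fun c x y => by simp [wedge])
    (fun x y z => by simp [wedge]) (fun c x y => by simp [wedge]))

theorem wedgeL_apply (x y : E3) : wedgeL x y = wedge x y := rfl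

theorem norm_wedge_le (x y : E3) : ‖wedge x y‖ ≤ ‖x‖ * ‖y‖ := by
  have h := inner_wedge_wedge x y
  rw [real_inner_self_eq_norm_sq, real_inner_self_eq_norm_sq, real_inner_self_eq_norm_sq] at h
  refine abs_le_of_sq_le_sq' ?_ (by positivity) |>.2
  nlinarith [sq_nonneg (inner ℝ x y)]

theorem hasDerivAt_wedge {x y : ℝ → E3} {x' y' : E3} {t : ℝ} (hx : HasDerivAt x x' t)
    (hy : HasDerivAt y y' t) :
    HasDerivAt (fun t => wedge (x t) (y t)) (wedge (x t) y' + wedge x' (y t)) t :=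
  wedgeL.hasDerivAt_of_bilinear (fun _ => hx) (fun _ => hy)

end Wedge

section Constants

variable {r₀ v₀ : E3}

theorem inner_self_chi (r₀ v₀ : E3) : inner ℝ (wedge r₀ v₀) (wedge r₀ v₀) =
    alpha r₀ * speed v₀ ^ 2 - beta r₀ v₀ ^ 2 := by
  rw [inner_wedge_wedge, real_inner_self_eq_norm_sq, real_inner_self_eq_norm_sq]
  rfl

theorem hasDerivAt_chi (r₀ v₀ : E3) (t : ℝ) :
    HasDerivAt (chi r₀ v₀) (2 * (beta r₀ v₀ + speed v₀ ^ 2 * t)) t := by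
  have h := (((hasDerivAt_id t).const_mul (2 * beta r₀ v₀)).const_add (alpha r₀)).add
    (((hasDerivAt_id t).pow 2).const_mul (speed v₀ ^ 2))
  refine (h.congr_deriv ?_).congr_of_eventuallyEq ?_
  · simp; ring
  · exact Eventually.of_forall fun s => by simp [chi]

theorem deriv_chi (r₀ v₀ : E3) (t : ℝ) :
    deriv (chi r₀ v₀) t = 2 * (beta r₀ v₀ + speed v₀ ^ 2 * t) := (hasDerivAt_chi r₀ v₀ t).deriv

theorem continuous_chi (r₀ v₀ : E3) : Continuous (chi r₀ v₀) := by
  unfold chi; fun_prop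

end Constants

/-! ### Conservation laws and the first-order form of the third-order equation. -/

variable {J : Set ℝ} {r₀ v₀ : E3}

/-- Functions with the same derivative on an open interval that agree at `0` agree. -/
theorem eq_of_hasDerivAt_of_eq_zero {E : Type*} [NormedAddCommGroup E] [NormedSpace ℝ E]
    (hJc : J.OrdConnected) (hJ0 : (0 : ℝ) ∈ J) {x y x' : ℝ → E}
    (hx : ∀ t ∈ J, HasDerivAt x (x' t) t) (hy : ∀ t ∈ J, HasDerivAt y (x' t) t)
    (h0 : x 0 = y 0) : ∀ t ∈ J, x t = y t := by
  intro t ht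
  refine sub_eq_zero.1 (eqOn_zero_of_norm_deriv_le hJc hJ0 (x := fun t => x t - y t)
    (x' := fun _ => 0) (K := fun _ => 0) continuousOn_const (fun s hs => ?_) (by simp)
    (sub_eq_zero.2 h0) t ht)
  simpa using! (hx s hs).sub (hy s hs)

/-- The conservation laws. -/
theorem motion_conservation (hJc : J.OrdConnected) (hJ0 : (0 : ℝ) ∈ J)
    {H : ℝ → ℝ → ℝ} {r : ℝ → E3} (hr : IsMotion H J r) (h0 : r 0 = r₀) (h1 : deriv r 0 = v₀) :
    ∀ t ∈ J, ‖deriv r t‖ = speed v₀ ∧ ‖r t‖ ^ 2 = chi r₀ v₀ t ∧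
        inner ℝ (r t) (deriv r t) = beta r₀ v₀ + speed v₀ ^ 2 * t := by
  -- The force is orthogonal to ṙ and to r. The three laws come in this order because the derivative
  -- of r·ṙ is |ṙ|² and that of |r|² is 2 r·ṙ.
  have hv : ∀ t ∈ J, inner ℝ (deriv r t) (deriv r t) = speed v₀ ^ 2 := by
    refine eq_of_hasDerivAt_of_eq_zero hJc hJ0 (x' := fun _ => 0) (fun t ht => ?_)
      (fun t _ => hasDerivAt_const t _) ?_
    · have := (hr t ht).2.inner ℝ (hr t ht).2
      rw [real_inner_comm, inner_smul_left, real_inner_comm, inner_wedge_right] at this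
      simpa using this
    · rw [h1, real_inner_self_eq_norm_sq]; rfl
  have hrv : ∀ t ∈ J, inner ℝ (r t) (deriv r t) = beta r₀ v₀ + speed v₀ ^ 2 * t := by
    refine eq_of_hasDerivAt_of_eq_zero hJc hJ0 (x' := fun _ => speed v₀ ^ 2) (fun t ht => ?_)
      (fun t _ => by
        simpa using ((hasDerivAt_id t).const_mul (speed v₀ ^ 2)).const_add (beta r₀ v₀)) ?_
    · have := (hr t ht).1.hasDerivAt.inner ℝ (hr t ht).2
      rw [inner_smul_right, inner_wedge_left, hv t ht] at this
      simpa using this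
    · simp [h0, h1, beta]
  have hrr : ∀ t ∈ J, inner ℝ (r t) (r t) = chi r₀ v₀ t := by
    refine eq_of_hasDerivAt_of_eq_zero hJc hJ0 (fun t ht => ?_)
      (fun t _ => hasDerivAt_chi r₀ v₀ t) ?_
    · have := (hr t ht).1.hasDerivAt.inner ℝ (hr t ht).1.hasDerivAt
      rw [real_inner_comm (r t) (deriv r t), hrv t ht] at this
      exact this.congr_deriv (by ring)
    · rw [h0, real_inner_self_eq_norm_sq]; simp [chi, alpha]
  intro t ht
  refine ⟨?_, ?_, hrv t ht⟩
  · have := hv t ht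
    rw [real_inner_self_eq_norm_sq] at this
    exact (sq_eq_sq₀ (norm_nonneg _) (norm_nonneg _)).1 this
  · rw [← hrr t ht, real_inner_self_eq_norm_sq]

/-- The third-order equation as a first-order system for `F`, `D = Ḟ` and `G = F̈ / h`. -/
def SolvesThirdSystem {E : Type*} [NormedAddCommGroup E] [NormedSpace ℝ E] (h : ℝ → ℝ)
    (r₀ v₀ : E3) (J : Set ℝ) (F D G : ℝ → E) : Prop :=
  ∀ t ∈ J, HasDerivAt F (D t) t ∧ HasDerivAt D (h t • G t) t ∧
    HasDerivAt G (h t • ((beta r₀ v₀ + speed v₀ ^ 2 * t) • F t - chi r₀ v₀ t • D t)) t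

section ThirdSystem

variable {E : Type*} [NormedAddCommGroup E] [NormedSpace ℝ E] {h : ℝ → ℝ}

theorem SolvesThirdSystem.sub {F D G F₁ D₁ G₁ : ℝ → E} (hF : SolvesThirdSystem h r₀ v₀ J F D G)
    (hF₁ : SolvesThirdSystem h r₀ v₀ J F₁ D₁ G₁) :
    SolvesThirdSystem h r₀ v₀ J (F - F₁) (D - D₁) (G - G₁) := by
  intro t ht
  obtain ⟨a1, a2, a3⟩ := hF t ht
  obtain ⟨b1, b2, b3⟩ := hF₁ t ht
  refine ⟨a1.sub b1, (a2.sub b2).congr_deriv ?_, (a3.sub b3).congr_deriv ?_⟩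
  · simp [smul_sub]
  · simp only [Pi.sub_apply, smul_sub]; abel

theorem SolvesThirdSystem.add {F D G F₁ D₁ G₁ : ℝ → E} (hF : SolvesThirdSystem h r₀ v₀ J F D G)
    (hF₁ : SolvesThirdSystem h r₀ v₀ J F₁ D₁ G₁) :
    SolvesThirdSystem h r₀ v₀ J (F + F₁) (D + D₁) (G + G₁) := by
  intro t ht
  obtain ⟨a1, a2, a3⟩ := hF t ht
  obtain ⟨b1, b2, b3⟩ := hF₁ t ht
  refine ⟨a1.add b1, (a2.add b2).congr_deriv ?_, (a3.add b3).congr_deriv ?_⟩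
  · simp [smul_add]
  · simp only [Pi.add_apply, smul_add, smul_sub]; abel

theorem SolvesThirdSystem.smul_const {F D G : ℝ → ℝ} (hF : SolvesThirdSystem h r₀ v₀ J F D G)
    (e : E) : SolvesThirdSystem h r₀ v₀ J (fun t => F t • e) (fun t => D t • e)
      (fun t => G t • e) := by
  intro t ht
  obtain ⟨a1, a2, a3⟩ := hF t ht
  refine ⟨a1.smul_const e, (a2.smul_const e).congr_deriv ?_, (a3.smul_const e).congr_deriv ?_⟩
  · simp [smul_smul]
  · simp only [smul_eq_mul, smul_smul, ← sub_smul]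

/-- Uniqueness for values in any normed space: it will be applied to the difference between a motion
and the combination of r₀, v₀, r₀ ∧ v₀. -/
theorem SolvesThirdSystem.eq_zero (hJc : J.OrdConnected) (hJ0 : (0 : ℝ) ∈ J)
    (hh : ContinuousOn h J) {F D G : ℝ → E} (hF : SolvesThirdSystem h r₀ v₀ J F D G)
    (h0 : F 0 = 0) (h1 : D 0 = 0) (h2 : G 0 = 0) :
    ∀ t ∈ J, F t = 0 ∧ D t = 0 ∧ G t = 0 := by
  intro t ht
  have := eqOn_zero_of_norm_deriv_le hJc hJ0 (x := fun t => (F t, D t, G t))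
    (x' := fun t => (D t, h t • G t,
      h t • ((beta r₀ v₀ + speed v₀ ^ 2 * t) • F t - chi r₀ v₀ t • D t)))
    -- A crude bound for the coefficient matrix in the maximum norm: each of the three components of
    -- the derivative is at most this multiple of the norm.
    (K := fun t => 1 + |h t| * (1 + |beta r₀ v₀ + speed v₀ ^ 2 * t| + |chi r₀ v₀ t|))
    ?_ (fun t ht => (hF t ht).1.prodMk ((hF t ht).2.1.prodMk (hF t ht).2.2)) ?_
    (by simp [h0, h1, h2]) t ht
  · simpa using this
  · have := (continuous_chi r₀ v₀).continuousOn (s := J)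
    fun_prop
  · intro t _
    set x : E × E × E := (F t, D t, G t) with hx
    have n1 : ‖F t‖ ≤ ‖x‖ := norm_fst_le x
    have n2 : ‖D t‖ ≤ ‖x‖ := (norm_fst_le x.2).trans (norm_snd_le x)
    have n3 : ‖G t‖ ≤ ‖x‖ := (norm_snd_le x.2).trans (norm_snd_le x)
    have p : 0 ≤ ‖x‖ := norm_nonneg x
    set c1 := beta r₀ v₀ + speed v₀ ^ 2 * t
    set c := chi r₀ v₀ t
    have q1 := abs_nonneg (h t)
    have q2 := abs_nonneg c1
    have q3 := abs_nonneg c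
    refine max_le ?_ (max_le ?_ ?_)
    · calc ‖D t‖ ≤ ‖x‖ := n2
        _ ≤ _ := le_mul_of_one_le_left p (by simp; positivity)
    · calc ‖h t • G t‖ ≤ |h t| * ‖x‖ := by rw [norm_smul, Real.norm_eq_abs]; gcongr
        _ ≤ _ := by gcongr; nlinarith [mul_nonneg q1 q2, mul_nonneg q1 q3]
    · calc ‖h t • (c1 • F t - c • D t)‖ ≤ |h t| * (|c1| * ‖x‖ + |c| * ‖x‖) := by
            rw [norm_smul, Real.norm_eq_abs]
            gcongr
            refine (norm_sub_le _ _).trans ?_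
            rw [norm_smul, norm_smul, Real.norm_eq_abs, Real.norm_eq_abs]
            gcongr
        _ = (|h t| * (|c1| + |c|)) * ‖x‖ := by ring
        _ ≤ _ := by gcongr; nlinarith

theorem exists_solvesThirdSystem (hJ : IsOpen J) (hJc : J.OrdConnected) (hJ0 : (0 : ℝ) ∈ J)
    (hh : ContinuousOn h J) (x₀ x₁ x₂ : ℝ) :
    ∃ F D G : ℝ → ℝ, SolvesThirdSystem h r₀ v₀ J F D G ∧ F 0 = x₀ ∧ D 0 = x₁ ∧ G 0 = x₂ := by
  let pF : ℝ × ℝ × ℝ →L[ℝ] ℝ := .fst ℝ ℝ (ℝ × ℝ)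
  let pD : ℝ × ℝ × ℝ →L[ℝ] ℝ := (ContinuousLinearMap.fst ℝ ℝ ℝ).comp (.snd ℝ ℝ (ℝ × ℝ))
  let pG : ℝ × ℝ × ℝ →L[ℝ] ℝ := (ContinuousLinearMap.snd ℝ ℝ ℝ).comp (.snd ℝ ℝ (ℝ × ℝ))
  let A : ℝ → ℝ × ℝ × ℝ →L[ℝ] ℝ × ℝ × ℝ := fun t => pD.prod 0 +
    h t • (ContinuousLinearMap.prod 0 (pG.prod 0) +
      (beta r₀ v₀ + speed v₀ ^ 2 * t) • ContinuousLinearMap.prod 0 (ContinuousLinearMap.prod 0 pF) -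
      chi r₀ v₀ t • ContinuousLinearMap.prod 0 (ContinuousLinearMap.prod 0 pD))
  have hA : ContinuousOn A J := by
    have := (continuous_chi r₀ v₀).continuousOn (s := J)
    fun_prop
  obtain ⟨x, hx0, hx⟩ := exists_solution_linear hJ hJc hJ0 hA (x₀, x₁, x₂)
  refine ⟨fun t => (x t).1, fun t => (x t).2.1, fun t => (x t).2.2, fun t ht => ?_, by simp [hx0],
    by simp [hx0], by simp [hx0]⟩
  have h1 := pF.hasFDerivAt.comp_hasDerivAt t (hx t ht)
  have h2 := pD.hasFDerivAt.comp_hasDerivAt t (hx t ht)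
  have h3 := pG.hasFDerivAt.comp_hasDerivAt t (hx t ht)
  refine ⟨h1.congr_deriv ?_, h2.congr_deriv ?_, h3.congr_deriv ?_⟩ <;>
    simp [A, pF, pD, pG]

end ThirdSystem

end VectorNewton

/-! ### Equivalence of the equation of motion with the third-order equation. -/

namespace VectorNewton

open Set Filter Topology

variable {J : Set ℝ} {r₀ v₀ : E3} {h : ℝ → ℝ}

/-- On an open set, the derivative of a function known there is locally the given one. -/
theorem deriv_eventuallyEq_of_isOpen {E : Type*} [NormedAddCommGroup E] [NormedSpace ℝ E]
    (hJ : IsOpen J) {x x' : ℝ → E} (hx : ∀ t ∈ J, HasDerivAt x (x' t) t) {t : ℝ} (ht : t ∈ J) :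
    deriv x =ᶠ[𝓝 t] x' := by
  filter_upwards [hJ.mem_nhds ht] with s hs using (hx s hs).deriv

/-- Dividing F̈ by h absorbs the term (ḣ/h)F̈, so the system contains no derivative of h. -/
theorem SolvesThirdOrder.system (hh : ∀ t ∈ J, DifferentiableAt ℝ h t ∧ h t ≠ 0)
    {x₀ x₁ x₂ : ℝ} {F : ℝ → ℝ} (hF : SolvesThirdOrder h r₀ v₀ J x₀ x₁ x₂ F) :
    SolvesThirdSystem h r₀ v₀ J F (deriv F) (fun t => deriv (deriv F) t / h t) := by
  intro t ht
  obtain ⟨h1, h2, h3⟩ := hF.1 t ht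
  have hne := (hh t ht).2
  refine ⟨h1.hasDerivAt, h2.hasDerivAt.congr_deriv ?_,
    (h3.div (hh t ht).1.hasDerivAt hne).congr_deriv ?_⟩
  · simp only [smul_eq_mul]; field_simp
  · simp only [smul_eq_mul, deriv_chi]; field_simp; ring

theorem SolvesThirdSystem.order (hJ : IsOpen J) (hJ0 : (0 : ℝ) ∈ J)
    (hh : ∀ t ∈ J, DifferentiableAt ℝ h t ∧ h t ≠ 0)
    {F D G : ℝ → ℝ} (hF : SolvesThirdSystem h r₀ v₀ J F D G) :
    SolvesThirdOrder h r₀ v₀ J (F 0) (D 0) (h 0 * G 0) F := by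
  have e1 : ∀ t ∈ J, deriv F =ᶠ[𝓝 t] D := fun t ht =>
    deriv_eventuallyEq_of_isOpen hJ (fun s hs => (hF s hs).1) ht
  have e2 : ∀ t ∈ J, deriv (deriv F) =ᶠ[𝓝 t] fun t => h t * G t := fun t ht =>
    ((e1 t ht).deriv).trans (deriv_eventuallyEq_of_isOpen hJ (fun s hs => (hF s hs).2.1) ht)
  refine ⟨fun t ht => ⟨(hF t ht).1.differentiableAt,
    (hF t ht).2.1.differentiableAt.congr_of_eventuallyEq (e1 t ht), ?_⟩, rfl,
    (e1 0 hJ0).self_of_nhds, (e2 0 hJ0).self_of_nhds⟩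
  refine (((hh t ht).1.hasDerivAt.mul (hF t ht).2.2).congr_deriv ?_).congr_of_eventuallyEq (e2 t ht)
  rw [(e2 t ht).self_of_nhds, (e1 t ht).self_of_nhds, deriv_chi]
  have hne := (hh t ht).2
  simp only [smul_eq_mul]
  field_simp

/-- The derivative of r ∧ ṙ is h r ∧ (r ∧ ṙ) = h[(r·ṙ)r - |r|²ṙ], and the conservation laws turn its
coefficients into known functions of t. -/
theorem IsMotion.system (hJc : J.OrdConnected) (hJ0 : (0 : ℝ) ∈ J)
    {H : ℝ → ℝ → ℝ} (hH : ∀ t, h t = H t (chi r₀ v₀ t)) {r : ℝ → E3} (hr : IsMotion H J r)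
    (h0 : r 0 = r₀) (h1 : deriv r 0 = v₀) :
    SolvesThirdSystem h r₀ v₀ J r (deriv r) (fun t => wedge (r t) (deriv r t)) := by
  intro t ht
  obtain ⟨-, c2, c3⟩ := motion_conservation hJc hJ0 hr h0 h1 t ht
  obtain ⟨d1, d2⟩ := hr t ht
  rw [c2, ← hH t] at d2
  refine ⟨d1.hasDerivAt, d2, (hasDerivAt_wedge d1.hasDerivAt d2).congr_deriv ?_⟩
  rw [wedge_self, add_zero, ← wedgeL_apply, map_smul, wedgeL_apply, wedge_wedge, c3,
    real_inner_self_eq_norm_sq, c2]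

/-- The bound of the linear system for the deviations of the Gram matrix of `F, D, G`. -/
theorem gram_bound {η c₁ c p q s u v w N : ℝ} (hp : |p| ≤ N) (hq : |q| ≤ N) (hs : |s| ≤ N)
    (hu : |u| ≤ N) (hv : |v| ≤ N) (hw : |w| ≤ N) :
    |2 * q| ≤ (2 + 2 * |η| * (1 + |c₁| + |c|)) * N ∧
    |s + η * u| ≤ (2 + 2 * |η| * (1 + |c₁| + |c|)) * N ∧
    |2 * (η * v)| ≤ (2 + 2 * |η| * (1 + |c₁| + |c|)) * N ∧
    |v + η * (c₁ * p - c * q)| ≤ (2 + 2 * |η| * (1 + |c₁| + |c|)) * N ∧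
    |η * w + η * (c₁ * q - c * s)| ≤ (2 + 2 * |η| * (1 + |c₁| + |c|)) * N ∧
    |2 * (η * (c₁ * u - c * v))| ≤ (2 + 2 * |η| * (1 + |c₁| + |c|)) * N := by
  have hN : 0 ≤ N := (abs_nonneg _).trans hp
  have m : ∀ a x : ℝ, |x| ≤ N → |a * x| ≤ |a| * N := fun a x hx => by
    rw [abs_mul]; gcongr
  have m1 : ∀ x : ℝ, |x| ≤ N → |η * x| ≤ |η| * N := m η
  have m2 : ∀ x y : ℝ, |x| ≤ N → |y| ≤ N → |η * (c₁ * x - c * y)| ≤ |η| * |c₁| * N + |η| * |c| * N :=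
    fun x y hx hy => by
      rw [mul_sub, ← mul_assoc, ← mul_assoc]
      refine (abs_sub _ _).trans ?_
      have := m (η * c₁) x hx
      have := m (η * c) y hy
      rw [abs_mul η] at *
      linarith
  have e0 : 0 ≤ |η| * N := by positivity
  have e1 : 0 ≤ |η| * |c₁| * N := by positivity
  have e2 : 0 ≤ |η| * |c| * N := by positivity
  have e : (2 + 2 * |η| * (1 + |c₁| + |c|)) * N =
    2 * N + 2 * (|η| * N) + 2 * (|η| * |c₁| * N) + 2 * (|η| * |c| * N) := by ring
  rw [e]
  refine ⟨?_, ?_, ?_, ?_, ?_, ?_⟩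
  · rw [abs_mul, abs_two]; linarith
  · refine (abs_add_le _ _).trans ?_
    linarith [m1 u hu]
  · rw [abs_mul, abs_two]; linarith [m1 v hv]
  · refine (abs_add_le _ _).trans ?_
    linarith [m2 p q hp hq]
  · refine (abs_add_le _ _).trans ?_
    linarith [m1 w hw, m2 q s hq hs]
  · rw [abs_mul, abs_two]; linarith [m2 u v hu hv]

/-- The six inner products of F, D, G satisfy a linear system of their own. Their expected values χ,
β + b²t, b², 0, 0, αb² - β² also satisfy it, since χb² - (β + b²t)² is the constant αb² - β². The
deviations thus solve a homogeneous system with zero initial data. -/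
theorem SolvesThirdSystem.gram (hJc : J.OrdConnected) (hJ0 : (0 : ℝ) ∈ J)
    (hh : ContinuousOn h J) {F D G : ℝ → E3} (hF : SolvesThirdSystem h r₀ v₀ J F D G)
    (h0 : F 0 = r₀) (h1 : D 0 = v₀) (h2 : G 0 = wedge r₀ v₀) :
    ∀ t ∈ J, inner ℝ (F t) (F t) = chi r₀ v₀ t ∧
      inner ℝ (F t) (D t) = beta r₀ v₀ + speed v₀ ^ 2 * t := by
  intro t ht
  have := eqOn_zero_of_norm_deriv_le hJc hJ0
    (x := fun t => (inner ℝ (F t) (F t) - chi r₀ v₀ t,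
      inner ℝ (F t) (D t) - (beta r₀ v₀ + speed v₀ ^ 2 * t),
      inner ℝ (D t) (D t) - speed v₀ ^ 2, inner ℝ (F t) (G t), inner ℝ (D t) (G t),
      inner ℝ (G t) (G t) - (alpha r₀ * speed v₀ ^ 2 - beta r₀ v₀ ^ 2)))
    (x' := fun t =>
      (2 * (inner ℝ (F t) (D t) - (beta r₀ v₀ + speed v₀ ^ 2 * t)),
       inner ℝ (D t) (D t) - speed v₀ ^ 2 + h t * inner ℝ (F t) (G t),
       2 * (h t * inner ℝ (D t) (G t)),
       inner ℝ (D t) (G t) + h t * ((beta r₀ v₀ + speed v₀ ^ 2 * t) *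
        (inner ℝ (F t) (F t) - chi r₀ v₀ t) - chi r₀ v₀ t *
          (inner ℝ (F t) (D t) - (beta r₀ v₀ + speed v₀ ^ 2 * t))),
       h t * (inner ℝ (G t) (G t) - (alpha r₀ * speed v₀ ^ 2 - beta r₀ v₀ ^ 2)) +
        h t * ((beta r₀ v₀ + speed v₀ ^ 2 * t) *
          (inner ℝ (F t) (D t) - (beta r₀ v₀ + speed v₀ ^ 2 * t)) - chi r₀ v₀ t *
          (inner ℝ (D t) (D t) - speed v₀ ^ 2)),
       2 * (h t * ((beta r₀ v₀ + speed v₀ ^ 2 * t) * inner ℝ (F t) (G t) -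
        chi r₀ v₀ t * inner ℝ (D t) (G t)))))
    (K := fun t => 2 + 2 * |h t| * (1 + |beta r₀ v₀ + speed v₀ ^ 2 * t| + |chi r₀ v₀ t|))
    ?_ ?_ ?_ ?_ t ht
  · simp only [Prod.mk_eq_zero] at this
    exact ⟨sub_eq_zero.1 this.1, sub_eq_zero.1 this.2.1⟩
  · have := (continuous_chi r₀ v₀).continuousOn (s := J)
    fun_prop
  · intro t ht
    obtain ⟨a1, a2, a3⟩ := hF t ht
    refine ((a1.inner ℝ a1).sub (hasDerivAt_chi r₀ v₀ t) |>.congr_deriv ?_).prodMk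
      (((a1.inner ℝ a2).sub (((hasDerivAt_id t).const_mul _).const_add _) |>.congr_deriv ?_).prodMk
      (((a2.inner ℝ a2).sub_const _ |>.congr_deriv ?_).prodMk
      ((a1.inner ℝ a3 |>.congr_deriv ?_).prodMk
      ((a2.inner ℝ a3 |>.congr_deriv ?_).prodMk
      ((a3.inner ℝ a3).sub_const _ |>.congr_deriv ?_)))))
    all_goals
      simp only [inner_smul_right, inner_smul_left, inner_sub_right, inner_sub_left,
        real_inner_comm (F t) (D t), real_inner_comm (F t) (G t), real_inner_comm (D t) (G t),
        chi, RCLike.conj_to_real]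
      ring
  · intro t _
    set N := ‖(inner ℝ (F t) (F t) - chi r₀ v₀ t,
      inner ℝ (F t) (D t) - (beta r₀ v₀ + speed v₀ ^ 2 * t),
      inner ℝ (D t) (D t) - speed v₀ ^ 2, inner ℝ (F t) (G t), inner ℝ (D t) (G t),
      inner ℝ (G t) (G t) - (alpha r₀ * speed v₀ ^ 2 - beta r₀ v₀ ^ 2))‖ with hN
    have hle := hN.ge
    simp only [Prod.norm_mk, sup_le_iff, Real.norm_eq_abs] at hle
    obtain ⟨n1, n2, n3, n4, n5, n6⟩ := hle
    obtain ⟨k1, k2, k3, k4, k5, k6⟩ := gram_bound (η := h t)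
      (c₁ := beta r₀ v₀ + speed v₀ ^ 2 * t) (c := chi r₀ v₀ t) n1 n2 n3 n4 n5 n6
    exact max_le k1 (max_le k2 (max_le k3 (max_le k4 (max_le k5 k6))))
  · simp only [h0, h1, h2, inner_wedge_left, inner_wedge_right, inner_self_chi]
    simp [chi, alpha, beta, speed]

/-- With the Gram matrix known, (β + b²t)F - χD = F ∧ (F ∧ D). Hence the difference Δ = G - F ∧ D
satisfies Δ' = -h F ∧ Δ, and it vanishes at 0. -/
theorem SolvesThirdSystem.eq_wedge (hJc : J.OrdConnected) (hJ0 : (0 : ℝ) ∈ J)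
    (hh : ContinuousOn h J) {F D G : ℝ → E3} (hF : SolvesThirdSystem h r₀ v₀ J F D G)
    (h0 : F 0 = r₀) (h1 : D 0 = v₀) (h2 : G 0 = wedge r₀ v₀) :
    ∀ t ∈ J, G t = wedge (F t) (D t) := by
  intro t ht
  refine sub_eq_zero.1 (eqOn_zero_of_norm_deriv_le hJc hJ0
    (x := fun t => G t - wedge (F t) (D t))
    (x' := fun t => -(h t • wedge (F t) (G t - wedge (F t) (D t))))
    (K := fun t => |h t| * ‖F t‖) ?_ ?_ ?_ (by simp [h0, h1, h2]) t ht)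
  · have : ContinuousOn F J := fun t ht => (hF t ht).1.continuousAt.continuousWithinAt
    fun_prop
  · intro t ht
    obtain ⟨a1, a2, a3⟩ := hF t ht
    obtain ⟨g1, g2⟩ := hF.gram hJc hJ0 hh h0 h1 h2 t ht
    refine (a3.sub (hasDerivAt_wedge a1 a2)).congr_deriv ?_
    rw [wedge_self, add_zero, ← g1, ← g2, ← wedge_wedge]
    simp only [← wedgeL_apply, map_smul, map_sub, smul_sub]
    abel
  · intro t _
    rw [norm_neg, norm_smul, mul_assoc, Real.norm_eq_abs]
    gcongr
    exact norm_wedge_le _ _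

/-- The motions are the combinations of the three basic solutions of the third-order equation. -/
theorem motion_iff (hJ : IsOpen J) (hJc : J.OrdConnected) (hJ0 : (0 : ℝ) ∈ J)
    {H : ℝ → ℝ → ℝ} (hH : ∀ t, h t = H t (chi r₀ v₀ t))
    (hh : ∀ t ∈ J, DifferentiableAt ℝ h t ∧ h t ≠ 0) {F₀ F₁ F₂ : ℝ → ℝ}
    (hF₀ : SolvesThirdOrder h r₀ v₀ J 1 0 0 F₀) (hF₁ : SolvesThirdOrder h r₀ v₀ J 0 1 0 F₁)
    (hF₂ : SolvesThirdOrder h r₀ v₀ J 0 0 (h 0) F₂) (r : ℝ → E3) :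
    (IsMotion H J r ∧ r 0 = r₀ ∧ deriv r 0 = v₀) ↔
      ∀ t ∈ J, r t = F₀ t • r₀ + F₁ t • v₀ + F₂ t • wedge r₀ v₀ := by
  have hc : ContinuousOn h J := fun t ht => (hh t ht).1.continuousAt.continuousWithinAt
  have hR := (((hF₀.system hh).smul_const r₀).add ((hF₁.system hh).smul_const v₀)).add
    ((hF₂.system hh).smul_const (wedge r₀ v₀))
  obtain ⟨-, a0, a1, a2⟩ := hF₀
  obtain ⟨-, b0, b1, b2⟩ := hF₁
  obtain ⟨-, c0, c1, c2⟩ := hF₂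
  have hne := (hh 0 hJ0).2
  constructor
  · rintro ⟨hr, h0, h1⟩ t ht
    have := (hR.sub (hr.system hJc hJ0 hH h0 h1)).eq_zero hJc hJ0 hc
      (by simp [a0, b0, c0, h0]) (by simp [a1, b1, c1, h1])
      (by simp [a2, b2, c2, h0, h1, hne]) t ht
    exact (sub_eq_zero.1 this.1).symm
  · intro hr
    -- The representation fixes r only on J; since J is open, equality holds near each point and
    -- passes to the derivatives.
    have e0 : ∀ t ∈ J, r =ᶠ[𝓝 t] fun t => F₀ t • r₀ + F₁ t • v₀ + F₂ t • wedge r₀ v₀ :=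
      fun t ht => by filter_upwards [hJ.mem_nhds ht] with s hs using hr s hs
    have e1 : ∀ t ∈ J, deriv r =ᶠ[𝓝 t]
        fun t => deriv F₀ t • r₀ + deriv F₁ t • v₀ + deriv F₂ t • wedge r₀ v₀ :=
      fun t ht => (e0 t ht).deriv.trans
        (deriv_eventuallyEq_of_isOpen hJ (fun s hs => (hR s hs).1) ht)
    have i0 : F₀ 0 • r₀ + F₁ 0 • v₀ + F₂ 0 • wedge r₀ v₀ = r₀ := by simp [a0, b0, c0]
    have i1 : deriv F₀ 0 • r₀ + deriv F₁ 0 • v₀ + deriv F₂ 0 • wedge r₀ v₀ = v₀ := by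
      simp [a1, b1, c1]
    have i2 : (deriv (deriv F₀) 0 / h 0) • r₀ + (deriv (deriv F₁) 0 / h 0) • v₀ +
      (deriv (deriv F₂) 0 / h 0) • wedge r₀ v₀ = wedge r₀ v₀ := by simp [a2, b2, c2, hne]
    refine ⟨fun t ht => ?_, (e0 0 hJ0).self_of_nhds.trans i0,
      (e1 0 hJ0).self_of_nhds.trans i1⟩
    have g1 := (hR.gram hJc hJ0 hc i0 i1 i2 t ht).1
    have g2 := hR.eq_wedge hJc hJ0 hc i0 i1 i2 t ht
    refine ⟨(hR t ht).1.differentiableAt.congr_of_eventuallyEq (e0 t ht),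
      ((hR t ht).2.1.congr_deriv ?_).congr_of_eventuallyEq (e1 t ht)⟩
    rw [g2, ← real_inner_self_eq_norm_sq, (e0 t ht).self_of_nhds, (e1 t ht).self_of_nhds, hH t]
    exact congrArg₂ _ (congrArg _ g1.symm) rfl

theorem exists_solvesThirdOrder (hJ : IsOpen J) (hJc : J.OrdConnected) (hJ0 : (0 : ℝ) ∈ J)
    (hh : ∀ t ∈ J, DifferentiableAt ℝ h t ∧ h t ≠ 0) (x₀ x₁ x₂ : ℝ) :
    ∃ F : ℝ → ℝ, SolvesThirdOrder h r₀ v₀ J x₀ x₁ x₂ F := by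
  -- The third unknown of the system is F̈/h, hence the initial value x₂ / h(0).
  obtain ⟨F, D, G, hF, rfl, rfl, h2⟩ := exists_solvesThirdSystem (r₀ := r₀) (v₀ := v₀) hJ hJc hJ0
    (fun t ht => (hh t ht).1.continuousAt.continuousWithinAt) x₀ x₁ (x₂ / h 0)
  have := hF.order hJ hJ0 hh
  rw [h2, mul_div_cancel₀ _ (hh 0 hJ0).2] at this
  exact ⟨F, this⟩

end VectorNewton

/-! ### The spinor system for (f, g) and its equivalence with the second-order equation. -/

namespace VectorNewton

open Set Filter Topology Complex ComplexConjugate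

variable {J : Set ℝ} {r₀ v₀ : E3} {h : ℝ → ℝ}

section NonDegenerate

theorem speed_pos (hw : wedge r₀ v₀ ≠ 0) : 0 < speed v₀ := by
  refine norm_pos_iff.2 fun h0 => hw ?_
  rw [h0, ← wedgeL_apply, map_zero]

theorem parC_pos (hw : wedge r₀ v₀ ≠ 0) : 0 < parC r₀ v₀ := div_pos (norm_pos_iff.2 hw) (speed_pos hw)

theorem speed_mul_parA (hw : wedge r₀ v₀ ≠ 0) : speed v₀ * parA r₀ v₀ = beta r₀ v₀ :=
  mul_div_cancel₀ _ (speed_pos hw).ne'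

theorem parC_sq_add_parA_sq (hw : wedge r₀ v₀ ≠ 0) :
    parC r₀ v₀ ^ 2 + parA r₀ v₀ ^ 2 = alpha r₀ := by
  have h1 := inner_self_chi r₀ v₀
  rw [real_inner_self_eq_norm_sq] at h1
  have := (speed_pos hw).ne'
  rw [parC, parA, div_pow, h1]
  field_simp
  ring

/-- Completing the square; Lagrange's identity identifies the remainder as c². This makes χ positive
and is the relation M² = χ for the matrix of the spinor system. -/
theorem chi_eq (hw : wedge r₀ v₀ ≠ 0) (t : ℝ) :
    chi r₀ v₀ t = parC r₀ v₀ ^ 2 + (parA r₀ v₀ + speed v₀ * t) ^ 2 := by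
  rw [chi, ← parC_sq_add_parA_sq hw, ← speed_mul_parA hw]; ring

theorem chi_pos (hw : wedge r₀ v₀ ≠ 0) (t : ℝ) : 0 < chi r₀ v₀ t := by
  rw [chi_eq hw]
  have := parC_pos hw
  positivity

end NonDegenerate

theorem chi_zero (r₀ v₀ : E3) : chi r₀ v₀ 0 = alpha r₀ := by simp [chi]

/-- The coefficient operator of the first-order system for `(f, g)`. -/
noncomputable def systemOp (h : ℝ → ℝ) (r₀ v₀ : E3) (t : ℝ) : ℂ × ℂ →L[ℝ] ℂ × ℂ :=
  (I * ((h t : ℂ) / 2)) • (((parA r₀ v₀ + speed v₀ * t : ℝ) : ℂ) •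
      (ContinuousLinearMap.fst ℝ ℂ ℂ).prod (-ContinuousLinearMap.snd ℝ ℂ ℂ) +
    (parC r₀ v₀ : ℂ) • (ContinuousLinearMap.snd ℝ ℂ ℂ).prod (ContinuousLinearMap.fst ℝ ℂ ℂ))

theorem systemOp_apply (h : ℝ → ℝ) (r₀ v₀ : E3) (t : ℝ) (z w : ℂ) :
    systemOp h r₀ v₀ t (z, w) =
      (I * ((h t : ℂ) / 2) * (((parA r₀ v₀ + speed v₀ * t : ℝ) : ℂ) * z + parC r₀ v₀ * w),
       I * ((h t : ℂ) / 2) * (-((parA r₀ v₀ + speed v₀ * t : ℝ) : ℂ) * w + parC r₀ v₀ * z)) := by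
  ext <;> simp [systemOp] <;> ring

theorem continuousOn_systemOp (hh : ContinuousOn h J) :
    ContinuousOn (systemOp h r₀ v₀) J := by
  have h1 : ContinuousOn (fun t => (h t : ℂ)) J := continuous_ofReal.comp_continuousOn hh
  have h2 : Continuous fun t : ℝ => ((parA r₀ v₀ + speed v₀ * t : ℝ) : ℂ) := by fun_prop
  unfold systemOp
  exact (continuousOn_const.mul (h1.div_const 2)).smul
    ((h2.continuousOn.smul continuousOn_const).add continuousOn_const)

theorem exists_solvesSystem (hJ : IsOpen J) (hJc : J.OrdConnected) (hJ0 : (0 : ℝ) ∈ J)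
    (hh : ContinuousOn h J) : ∃ f g : ℝ → ℂ, SolvesSystem h r₀ v₀ J f g := by
  obtain ⟨x, hx0, hx⟩ := exists_solution_linear hJ hJc hJ0
    (continuousOn_systemOp (r₀ := r₀) (v₀ := v₀) hh) (1, 0)
  refine ⟨fun t => (x t).1, fun t => (x t).2, fun t ht => ?_, by simp [hx0], by simp [hx0]⟩
  have h1 := (ContinuousLinearMap.fst ℝ ℂ ℂ).hasFDerivAt.comp_hasDerivAt t (hx t ht)
  have h2 := (ContinuousLinearMap.snd ℝ ℂ ℂ).hasFDerivAt.comp_hasDerivAt t (hx t ht)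
  rw [← Prod.mk.eta (p := x t), systemOp_apply] at h1 h2
  exact ⟨h1, h2⟩

theorem SolvesSystem.eqOn (hJc : J.OrdConnected) (hJ0 : (0 : ℝ) ∈ J)
    (hh : ContinuousOn h J) {f g f₁ g₁ : ℝ → ℂ} (hf : SolvesSystem h r₀ v₀ J f g)
    (hf₁ : SolvesSystem h r₀ v₀ J f₁ g₁) : EqOn f f₁ J := by
  have := eqOn_of_linear hJc hJ0 (continuousOn_systemOp (r₀ := r₀) (v₀ := v₀) hh)
    (x := fun t => (f t, g t)) (y := fun t => (f₁ t, g₁ t))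
    (fun t ht => by rw [systemOp_apply]; exact (hf.1 t ht).1.prodMk (hf.1 t ht).2)
    (fun t ht => by rw [systemOp_apply]; exact (hf₁.1 t ht).1.prodMk (hf₁.1 t ht).2)
    (by simp [hf.2.1, hf.2.2, hf₁.2.1, hf₁.2.2])
  exact fun t ht => congrArg Prod.fst (this ht)

theorem hasDerivAt_affine_ofReal (a b t : ℝ) :
    HasDerivAt (fun t : ℝ => ((a + b * t : ℝ) : ℂ)) (b : ℂ) t := by
  have h1 : HasDerivAt (fun t : ℝ => a + b * t) b t := by
    simpa using ((hasDerivAt_id t).const_mul b).const_add a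
  exact h1.ofReal_comp

/-- The companion g is the first equation of the system solved for g. The second equation comes from
differentiating this g and inserting the second-order equation with χ = c² + (a+bt)². -/
theorem IsGenerating.solvesSystem (hJ : IsOpen J) (hJ0 : (0 : ℝ) ∈ J) (hw : wedge r₀ v₀ ≠ 0)
    (hh : ∀ t ∈ J, DifferentiableAt ℝ h t ∧ h t ≠ 0) {f g : ℝ → ℂ}
    (hf : IsGenerating h r₀ v₀ J f) (hg : EqOn g (companion h r₀ v₀ f) J) :
    SolvesSystem h r₀ v₀ J f g := by
  obtain ⟨hf, h0, h1⟩ := hf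
  have hc : (parC r₀ v₀ : ℂ) ≠ 0 := ofReal_ne_zero.2 (parC_pos hw).ne'
  refine ⟨fun t ht => ?_, h0, ?_⟩
  · have hne : (h t : ℂ) ≠ 0 := ofReal_ne_zero.2 (hh t ht).2
    obtain ⟨d1, d2⟩ := hf t ht
    have hd1 := d1.hasDerivAt
    refine ⟨hd1.congr_deriv ?_, ?_⟩
    · rw [hg ht, companion]
      field_simp
      linear_combination 2 * deriv f t * I_sq
    · have hgt : g =ᶠ[𝓝 t] companion h r₀ v₀ f := by
        filter_upwards [hJ.mem_nhds ht] with s hs using hg hs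
      have hs := hasDerivAt_affine_ofReal (parA r₀ v₀) (speed v₀) t
      have hh' : HasDerivAt (fun t => (h t : ℂ)) ((deriv h t : ℝ) : ℂ) t :=
        (hh t ht).1.hasDerivAt.ofReal_comp
      have hk : HasDerivAt (fun t => I * (2 / (h t : ℂ))) 
          (I * (-(2 * ((deriv h t : ℝ) : ℂ)) / (h t : ℂ) ^ 2)) t := by
        have := ((hasDerivAt_const t (2 : ℂ)).div hh' hne).const_mul I
        exact this.congr_deriv (by ring)
      refine ((((hs.mul hd1).add (hk.mul d2)).neg.div_const (parC r₀ v₀ : ℂ)).congr_deriv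
        ?_).congr_of_eventuallyEq hgt
      rw [hg ht, companion, chi_eq hw]
      push_cast
      field_simp
      ring_nf
      simp only [I_sq]
      ring
  · rw [hg hJ0, companion, h0, h1]
    have hne : (h 0 : ℂ) ≠ 0 := ofReal_ne_zero.2 (hh 0 hJ0).2
    field_simp
    push_cast
    linear_combination (-(parA r₀ v₀ : ℂ)) * I_sq

/-- Differentiating the first equation and using the second, the matrix acts twice and gives -χh²/4,
while the derivative b of a + bt leaves ibh/2. -/
theorem SolvesSystem.isGenerating (hJ : IsOpen J) (hJ0 : (0 : ℝ) ∈ J) (hw : wedge r₀ v₀ ≠ 0)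
    (hh : ∀ t ∈ J, DifferentiableAt ℝ h t ∧ h t ≠ 0) {f g : ℝ → ℂ}
    (hf : SolvesSystem h r₀ v₀ J f g) :
    IsGenerating h r₀ v₀ J f ∧ EqOn g (companion h r₀ v₀ f) J := by
  have hc : (parC r₀ v₀ : ℂ) ≠ 0 := ofReal_ne_zero.2 (parC_pos hw).ne'
  have hd : ∀ t ∈ J, deriv f t = I * ((h t : ℂ) / 2) *
      (((parA r₀ v₀ + speed v₀ * t : ℝ) : ℂ) * f t + parC r₀ v₀ * g t) :=
    fun t ht => (hf.1 t ht).1.deriv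
  refine ⟨⟨fun t ht => ⟨(hf.1 t ht).1.differentiableAt, ?_⟩, hf.2.1, ?_⟩, fun t ht => ?_⟩
  · have hne : (h t : ℂ) ≠ 0 := ofReal_ne_zero.2 (hh t ht).2
    have hs := hasDerivAt_affine_ofReal (parA r₀ v₀) (speed v₀) t
    have hh' : HasDerivAt (fun t => (h t : ℂ)) ((deriv h t : ℝ) : ℂ) t :=
      (hh t ht).1.hasDerivAt.ofReal_comp
    have hk := ((hh'.div_const 2).const_mul I).mul
      ((hs.mul (hf.1 t ht).1).add ((hf.1 t ht).2.const_mul (parC r₀ v₀ : ℂ)))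
    refine (hk.congr_deriv ?_).congr_of_eventuallyEq
      (deriv_eventuallyEq_of_isOpen hJ (fun s hs => (hf.1 s hs).1) ht)
    rw [hd t ht, chi_eq hw]
    simp only [Pi.add_apply, Pi.mul_apply]
    push_cast
    field_simp
    ring_nf
    simp only [I_sq]
    ring
  · rw [hd 0 hJ0, hf.2.1, hf.2.2]
    push_cast
    ring
  · have hne : (h t : ℂ) ≠ 0 := ofReal_ne_zero.2 (hh t ht).2
    rw [companion, hd t ht]
    field_simp
    ring_nf
    simp only [I_sq]
    ring

theorem solvesSystem_iff (hJ : IsOpen J) (hJ0 : (0 : ℝ) ∈ J) (hw : wedge r₀ v₀ ≠ 0)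
    (hh : ∀ t ∈ J, DifferentiableAt ℝ h t ∧ h t ≠ 0) (f g : ℝ → ℂ) :
    SolvesSystem h r₀ v₀ J f g ↔
      IsGenerating h r₀ v₀ J f ∧ EqOn g (companion h r₀ v₀ f) J :=
  ⟨fun hf => hf.isGenerating hJ hJ0 hw hh, fun hf => hf.1.solvesSystem hJ hJ0 hw hh hf.2⟩

theorem IsGenerating.eqOn (hJ : IsOpen J) (hJc : J.OrdConnected) (hJ0 : (0 : ℝ) ∈ J)
    (hw : wedge r₀ v₀ ≠ 0) (hh : ∀ t ∈ J, DifferentiableAt ℝ h t ∧ h t ≠ 0) {f₁ f₂ : ℝ → ℂ}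
    (h₁ : IsGenerating h r₀ v₀ J f₁) (h₂ : IsGenerating h r₀ v₀ J f₂) : EqOn f₁ f₂ J :=
  (h₁.solvesSystem hJ hJ0 hw hh (eqOn_refl _ _)).eqOn hJc hJ0
    (fun t ht => (hh t ht).1.continuousAt.continuousWithinAt)
    (h₂.solvesSystem hJ hJ0 hw hh (eqOn_refl _ _))

theorem IsGenerating.congr (hJ : IsOpen J) (hJ0 : (0 : ℝ) ∈ J) {f₁ f₂ : ℝ → ℂ}
    (h₁ : IsGenerating h r₀ v₀ J f₁) (he : EqOn f₂ f₁ J) : IsGenerating h r₀ v₀ J f₂ := by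
  have e0 : ∀ t ∈ J, f₂ =ᶠ[𝓝 t] f₁ := fun t ht => by
    filter_upwards [hJ.mem_nhds ht] with s hs using he hs
  refine ⟨fun t ht => ⟨(h₁.1 t ht).1.congr_of_eventuallyEq (e0 t ht), ?_⟩, ?_, ?_⟩
  · rw [he ht, (e0 t ht).deriv_eq]
    exact (h₁.1 t ht).2.congr_of_eventuallyEq (e0 t ht).deriv
  · rw [he hJ0, h₁.2.1]
  · rw [(e0 0 hJ0).deriv_eq, h₁.2.2]

/-- Once one generating function is known, the generating functions are those that agree with it. -/
theorem isGenerating_iff_eqOn (hJ : IsOpen J) (hJc : J.OrdConnected) (hJ0 : (0 : ℝ) ∈ J)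
    (hw : wedge r₀ v₀ ≠ 0) (hh : ∀ t ∈ J, DifferentiableAt ℝ h t ∧ h t ≠ 0) {f₁ : ℝ → ℂ}
    (h₁ : IsGenerating h r₀ v₀ J f₁) (f : ℝ → ℂ) :
    IsGenerating h r₀ v₀ J f ↔ ∀ t ∈ J, f t = f₁ t :=
  ⟨fun hf => hf.eqOn hJ hJc hJ0 hw hh h₁, fun he => h₁.congr hJ hJ0 he⟩

end VectorNewton

/-! ### The functions F₀, F₁, F₂ as quadratic expressions in the spinor. -/

namespace VectorNewton

open Set Filter Topology Complex ComplexConjugate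

variable {J : Set ℝ} {r₀ v₀ : E3} {h : ℝ → ℝ}

/-- The first-order system in terms of real and imaginary parts. -/
theorem SolvesSystem.hasDerivAt_parts {f g : ℝ → ℂ} (hf : SolvesSystem h r₀ v₀ J f g) {t : ℝ}
    (ht : t ∈ J) :
    HasDerivAt (fun t => (f t).re)
      (-(h t / 2) * ((parA r₀ v₀ + speed v₀ * t) * (f t).im + parC r₀ v₀ * (g t).im)) t ∧
    HasDerivAt (fun t => (f t).im)
      (h t / 2 * ((parA r₀ v₀ + speed v₀ * t) * (f t).re + parC r₀ v₀ * (g t).re)) t ∧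
    HasDerivAt (fun t => (g t).re)
      (-(h t / 2) * (-(parA r₀ v₀ + speed v₀ * t) * (g t).im + parC r₀ v₀ * (f t).im)) t ∧
    HasDerivAt (fun t => (g t).im)
      (h t / 2 * (-(parA r₀ v₀ + speed v₀ * t) * (g t).re + parC r₀ v₀ * (f t).re)) t := by
  obtain ⟨h1, h2⟩ := hf.1 t ht
  have e : I * ((h t : ℂ) / 2) = I * ((h t / 2 : ℝ) : ℂ) := by push_cast; ring
  rw [e] at h1 h2
  refine ⟨(reCLM.hasFDerivAt.comp_hasDerivAt t h1).congr_deriv ?_,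
    (imCLM.hasFDerivAt.comp_hasDerivAt t h1).congr_deriv ?_,
    (reCLM.hasFDerivAt.comp_hasDerivAt t h2).congr_deriv ?_,
    (imCLM.hasFDerivAt.comp_hasDerivAt t h2).congr_deriv ?_⟩ <;>
  · simp only [reCLM_apply, imCLM_apply, ← ofReal_neg, mul_re, mul_im, add_re, add_im, I_re, I_im,
      ofReal_re, ofReal_im]
    ring

/-- The coefficient matrix is i times a hermitian matrix, so the evolution is unitary. -/
theorem SolvesSystem.norm_sq_add (hJc : J.OrdConnected) (hJ0 : (0 : ℝ) ∈ J) {f g : ℝ → ℂ}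
    (hf : SolvesSystem h r₀ v₀ J f g) :
    ∀ t ∈ J, (f t).re ^ 2 + (f t).im ^ 2 + (g t).re ^ 2 + (g t).im ^ 2 = 1 := by
  refine eq_of_hasDerivAt_of_eq_zero hJc hJ0 (x' := fun _ => 0) (fun t ht => ?_)
    (fun t _ => hasDerivAt_const t 1) (by simp [hf.2.1, hf.2.2])
  obtain ⟨a1, a2, a3, a4⟩ := hf.hasDerivAt_parts ht
  refine ((((a1.pow 2).add (a2.pow 2)).add (a3.pow 2)).add (a4.pow 2)).congr_deriv ?_
  simp
  ring

section Expressions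

variable (r₀ v₀) (t : ℝ) (z w : ℂ)

/-- The real number `F₀` in terms of `f` and `g`. -/
noncomputable def realF0 : ℝ :=
  z.re ^ 2 - z.im ^ 2 - w.re ^ 2 + w.im ^ 2
    - 2 * (parA r₀ v₀ + speed v₀ * t) / parC r₀ v₀ * (z.re * w.re - z.im * w.im)

/-- The real number `F₁` in terms of `f` and `g`. -/
noncomputable def realF1 : ℝ :=
  (-parA r₀ v₀ * realF0 r₀ v₀ t z w
    + (parA r₀ v₀ + speed v₀ * t) * (z.re ^ 2 + z.im ^ 2 - w.re ^ 2 - w.im ^ 2)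
    + parC r₀ v₀ * (2 * (z.re * w.re + z.im * w.im))) / speed v₀

/-- The real number `F₂` in terms of `f` and `g`. -/
noncomputable def realF2 : ℝ :=
  (2 * (parA r₀ v₀ + speed v₀ * t) * (z.re * w.im + z.im * w.re)
    - parC r₀ v₀ * (2 * z.re * z.im - 2 * w.re * w.im)) / (parC r₀ v₀ * speed v₀)

variable {r₀ v₀}

theorem pairF0_eq (hw : wedge r₀ v₀ ≠ 0) : (realF0 r₀ v₀ t z w : ℂ) = pairF0 r₀ v₀ t z w := by
  have hc := (parC_pos hw).ne'
  have e : 1 / (2 * (parC r₀ v₀ : ℂ)) = ((1 / (2 * parC r₀ v₀) : ℝ) : ℂ) := by push_cast; ring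
  rw [pairF0, e]
  apply Complex.ext
  · simp [realF0, pow_two]
    field_simp
    ring
  · simp [pow_two]
    ring_nf
    simp

theorem pairF1_eq (hw : wedge r₀ v₀ ≠ 0) : (realF1 r₀ v₀ t z w : ℂ) = pairF1 r₀ v₀ t z w := by
  have e : 1 / (speed v₀ : ℂ) = ((1 / speed v₀ : ℝ) : ℂ) := by push_cast; ring
  rw [pairF1, ← pairF0_eq t z w hw, e]
  apply Complex.ext
  · simp [realF1, pow_two]
    ring
  · simp
    ring_nf
    simp

theorem pairF2_eq (hw : wedge r₀ v₀ ≠ 0) : (realF2 r₀ v₀ t z w : ℂ) = pairF2 r₀ v₀ t z w := by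
  have hc := (parC_pos hw).ne'
  have hb := (speed_pos hw).ne'
  have e : I / (2 * (parC r₀ v₀ : ℂ) * speed v₀) = I * ((1 / (2 * parC r₀ v₀ * speed v₀) : ℝ) : ℂ) := by
    push_cast; ring
  rw [pairF2, e]
  apply Complex.ext
  · rw [ofReal_re, realF2]
    simp [pow_two]
    field_simp
    ring
  · simp [pow_two]

variable {t z w} {η : ℝ} {z' : ℂ}

/-- With s = a + bt the hypothesis gives 4z'² = -η²(sz + cw)². Added to η²(c² + s²)z², the s²z²
terms cancel and η²c(cz² - 2szw - cw²) remains. -/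
theorem singleF0_eq (hw : wedge r₀ v₀ ≠ 0) (hη : η ≠ 0)
    (hz : z' = I * ((η : ℂ) / 2) * (((parA r₀ v₀ + speed v₀ * t : ℝ) : ℂ) * z + parC r₀ v₀ * w)) :
    singleF0 r₀ v₀ t η z z' = pairF0 r₀ v₀ t z w := by
  have hc : (parC r₀ v₀ : ℂ) ≠ 0 := ofReal_ne_zero.2 (parC_pos hw).ne'
  have hη' : (η : ℂ) ≠ 0 := ofReal_ne_zero.2 hη
  rw [singleF0, pairF0, hz]
  simp only [map_mul, map_add, conj_ofReal, conj_I, map_div₀, map_ofNat]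
  push_cast
  field_simp
  ring_nf
  simp only [I_sq]
  ring

/-- Here the normalisation is needed as well: it turns zz* - ww* into 2zz* - 1, which accounts for
the separate term -(a+bt). -/
theorem singleF1_eq (hw : wedge r₀ v₀ ≠ 0) (hη : η ≠ 0)
    (hz : z' = I * ((η : ℂ) / 2) * (((parA r₀ v₀ + speed v₀ * t : ℝ) : ℂ) * z + parC r₀ v₀ * w))
    (hn : w * conj w = 1 - z * conj z) :
    singleF1 r₀ v₀ t η z z' = pairF1 r₀ v₀ t z w := by
  have hη' : (η : ℂ) ≠ 0 := ofReal_ne_zero.2 hη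
  rw [singleF1, pairF1, singleF0_eq hw hη hz, hn, hz]
  congr 1
  simp only [map_mul, map_add, conj_ofReal, conj_I, map_div₀, map_ofNat]
  push_cast
  field_simp
  ring_nf
  simp only [I_sq]
  ring

theorem singleF2_eq (hw : wedge r₀ v₀ ≠ 0) (hη : η ≠ 0)
    (hz : z' = I * ((η : ℂ) / 2) * (((parA r₀ v₀ + speed v₀ * t : ℝ) : ℂ) * z + parC r₀ v₀ * w)) :
    singleF2 r₀ v₀ t η z z' = pairF2 r₀ v₀ t z w := by
  have hc : (parC r₀ v₀ : ℂ) ≠ 0 := ofReal_ne_zero.2 (parC_pos hw).ne'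
  have hb : (speed v₀ : ℂ) ≠ 0 := ofReal_ne_zero.2 (speed_pos hw).ne'
  have hη' : (η : ℂ) ≠ 0 := ofReal_ne_zero.2 hη
  rw [singleF2, pairF2, hz]
  simp only [map_mul, map_add, conj_ofReal, conj_I, map_div₀, map_ofNat]
  push_cast
  field_simp
  ring_nf
  simp only [I_sq]
  ring

end Expressions

section Solutions

variable {f g : ℝ → ℂ}

/-- In the derivative of F₀ all terms with h cancel and only the derivative of the explicit factor a
+ bt survives. This leaves D = -(2b/c) Re(fg), and differentiating once more gives G = b Im(f² +
g²). The other two functions follow the same pattern. -/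
theorem solvesThirdSystem_realF0 (hw : wedge r₀ v₀ ≠ 0) (hf : SolvesSystem h r₀ v₀ J f g) :
    SolvesThirdSystem h r₀ v₀ J (fun t => realF0 r₀ v₀ t (f t) (g t))
      (fun t => -(2 * speed v₀ / parC r₀ v₀) * ((f t).re * (g t).re - (f t).im * (g t).im))
      (fun t => 2 * speed v₀ * ((f t).re * (f t).im + (g t).re * (g t).im)) := by
  intro t ht
  obtain ⟨a1, a2, a3, a4⟩ := hf.hasDerivAt_parts ht
  have hs : HasDerivAt (fun t => 2 * (parA r₀ v₀ + speed v₀ * t) / parC r₀ v₀)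
      (2 * speed v₀ / parC r₀ v₀) t := by
    simpa using ((((hasDerivAt_id t).const_mul (speed v₀)).const_add (parA r₀ v₀)).const_mul
      2).div_const (parC r₀ v₀)
  have hc := (parC_pos hw).ne'
  refine ⟨(((((a1.pow 2).sub (a2.pow 2)).sub (a3.pow 2)).add (a4.pow 2)).sub
      (hs.mul ((a1.mul a3).sub (a2.mul a4)))).congr_deriv ?_,
    (((a1.mul a3).sub (a2.mul a4)).const_mul _).congr_deriv ?_,
    (((a1.mul a2).add (a3.mul a4)).const_mul _).congr_deriv ?_⟩
  · simp
    field_simp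
    ring
  · simp
    field_simp
    ring
  · rw [chi_eq hw, ← speed_mul_parA hw]
    simp [realF0]
    field_simp
    ring

theorem solvesThirdSystem_realF1 (hw : wedge r₀ v₀ ≠ 0) (hf : SolvesSystem h r₀ v₀ J f g) :
    SolvesThirdSystem h r₀ v₀ J (fun t => realF1 r₀ v₀ t (f t) (g t))
      (fun t => (-parA r₀ v₀ * (-(2 * speed v₀ / parC r₀ v₀) *
          ((f t).re * (g t).re - (f t).im * (g t).im)) +
        speed v₀ * ((f t).re ^ 2 + (f t).im ^ 2 - (g t).re ^ 2 - (g t).im ^ 2)) / speed v₀)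
      (fun t => (-parA r₀ v₀ * (2 * speed v₀ * ((f t).re * (f t).im + (g t).re * (g t).im)) +
        speed v₀ * (2 * parC r₀ v₀ * ((f t).im * (g t).re - (f t).re * (g t).im))) / speed v₀) := by
  intro t ht
  obtain ⟨b1, b2, b3⟩ := solvesThirdSystem_realF0 hw hf t ht
  obtain ⟨a1, a2, a3, a4⟩ := hf.hasDerivAt_parts ht
  have hs : HasDerivAt (fun t => parA r₀ v₀ + speed v₀ * t) (speed v₀) t := by
    simpa using ((hasDerivAt_id t).const_mul (speed v₀)).const_add (parA r₀ v₀)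
  have hc := (parC_pos hw).ne'
  have hb := (speed_pos hw).ne'
  have hq := (((a1.pow 2).add (a2.pow 2)).sub (a3.pow 2)).sub (a4.pow 2)
  refine ⟨((((b1.const_mul (-parA r₀ v₀)).add (hs.mul hq)).add
      ((((a1.mul a3).add (a2.mul a4)).const_mul 2).const_mul (parC r₀ v₀))).div_const
        (speed v₀)).congr_deriv ?_,
    (((b2.const_mul (-parA r₀ v₀)).add (hq.const_mul (speed v₀))).div_const
        (speed v₀)).congr_deriv ?_,
    (((b3.const_mul (-parA r₀ v₀)).add
      ((((a2.mul a3).sub (a1.mul a4)).const_mul (2 * parC r₀ v₀)).const_mul (speed v₀))).div_const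
        (speed v₀)).congr_deriv ?_⟩
  · simp
    field_simp
    ring
  · simp
    field_simp
    ring
  · rw [chi_eq hw, ← speed_mul_parA hw]
    simp [realF1, realF0]
    field_simp
    ring

theorem solvesThirdSystem_realF2 (hw : wedge r₀ v₀ ≠ 0) (hf : SolvesSystem h r₀ v₀ J f g) :
    SolvesThirdSystem h r₀ v₀ J (fun t => realF2 r₀ v₀ t (f t) (g t))
      (fun t => 2 / parC r₀ v₀ * ((f t).re * (g t).im + (f t).im * (g t).re))
      (fun t => (f t).re ^ 2 - (f t).im ^ 2 + (g t).re ^ 2 - (g t).im ^ 2) := by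
  intro t ht
  obtain ⟨a1, a2, a3, a4⟩ := hf.hasDerivAt_parts ht
  have hs : HasDerivAt (fun t => 2 * (parA r₀ v₀ + speed v₀ * t)) (2 * speed v₀) t := by
    simpa using (((hasDerivAt_id t).const_mul (speed v₀)).const_add (parA r₀ v₀)).const_mul 2
  have hc := (parC_pos hw).ne'
  have hb := (speed_pos hw).ne'
  refine ⟨(((hs.mul ((a1.mul a4).add (a2.mul a3))).sub ((((a1.const_mul 2).mul a2).sub
      ((a3.const_mul 2).mul a4)).const_mul (parC r₀ v₀))).div_const _).congr_deriv ?_,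
    (((a1.mul a4).add (a2.mul a3)).const_mul _).congr_deriv ?_,
    ((((a1.pow 2).sub (a2.pow 2)).add (a3.pow 2)).sub (a4.pow 2)).congr_deriv ?_⟩
  · simp
    field_simp
    ring
  · simp
    field_simp
    ring
  · rw [chi_eq hw, ← speed_mul_parA hw]
    simp [realF2]
    field_simp
    ring

/-- The three basic solutions of the third-order equation in terms of a generating function. -/
theorem IsGenerating.basic_solutions (hJ : IsOpen J) (hJc : J.OrdConnected) (hJ0 : (0 : ℝ) ∈ J)
    (hw : wedge r₀ v₀ ≠ 0) (hh : ∀ t ∈ J, DifferentiableAt ℝ h t ∧ h t ≠ 0)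
    (hf : IsGenerating h r₀ v₀ J f) (hg : g = companion h r₀ v₀ f) :
    (∀ t ∈ J, g t * conj (g t) = 1 - f t * conj (f t)) ∧
    ∃ F₀ F₁ F₂ : ℝ → ℝ,
      (∀ t ∈ J, (F₀ t : ℂ) = pairF0 r₀ v₀ t (f t) (g t) ∧
        (F₁ t : ℂ) = pairF1 r₀ v₀ t (f t) (g t) ∧
        (F₂ t : ℂ) = pairF2 r₀ v₀ t (f t) (g t) ∧
        (F₀ t : ℂ) = singleF0 r₀ v₀ t (h t) (f t) (deriv f t) ∧
        (F₁ t : ℂ) = singleF1 r₀ v₀ t (h t) (f t) (deriv f t) ∧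
        (F₂ t : ℂ) = singleF2 r₀ v₀ t (h t) (f t) (deriv f t)) ∧
      SolvesThirdOrder h r₀ v₀ J 1 0 0 F₀ ∧ SolvesThirdOrder h r₀ v₀ J 0 1 0 F₁ ∧
      SolvesThirdOrder h r₀ v₀ J 0 0 (h 0) F₂ := by
  have hs := hf.solvesSystem hJ hJ0 hw hh (g := g) (fun t _ => by rw [hg])
  have hn : ∀ t ∈ J, g t * conj (g t) = 1 - f t * conj (f t) := by
    intro t ht
    have := hs.norm_sq_add hJc hJ0 t ht
    rw [mul_conj, mul_conj, normSq_apply, normSq_apply]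
    norm_cast
    linarith
  have hb := (speed_pos hw).ne'
  refine ⟨hn, fun t => realF0 r₀ v₀ t (f t) (g t), fun t => realF1 r₀ v₀ t (f t) (g t),
    fun t => realF2 r₀ v₀ t (f t) (g t), fun t ht => ?_, ?_, ?_, ?_⟩
  · have hd := (hs.1 t ht).1.deriv
    have hne := (hh t ht).2
    refine ⟨pairF0_eq _ _ _ hw, pairF1_eq _ _ _ hw, pairF2_eq _ _ _ hw, ?_, ?_, ?_⟩
    · rw [singleF0_eq hw hne hd, pairF0_eq _ _ _ hw]
    · rw [singleF1_eq hw hne hd (hn t ht), pairF1_eq _ _ _ hw]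
    · rw [singleF2_eq hw hne hd, pairF2_eq _ _ _ hw]
  · have := (solvesThirdSystem_realF0 hw hs).order hJ hJ0 hh
    simpa [realF0, hs.2.1, hs.2.2] using this
  · have := (solvesThirdSystem_realF1 hw hs).order hJ hJ0 hh
    simpa [realF1, realF0, hs.2.1, hs.2.2, hb] using this
  · have := (solvesThirdSystem_realF2 hw hs).order hJ hJ0 hh
    simpa [realF2, hs.2.1, hs.2.2] using this

end Solutions

end VectorNewton

/-! ### Removal of the first-derivative term: the Schrödinger form. -/

namespace VectorNewton

open Set Filter Topology Complex ComplexConjugate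

section SquareRoot

theorem cpow_half_sq (x : ℂ) : (x ^ (1 / 2 : ℂ)) ^ 2 = x := by
  rw [← cpow_nat_mul]
  norm_num

theorem cpow_half_ne_zero {x : ℂ} (hx : x ≠ 0) : x ^ (1 / 2 : ℂ) ≠ 0 := fun h0 => hx <| by
  rw [← cpow_half_sq x, h0]; simp

theorem cpow_neg_half (x : ℂ) : x ^ (-1 / 2 : ℂ) = (x ^ (1 / 2 : ℂ))⁻¹ := by
  rw [← cpow_neg]; norm_num

theorem cpow_neg_three_half (x : ℂ) : x ^ (-3 / 2 : ℂ) = ((x ^ (1 / 2 : ℂ)) ^ 3)⁻¹ := by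
  rw [← cpow_nat_mul, ← cpow_neg]; norm_num

/-- The derivative of the principal square root of a nonvanishing real function. -/
theorem hasDerivAt_cpow_half {h : ℝ → ℝ} {h' t : ℝ} (hh : HasDerivAt h h' t) (h0 : h t ≠ 0) :
    HasDerivAt (fun t => (h t : ℂ) ^ (1 / 2 : ℂ))
      (((h' / (2 * h t) : ℝ) : ℂ) * (h t : ℂ) ^ (1 / 2 : ℂ)) t := by
  have h1 := (hasDerivAt_ofReal_cpow_const (r := 1 / 2) h0 (by norm_num)).scomp t hh
  have hne : (h t : ℂ) ≠ 0 := ofReal_ne_zero.2 h0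
  refine h1.congr_deriv ?_
  rw [cpow_sub _ _ hne, cpow_one, real_smul]
  push_cast
  field_simp

end SquareRoot

variable {J : Set ℝ} {r₀ v₀ : E3} {h : ℝ → ℝ}

section Schroedinger

variable {f φ : ℝ → ℂ}

theorem hasDerivAt_halfLogDeriv
    (hh : ∀ t ∈ J, DifferentiableAt ℝ h t ∧ DifferentiableAt ℝ (deriv h) t ∧ h t ≠ 0)
    {t : ℝ} (ht : t ∈ J) :
    HasDerivAt (fun t => ((deriv h t / (2 * h t) : ℝ) : ℂ))
      (((deriv (deriv h) t * h t - deriv h t ^ 2) / (2 * h t ^ 2) : ℝ) : ℂ) t := by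
  obtain ⟨h1, h2, h3⟩ := hh t ht
  have := (h2.hasDerivAt.div (h1.hasDerivAt.const_mul 2) (mul_ne_zero two_ne_zero h3)).ofReal_comp
  refine this.congr_deriv ?_
  congr 1
  field_simp

theorem hasDerivAt_of_schroedinger (hJ : IsOpen J)
    (hh : ∀ t ∈ J, DifferentiableAt ℝ h t ∧ DifferentiableAt ℝ (deriv h) t ∧ h t ≠ 0)
    (hfφ : ∀ t ∈ J, f t = (h t : ℂ) ^ (1 / 2 : ℂ) * φ t)
    (hφ : ∀ t ∈ J, DifferentiableAt ℝ φ t) :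
    ∀ t ∈ J, HasDerivAt f ((h t : ℂ) ^ (1 / 2 : ℂ) *
      (((deriv h t / (2 * h t) : ℝ) : ℂ) * φ t + deriv φ t)) t := by
  intro t ht
  refine (((hasDerivAt_cpow_half (hh t ht).1.hasDerivAt (hh t ht).2.2).mul
    (hφ t ht).hasDerivAt).congr_deriv ?_).congr_of_eventuallyEq ?_
  · ring
  · filter_upwards [hJ.mem_nhds ht] with s hs using hfφ s hs

theorem hasDerivAt_of_linear (hJ : IsOpen J)
    (hh : ∀ t ∈ J, DifferentiableAt ℝ h t ∧ DifferentiableAt ℝ (deriv h) t ∧ h t ≠ 0)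
    (hfφ : ∀ t ∈ J, f t = (h t : ℂ) ^ (1 / 2 : ℂ) * φ t)
    (hf : ∀ t ∈ J, DifferentiableAt ℝ f t) :
    ∀ t ∈ J, HasDerivAt φ (((h t : ℂ) ^ (1 / 2 : ℂ))⁻¹ *
      (deriv f t - ((deriv h t / (2 * h t) : ℝ) : ℂ) * f t)) t := by
  intro t ht
  have hne : ∀ s ∈ J, (h s : ℂ) ^ (1 / 2 : ℂ) ≠ 0 := fun s hs =>
    cpow_half_ne_zero (ofReal_ne_zero.2 (hh s hs).2.2)
  refine (((hf t ht).hasDerivAt.div (hasDerivAt_cpow_half (hh t ht).1.hasDerivAt (hh t ht).2.2)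
    (hne t ht)).congr_deriv ?_).congr_of_eventuallyEq ?_
  · have := hne t ht
    field_simp
  · filter_upwards [hJ.mem_nhds ht] with s hs
    rw [Pi.div_apply, hfφ s hs, mul_div_cancel_left₀ _ (hne s hs)]

/-- Liouville's substitution: h^(1/2) has logarithmic derivative ḣ/(2h), which cancels the term
(ḣ/h)ḟ. Each direction has to obtain the differentiability of one function from that of the other,
so φ is also written as h^(-1/2) f. -/
theorem solvesLinear_iff_solvesSchroedinger (hJ : IsOpen J)
    (hh : ∀ t ∈ J, DifferentiableAt ℝ h t ∧ DifferentiableAt ℝ (deriv h) t ∧ h t ≠ 0)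
    (hfφ : ∀ t ∈ J, f t = (h t : ℂ) ^ (1 / 2 : ℂ) * φ t) :
    SolvesLinear h r₀ v₀ J f ↔ SolvesSchroedinger h r₀ v₀ J φ := by
  have hne : ∀ s ∈ J, (h s : ℂ) ^ (1 / 2 : ℂ) ≠ 0 := fun s hs =>
    cpow_half_ne_zero (ofReal_ne_zero.2 (hh s hs).2.2)
  constructor
  · intro hf t ht
    have hd := hasDerivAt_of_linear hJ hh hfφ (fun s hs => (hf s hs).1)
    have hρ := hasDerivAt_cpow_half (hh t ht).1.hasDerivAt (hh t ht).2.2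
    have hR := hasDerivAt_halfLogDeriv hh ht
    refine ⟨(hd t ht).differentiableAt, (((hρ.inv (hne t ht)).mul
      ((hf t ht).2.sub (hR.mul (hf t ht).1.hasDerivAt))).congr_deriv ?_).congr_of_eventuallyEq
      (deriv_eventuallyEq_of_isOpen hJ hd ht)⟩
    have h1 := hne t ht
    have h2 : (h t : ℂ) ≠ 0 := ofReal_ne_zero.2 (hh t ht).2.2
    simp only [Pi.sub_apply, Pi.mul_apply, Pi.inv_apply]
    rw [hfφ t ht]
    push_cast
    field_simp
    ring
  · intro hφ t ht
    have hd := hasDerivAt_of_schroedinger hJ hh hfφ (fun s hs => (hφ s hs).1)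
    have hρ := hasDerivAt_cpow_half (hh t ht).1.hasDerivAt (hh t ht).2.2
    have hR := hasDerivAt_halfLogDeriv hh ht
    refine ⟨(hd t ht).differentiableAt, ((hρ.mul
      ((hR.mul (hφ t ht).1.hasDerivAt).add (hφ t ht).2)).congr_deriv ?_).congr_of_eventuallyEq
      (deriv_eventuallyEq_of_isOpen hJ hd ht)⟩
    have h1 := hne t ht
    have h2 : (h t : ℂ) ≠ 0 := ofReal_ne_zero.2 (hh t ht).2.2
    simp only [Pi.add_apply, Pi.mul_apply]
    rw [(hd t ht).deriv, hfφ t ht]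
    push_cast
    field_simp
    ring

theorem isGenerating_iff_solvesSchroedinger (hJ : IsOpen J)
    (hh : ∀ t ∈ J, DifferentiableAt ℝ h t ∧ DifferentiableAt ℝ (deriv h) t ∧ h t ≠ 0)
    (hfφ : ∀ t ∈ J, f t = (h t : ℂ) ^ (1 / 2 : ℂ) * φ t)
    (hJ0 : (0 : ℝ) ∈ J) :
    IsGenerating h r₀ v₀ J f ↔
      SolvesSchroedinger h r₀ v₀ J φ ∧ φ 0 = phiInit h ∧ deriv φ 0 = phiDerivInit h r₀ v₀ := by
  rw [IsGenerating, solvesLinear_iff_solvesSchroedinger hJ hh hfφ]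
  refine and_congr_right fun hφ => ?_
  have h2 : (h 0 : ℂ) ≠ 0 := ofReal_ne_zero.2 (hh 0 hJ0).2.2
  have hne := cpow_half_ne_zero h2
  have hsq := cpow_half_sq (h 0)
  have hd := (hasDerivAt_of_schroedinger hJ hh hfφ (fun s hs => (hφ s hs).1) 0 hJ0).deriv
  rw [hfφ 0 hJ0, hd, phiInit, phiDerivInit, cpow_neg_half, cpow_neg_three_half]
  set ρ := (h 0 : ℂ) ^ (1 / 2 : ℂ)
  rw [← eq_inv_mul_iff_mul_eq₀ hne, mul_one]
  refine and_congr_right fun h0 => ?_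
  rw [← eq_inv_mul_iff_mul_eq₀ hne, h0, ← eq_sub_iff_add_eq']
  -- All powers are expressed through ρ = h(0)^(1/2), with ρ² = h(0) and h(0)^(-3/2) = ρ⁻³, so the
  -- principal branch causes no sign ambiguity, even for h(0) < 0.
  have e : ρ⁻¹ * (I * parA r₀ v₀ * h 0 / 2) - ((deriv h 0 / (2 * h 0) : ℝ) : ℂ) * ρ⁻¹ =
      (ρ ^ 3)⁻¹ * (I * parA r₀ v₀ * (h 0 : ℂ) ^ 2 - ((deriv h 0 : ℝ) : ℂ)) / 2 := by
    push_cast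
    rw [← hsq]
    field_simp
  rw [e]

end Schroedinger

end VectorNewton

/-! ### Taylor coefficients and the power series of hypergeometric operators. -/

namespace VectorNewton

open Set Filter Topology Complex Metric
open scoped Nat

section Taylor

/-- The Taylor coefficients at `0`. -/
noncomputable def taylorCoeff (f : ℂ → ℂ) (n : ℕ) : ℂ := iteratedDeriv n f 0 / n !

variable {f g : ℂ → ℂ} {R : ℝ} {z : ℂ}

theorem hasSum_taylorCoeff (hf : DifferentiableOn ℂ f (ball 0 R)) (hz : z ∈ ball (0 : ℂ) R) :
    HasSum (fun n => taylorCoeff f n * z ^ n) (f z) := by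
  refine (hasSum_taylorSeries_on_ball hf hz).congr_fun fun n => ?_
  simp only [taylorCoeff, smul_eq_mul, sub_zero]
  ring

theorem taylorCoeff_zero (f : ℂ → ℂ) : taylorCoeff f 0 = f 0 := by simp [taylorCoeff]

theorem taylorCoeff_deriv (f : ℂ → ℂ) (n : ℕ) :
    taylorCoeff (deriv f) n = (n + 1) * taylorCoeff f (n + 1) := by
  rw [taylorCoeff, taylorCoeff, iteratedDeriv_succ', Nat.factorial_succ]
  push_cast
  have : (n : ℂ) + 1 ≠ 0 := Nat.cast_add_one_ne_zero n
  have : (n ! : ℂ) ≠ 0 := Nat.cast_ne_zero.2 n.factorial_ne_zero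
  field_simp

theorem taylorCoeff_congr (h : f =ᶠ[𝓝 0] g) (n : ℕ) : taylorCoeff f n = taylorCoeff g n := by
  rw [taylorCoeff, taylorCoeff, h.iteratedDeriv_eq]

theorem taylorCoeff_eq_coeff {p : FormalMultilinearSeries ℂ ℂ ℂ} (h : HasFPowerSeriesAt f p 0)
    (n : ℕ) : taylorCoeff f n = p.coeff n := by
  obtain ⟨r, hr⟩ := h
  have h1 := hr.factorial_smul 1 n
  rw [iteratedFDeriv_apply_eq_iteratedDeriv_mul_prod] at h1
  simp only [Finset.prod_const_one, one_smul] at h1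
  have : (n ! : ℂ) ≠ 0 := Nat.cast_ne_zero.2 n.factorial_ne_zero
  rw [taylorCoeff, ← h1, div_eq_iff this, nsmul_eq_mul, mul_comm]
  rfl

theorem taylorCoeff_eq_of_hasSum {c : ℕ → ℂ}
    (h : ∀ᶠ z in 𝓝 (0 : ℂ), HasSum (fun n => c n * z ^ n) (f z)) (n : ℕ) :
    taylorCoeff f n = c n := by
  have : HasFPowerSeriesAt f (.ofScalars ℂ c) 0 := by
    rw [hasFPowerSeriesAt_iff]
    filter_upwards [h] with z hz
    simpa [FormalMultilinearSeries.coeff_ofScalars, mul_comm] using hz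
  rw [taylorCoeff_eq_coeff this, FormalMultilinearSeries.coeff_ofScalars]

theorem eqOn_ball_of_taylorCoeff_eq (hf : DifferentiableOn ℂ f (ball 0 R))
    (hg : DifferentiableOn ℂ g (ball 0 R)) (h : ∀ n, taylorCoeff f n = taylorCoeff g n) :
    EqOn f g (ball 0 R) := fun z hz => by
  have h1 := hasSum_taylorCoeff hf hz
  simp_rw [h] at h1
  exact h1.unique (hasSum_taylorCoeff hg hz)

theorem hasSum_mul_id {c : ℕ → ℂ} {s : ℂ} (h : HasSum (fun n => c (n + 1) * z ^ n) s)
    (h0 : c 0 = 0) : HasSum (fun n => c n * z ^ n) (z * s) := by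
  rw [← hasSum_nat_add_iff' 1]
  simp only [Finset.range_one, Finset.sum_singleton, h0, zero_mul, sub_zero]
  refine (h.mul_left z).congr_fun fun n => ?_
  ring

theorem hasSum_deriv (hf : DifferentiableOn ℂ f (ball 0 R)) (hz : z ∈ ball (0 : ℂ) R) :
    HasSum (fun n : ℕ => (n + 1) * taylorCoeff f (n + 1) * z ^ n) (deriv f z) := by
  simpa only [taylorCoeff_deriv] using hasSum_taylorCoeff (hf.deriv isOpen_ball) hz

theorem hasSum_id_mul_deriv (hf : DifferentiableOn ℂ f (ball 0 R)) (hz : z ∈ ball (0 : ℂ) R) :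
    HasSum (fun n : ℕ => n * taylorCoeff f n * z ^ n) (z * deriv f z) := by
  refine hasSum_mul_id (c := fun n : ℕ => n * taylorCoeff f n) ?_ (by simp)
  simpa using hasSum_deriv hf hz

theorem hasSum_id_mul_deriv_deriv (hf : DifferentiableOn ℂ f (ball 0 R))
    (hz : z ∈ ball (0 : ℂ) R) :
    HasSum (fun n : ℕ => n * ((n + 1) * taylorCoeff f (n + 1)) * z ^ n)
      (z * deriv (deriv f) z) := by
  simpa only [taylorCoeff_deriv] using hasSum_id_mul_deriv (hf.deriv isOpen_ball) hz

theorem hasSum_sq_mul_deriv_deriv (hf : DifferentiableOn ℂ f (ball 0 R))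
    (hz : z ∈ ball (0 : ℂ) R) :
    HasSum (fun n : ℕ => n * (n - 1) * taylorCoeff f n * z ^ n)
      (z * (z * deriv (deriv f) z)) := by
  refine hasSum_mul_id (c := fun n : ℕ => n * (n - 1) * taylorCoeff f n) ?_ (by simp)
  refine (hasSum_id_mul_deriv_deriv hf hz).congr_fun fun n => ?_
  push_cast
  ring

/-- The power series of the confluent hypergeometric operator. -/
theorem hasSum_kummer_operator (hf : DifferentiableOn ℂ f (ball 0 R)) (hz : z ∈ ball (0 : ℂ) R)
    (a c : ℂ) :
    HasSum (fun n : ℕ => ((n + 1) * (n + c) * taylorCoeff f (n + 1) - (n + a) * taylorCoeff f n)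
      * z ^ n) (z * deriv (deriv f) z + (c - z) * deriv f z - a * f z) := by
  have := (((hasSum_id_mul_deriv_deriv hf hz).add ((hasSum_deriv hf hz).mul_left c)).sub
    (hasSum_id_mul_deriv hf hz)).sub ((hasSum_taylorCoeff hf hz).mul_left a)
  rw [show z * deriv (deriv f) z + (c - z) * deriv f z - a * f z =
    z * deriv (deriv f) z + c * deriv f z - z * deriv f z - a * f z by ring]
  refine this.congr_fun fun n => ?_
  ring

/-- The power series of the hypergeometric operator. -/
theorem hasSum_gauss_operator (hf : DifferentiableOn ℂ f (ball 0 R)) (hz : z ∈ ball (0 : ℂ) R)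
    (a b c : ℂ) :
    HasSum (fun n : ℕ => ((n + 1) * (n + c) * taylorCoeff f (n + 1)
        - (n + a) * (n + b) * taylorCoeff f n) * z ^ n)
      (z * (1 - z) * deriv (deriv f) z + (c - (a + b + 1) * z) * deriv f z - a * b * f z) := by
  have := ((((hasSum_id_mul_deriv_deriv hf hz).sub (hasSum_sq_mul_deriv_deriv hf hz)).add
    ((hasSum_deriv hf hz).mul_left c)).sub
    ((hasSum_id_mul_deriv hf hz).mul_left (a + b + 1))).sub
    ((hasSum_taylorCoeff hf hz).mul_left (a * b))
  rw [show z * (1 - z) * deriv (deriv f) z + (c - (a + b + 1) * z) * deriv f z - a * b * f z =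
    z * deriv (deriv f) z - z * (z * deriv (deriv f) z) + c * deriv f z
      - (a + b + 1) * (z * deriv f z) - a * b * f z by ring]
  refine this.congr_fun fun n => ?_
  ring

end Taylor

/-! ### Kummer's confluent hypergeometric function. -/

section Kummer

variable {a c : ℂ}

theorem hasFPowerSeriesOnBall_regularizedHGFun (a c : ℂ) :
    HasFPowerSeriesOnBall (regularizedHGFun {a} {c}) (regularizedHGFunSeries {a} {c}) 0 ⊤ := by
  have hr : (regularizedHGFunSeries {a} {c}).radius = ⊤ :=
    radius_regularizedHGFunSeries_eq_top (by simp)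
  have := (regularizedHGFunSeries {a} {c}).hasFPowerSeriesOnBall (by rw [hr]; simp)
  rwa [hr] at this

theorem differentiable_kummer (a c : ℂ) : Differentiable ℂ (kummer a c) := by
  have h1 : Differentiable ℂ (regularizedHGFun {a} {c}) := fun z =>
    ((hasFPowerSeriesOnBall_regularizedHGFun a c).analyticAt_of_mem
      (by simp)).differentiableAt
  exact h1.const_mul _

theorem taylorCoeff_kummer (a c : ℂ) (n : ℕ) :
    taylorCoeff (kummer a c) n = Gamma c * regularizedHGFunCoeff {a} {c} n := by
  have := taylorCoeff_eq_coeff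
    ((hasFPowerSeriesOnBall_regularizedHGFun a c).hasFPowerSeriesAt.const_smul (c := Gamma c)) n
  have e : (Gamma c • regularizedHGFunSeries {a} {c}).coeff n =
      Gamma c * (regularizedHGFunSeries {a} {c}).coeff n := rfl
  rw [e, regularizedHGFunSeries_coeff] at this
  exact this

theorem kummer_zero (hc : ∀ n : ℕ, c ≠ -n) : kummer a c 0 = 1 := by
  rw [← taylorCoeff_zero (kummer a c), taylorCoeff_kummer]
  simp [regularizedHGFunCoeff, Gamma_ne_zero hc]

theorem taylorCoeff_kummer_succ (hc : ∀ n : ℕ, c ≠ -n) (n : ℕ) :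
    (n + 1) * (n + c) * taylorCoeff (kummer a c) (n + 1) =
      (n + a) * taylorCoeff (kummer a c) n := by
  have h1 : (n : ℂ) + c ≠ 0 := fun h0 => hc n (eq_neg_of_add_eq_zero_right h0)
  have h2 : (n : ℂ) + 1 ≠ 0 := Nat.cast_add_one_ne_zero n
  rw [taylorCoeff_kummer, taylorCoeff_kummer, regularizedHGFunCoeff_add_one (by simpa using hc n)]
  simp only [Multiset.map_singleton, Multiset.prod_singleton]
  rw [add_comm c]
  field_simp
  ring

/-- Kummer's differential equation. -/
theorem kummer_equation (hc : ∀ n : ℕ, c ≠ -n) (z : ℂ) :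
    z * deriv (deriv (kummer a c)) z + (c - z) * deriv (kummer a c) z - a * kummer a c z = 0 := by
  have h1 := hasSum_kummer_operator (R := ‖z‖ + 1) (z := z)
    (differentiable_kummer a c).differentiableOn (by simp) a c
  simp only [taylorCoeff_kummer_succ hc, sub_self, zero_mul] at h1
  exact h1.unique hasSum_zero

/-- The entire solutions of Kummer's equation are multiples of Kummer's function. -/
theorem eq_kummer_of_equation (hc : ∀ n : ℕ, c ≠ -n) {y : ℂ → ℂ} (hy : Differentiable ℂ y)
    (h0 : y 0 = 1)
    (he : ∀ z, z * deriv (deriv y) z + (c - z) * deriv y z - a * y z = 0) : y = kummer a c := by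
  -- The operator applied to y has zero power series. Its coefficients give the two-term recursion,
  -- and (n+1)(n+c) ≠ 0 makes y(0) determine the rest.
  have hrec : ∀ n : ℕ, (n + 1) * (n + c) * taylorCoeff y (n + 1) = (n + a) * taylorCoeff y n := by
    intro n
    have h1 : taylorCoeff (fun _ => (0 : ℂ)) n = _ :=
      taylorCoeff_eq_of_hasSum (Eventually.of_forall fun z => by
        have := hasSum_kummer_operator (R := ‖z‖ + 1) (z := z) hy.differentiableOn (by simp) a c
        rwa [he z] at this) n
    have h2 : taylorCoeff (fun _ => (0 : ℂ)) n = 0 :=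
      taylorCoeff_eq_of_hasSum (c := fun _ => 0) (Eventually.of_forall fun z => by
        simp [hasSum_zero]) n
    exact sub_eq_zero.1 (h1.symm.trans h2)
  have hT : ∀ n, taylorCoeff y n = taylorCoeff (kummer a c) n := by
    intro n
    induction n with
    | zero => rw [taylorCoeff_zero, taylorCoeff_zero, h0, kummer_zero hc]
    | succ n ih =>
      have h1 : (n : ℂ) + c ≠ 0 := fun h0 => hc n (eq_neg_of_add_eq_zero_right h0)
      have h2 : (n : ℂ) + 1 ≠ 0 := Nat.cast_add_one_ne_zero n
      apply mul_left_cancel₀ (mul_ne_zero h2 h1)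
      rw [hrec, taylorCoeff_kummer_succ hc, ih]
  ext z
  exact eqOn_ball_of_taylorCoeff_eq (R := ‖z‖ + 1) hy.differentiableOn
    (differentiable_kummer a c).differentiableOn hT (by simp)

theorem hasDerivAt_kummer (a c z : ℂ) : HasDerivAt (kummer a c) (deriv (kummer a c) z) z :=
  (differentiable_kummer a c z).hasDerivAt

theorem hasDerivAt_deriv_kummer (a c z : ℂ) :
    HasDerivAt (deriv (kummer a c)) (deriv (deriv (kummer a c)) z) z :=
  ((differentiable_kummer a c).deriv z).hasDerivAt

/-- Kummer's transformation. -/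
theorem kummer_neg (hc : ∀ n : ℕ, c ≠ -n) (a z : ℂ) :
    exp z * kummer (c - a) c (-z) = kummer a c z := by
  have h1 : ∀ z, HasDerivAt (fun z => exp z * kummer (c - a) c (-z))
      (exp z * (kummer (c - a) c (-z) - deriv (kummer (c - a) c) (-z))) z := fun z => by
    have := (Complex.hasDerivAt_exp z).mul
      ((hasDerivAt_kummer (c - a) c (-z)).scomp z (hasDerivAt_neg z))
    refine this.congr_deriv ?_
    simp only [Function.comp, smul_eq_mul]
    ring
  have h2 : ∀ z, HasDerivAt
      (fun z => exp z * (kummer (c - a) c (-z) - deriv (kummer (c - a) c) (-z)))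
      (exp z * (kummer (c - a) c (-z) - 2 * deriv (kummer (c - a) c) (-z) +
        deriv (deriv (kummer (c - a) c)) (-z))) z := fun z => by
    have := (Complex.hasDerivAt_exp z).mul
      (((hasDerivAt_kummer (c - a) c (-z)).scomp z (hasDerivAt_neg z)).sub
        ((hasDerivAt_deriv_kummer (c - a) c (-z)).scomp z (hasDerivAt_neg z)))
    refine this.congr_deriv ?_
    simp only [Function.comp, smul_eq_mul, Pi.sub_apply]
    ring
  have d1 : deriv (fun z => exp z * kummer (c - a) c (-z)) = _ := funext fun z => (h1 z).deriv
  -- The left side is entire with value 1 at 0, so it only has to satisfy Kummer's equation.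
  refine congrFun (eq_kummer_of_equation (y := fun z => exp z * kummer (c - a) c (-z)) hc
    (fun z => (h1 z).differentiableAt) (by simp [kummer_zero hc]) fun z => ?_) z
  rw [d1, (h2 z).deriv]
  have := kummer_equation (a := c - a) hc (-z)
  linear_combination -exp z * this

end Kummer

end VectorNewton

/-! ### Parabolic cylinder functions. -/

namespace VectorNewton

open Set Filter Topology Complex

section Coefficients

variable {u w : ℂ → ℂ} {z : ℂ}

theorem coeff_value (hW : wronsk u w z ≠ 0) (x y : ℂ) :
    coeffFst u w z x y * u z + coeffSnd u w z x y * w z = x := by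
  rw [coeffFst, coeffSnd]
  field_simp
  rw [wronsk]
  ring

theorem coeff_deriv (hW : wronsk u w z ≠ 0) (x y : ℂ) :
    coeffFst u w z x y * deriv u z + coeffSnd u w z x y * deriv w z = y := by
  rw [coeffFst, coeffSnd]
  field_simp
  rw [wronsk]
  ring

end Coefficients

section ParabolicCylinder

variable {a c p : ℂ}

/-- The function `e^(-z²/4) Φ(a, c; z²/2)`. -/
noncomputable def gaussKummer (a c z : ℂ) : ℂ := exp (-z ^ 2 / 4) * kummer a c (z ^ 2 / 2)

/-- The derivative of `gaussKummer`. -/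
noncomputable def gaussKummerDeriv (a c z : ℂ) : ℂ :=
  exp (-z ^ 2 / 4) * (-z / 2 * kummer a c (z ^ 2 / 2) + z * deriv (kummer a c) (z ^ 2 / 2))

theorem hasDerivAt_exp_neg_sq (z : ℂ) :
    HasDerivAt (fun z : ℂ => exp (-z ^ 2 / 4)) (exp (-z ^ 2 / 4) * (-z / 2)) z := by
  have : HasDerivAt (fun z : ℂ => -z ^ 2 / 4) (-z / 2) z := by
    refine (((hasDerivAt_id z).pow 2).neg.div_const 4).congr_deriv ?_
    simp
    ring
  exact this.cexp

theorem hasDerivAt_sq_half (z : ℂ) : HasDerivAt (fun z : ℂ => z ^ 2 / 2) z z := by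
  refine (((hasDerivAt_id z).pow 2).div_const 2).congr_deriv ?_
  simp

theorem hasDerivAt_gaussKummer (a c z : ℂ) :
    HasDerivAt (gaussKummer a c) (gaussKummerDeriv a c z) z := by
  refine ((hasDerivAt_exp_neg_sq z).mul
    ((hasDerivAt_kummer a c _).comp z (hasDerivAt_sq_half z))).congr_deriv ?_
  simp only [gaussKummerDeriv, Function.comp]
  ring

/-- For c = 1/2 the last term disappears. For c = 3/2 it cancels the term with Φ' that arises when
the function is multiplied by z. The even and the odd part of D_p thus satisfy the same equation y''
= (z²/4 - p - 1/2)y. -/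
theorem hasDerivAt_gaussKummerDeriv (hc : ∀ n : ℕ, c ≠ -n) (a z : ℂ) :
    HasDerivAt (gaussKummerDeriv a c)
      ((z ^ 2 / 4 - 1 / 2 + 2 * a) * gaussKummer a c z
        + (1 - 2 * c) * (exp (-z ^ 2 / 4) * deriv (kummer a c) (z ^ 2 / 2))) z := by
  have h1 := (hasDerivAt_kummer a c _).comp z (hasDerivAt_sq_half z)
  have h2 := (hasDerivAt_deriv_kummer a c _).comp z (hasDerivAt_sq_half z)
  refine ((hasDerivAt_exp_neg_sq z).mul ((((hasDerivAt_id z).neg.div_const 2).mul h1).add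
    ((hasDerivAt_id z).mul h2))).congr_deriv ?_
  have := kummer_equation (a := a) hc (z ^ 2 / 2)
  simp only [gaussKummer, Function.comp, Pi.mul_apply, Pi.add_apply, Pi.neg_apply, id]
  linear_combination 2 * exp (-z ^ 2 / 4) * this

theorem gaussKummer_zero (hc : ∀ n : ℕ, c ≠ -n) : gaussKummer a c 0 = 1 := by
  simp [gaussKummer, kummer_zero hc]

theorem half_ne_neg_nat (n : ℕ) : (1 / 2 : ℂ) ≠ -n := by
  intro h
  have := congrArg re h
  simp at this
  linarith [n.cast_nonneg (α := ℝ)]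

theorem three_half_ne_neg_nat (n : ℕ) : (3 / 2 : ℂ) ≠ -n := by
  intro h
  have := congrArg re h
  simp at this
  linarith [n.cast_nonneg (α := ℝ)]

/-- The even coefficient of the parabolic cylinder function. -/
noncomputable def cylEven (p : ℂ) : ℂ :=
  (2 : ℂ) ^ (p / 2) * ((Real.sqrt Real.pi : ℂ) / Gamma ((1 - p) / 2))

/-- The odd coefficient of the parabolic cylinder function. -/
noncomputable def cylOdd (p : ℂ) : ℂ :=
  -((2 : ℂ) ^ (p / 2) * ((Real.sqrt (2 * Real.pi) : ℂ) / Gamma (-p / 2)))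

theorem parabolicCylinder_eq (p : ℂ) : parabolicCylinder p = fun z =>
    cylEven p * gaussKummer (-p / 2) (1 / 2) z
      + cylOdd p * (z * gaussKummer ((1 - p) / 2) (3 / 2) z) := by
  ext z
  simp only [parabolicCylinder, cylEven, cylOdd, gaussKummer]
  ring

/-- The derivative of the parabolic cylinder function. -/
noncomputable def parabolicCylinderDeriv (p z : ℂ) : ℂ :=
  cylEven p * gaussKummerDeriv (-p / 2) (1 / 2) z
    + cylOdd p * (gaussKummer ((1 - p) / 2) (3 / 2) z
      + z * gaussKummerDeriv ((1 - p) / 2) (3 / 2) z)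

theorem hasDerivAt_parabolicCylinder (p z : ℂ) :
    HasDerivAt (parabolicCylinder p) (parabolicCylinderDeriv p z) z := by
  rw [parabolicCylinder_eq]
  refine (((hasDerivAt_gaussKummer _ _ z).const_mul (cylEven p)).add
    (((hasDerivAt_id z).mul (hasDerivAt_gaussKummer _ _ z)).const_mul (cylOdd p))).congr_deriv ?_
  simp [parabolicCylinderDeriv]

/-- The differential equation of the parabolic cylinder function. -/
theorem hasDerivAt_parabolicCylinderDeriv (p z : ℂ) :
    HasDerivAt (parabolicCylinderDeriv p)
      ((z ^ 2 / 4 - p - 1 / 2) * parabolicCylinder p z) z := by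
  have h1 := hasDerivAt_gaussKummerDeriv half_ne_neg_nat (-p / 2) z
  have h2 := hasDerivAt_gaussKummerDeriv three_half_ne_neg_nat ((1 - p) / 2) z
  refine ((h1.const_mul (cylEven p)).add (((hasDerivAt_gaussKummer _ _ z).add
    ((hasDerivAt_id z).mul h2)).const_mul (cylOdd p))).congr_deriv ?_
  rw [parabolicCylinder_eq]
  simp only [gaussKummerDeriv, gaussKummer, id]
  ring

theorem parabolicCylinder_zero (p : ℂ) : parabolicCylinder p 0 = cylEven p := by
  simp only [parabolicCylinder_eq, gaussKummer_zero half_ne_neg_nat]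
  ring

theorem parabolicCylinderDeriv_zero (p : ℂ) : parabolicCylinderDeriv p 0 = cylOdd p := by
  simp [parabolicCylinderDeriv, gaussKummer_zero three_half_ne_neg_nat, gaussKummerDeriv]

theorem deriv_parabolicCylinder (p : ℂ) :
    deriv (parabolicCylinder p) = parabolicCylinderDeriv p :=
  funext fun z => (hasDerivAt_parabolicCylinder p z).deriv

theorem hasDerivAt_parabolicCylinder_neg (p z : ℂ) :
    HasDerivAt (fun z => parabolicCylinder p (-z)) (-parabolicCylinderDeriv p (-z)) z := by
  simpa using! (hasDerivAt_parabolicCylinder p (-z)).scomp z (hasDerivAt_neg z)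

theorem hasDerivAt_parabolicCylinderDeriv_neg (p z : ℂ) :
    HasDerivAt (fun z => -parabolicCylinderDeriv p (-z))
      ((z ^ 2 / 4 - p - 1 / 2) * parabolicCylinder p (-z)) z := by
  simpa using! ((hasDerivAt_parabolicCylinderDeriv p (-z)).scomp z (hasDerivAt_neg z)).neg

/-- The equation has no first-derivative term, so the Wronskian is constant. At 0 only the even
coefficient (value) and the odd coefficient (derivative) enter. -/
theorem wronsk_parabolicCylinder (p z : ℂ) :
    wronsk (parabolicCylinder p) (fun z => parabolicCylinder p (-z)) z =
      -2 * cylEven p * cylOdd p := by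
  have e : ∀ z, wronsk (parabolicCylinder p) (fun z => parabolicCylinder p (-z)) z =
      parabolicCylinder p z * -parabolicCylinderDeriv p (-z)
        - parabolicCylinder p (-z) * parabolicCylinderDeriv p z := fun z => by
    rw [wronsk, (hasDerivAt_parabolicCylinder_neg p z).deriv, deriv_parabolicCylinder]
  have hd : ∀ z, HasDerivAt (fun z => parabolicCylinder p z * -parabolicCylinderDeriv p (-z)
        - parabolicCylinder p (-z) * parabolicCylinderDeriv p z) 0 z := fun z => by
    refine (((hasDerivAt_parabolicCylinder p z).mul
      (hasDerivAt_parabolicCylinderDeriv_neg p z)).sub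
      ((hasDerivAt_parabolicCylinder_neg p z).mul
        (hasDerivAt_parabolicCylinderDeriv p z))).congr_deriv ?_
    ring
  rw [e, is_const_of_deriv_eq_zero (fun z => (hd z).differentiableAt) (fun z => (hd z).deriv) z 0,
    neg_zero, parabolicCylinder_zero, parabolicCylinderDeriv_zero]
  ring

/-- The two coefficients could vanish only where a Gamma factor in a denominator is at a pole;
`Gamma` has the value 0 there, so the quotient is 0. All these poles lie at integers p. -/
theorem wronsk_parabolicCylinder_ne_zero (hp : p.im ≠ 0) (z : ℂ) :
    wronsk (parabolicCylinder p) (fun z => parabolicCylinder p (-z)) z ≠ 0 := by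
  have h2 : (2 : ℂ) ^ (p / 2) ≠ 0 := by simp [cpow_eq_zero_iff]
  have hpi : (Real.sqrt Real.pi : ℂ) ≠ 0 :=
    ofReal_ne_zero.2 (Real.sqrt_ne_zero'.2 Real.pi_pos)
  have hg1 : Gamma ((1 - p) / 2) ≠ 0 := Gamma_ne_zero fun n h => hp <| by
    have := congrArg im h
    simpa using this
  have hg2 : Gamma (-p / 2) ≠ 0 := Gamma_ne_zero fun n h => hp <| by
    have := congrArg im h
    simpa using this
  rw [wronsk_parabolicCylinder, cylEven, cylOdd]
  simp [h2, hpi, hg1, hg2]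

end ParabolicCylinder

/-! ### Constant coefficient h = k. -/

section ConstantCoefficient

variable {J : Set ℝ} {r₀ v₀ : E3} {k : ℝ}

theorem cylP_im_ne_zero (hw : wedge r₀ v₀ ≠ 0) (hk : k ≠ 0) : (cylP k r₀ v₀).im ≠ 0 := by
  have hb := (speed_pos hw).ne'
  have hc := (parC_pos hw).ne'
  have e : cylP k r₀ v₀ = ((-1 : ℝ) : ℂ) + ((-(k * parC r₀ v₀ ^ 2 / (4 * speed v₀)) : ℝ) : ℂ) * I := by
    rw [cylP]; push_cast; ring
  rw [e, add_im, ofReal_im, zero_add, im_ofReal_mul, I_im, mul_one]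
  simp [hb, hc, hk]

theorem hasDerivAt_cylTau (k : ℝ) (r₀ v₀ : E3) (t : ℝ) :
    HasDerivAt (cylTau k r₀ v₀) ((I * k * speed v₀) ^ (1 / 2 : ℂ)) t := by
  have h1 : HasDerivAt (fun t : ℝ => ((t + beta r₀ v₀ / speed v₀ ^ 2 : ℝ) : ℂ)) 1 t := by
    simpa using! ((hasDerivAt_id t).add_const (beta r₀ v₀ / speed v₀ ^ 2)).ofReal_comp
  exact (h1.const_mul ((I * k * speed v₀) ^ (1 / 2 : ℂ))).congr_deriv (mul_one _)

theorem ofReal_mul_cpow {x : ℝ} (hx : 0 < x) {y : ℂ} (hy : y ≠ 0) (s : ℂ) :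
    ((x : ℂ) * y) ^ s = (x : ℂ) ^ s * y ^ s := by
  have hx' : (x : ℂ) ≠ 0 := ofReal_ne_zero.2 hx.ne'
  rw [cpow_def_of_ne_zero (mul_ne_zero hx' hy), cpow_def_of_ne_zero hx', cpow_def_of_ne_zero hy,
    log_ofReal_mul hx hy, ofReal_log hx.le, add_mul, exp_add]

/-- The first factor is dτ/dt, so this says that k̃ is the τ-derivative belonging to ḟ(0) = iak/2.
The two principal roots multiply to ik without a sign because b > 0. -/
theorem sqrt_mul_cylK (hw : wedge r₀ v₀ ≠ 0) (hk : k ≠ 0) :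
    (I * k * speed v₀) ^ (1 / 2 : ℂ) * cylK k r₀ v₀ = I * parA r₀ v₀ * k / 2 := by
  have hb := speed_pos hw
  have hb' : (speed v₀ : ℂ) ≠ 0 := ofReal_ne_zero.2 hb.ne'
  have hk' : I * k ≠ 0 := mul_ne_zero I_ne_zero (ofReal_ne_zero.2 hk)
  have e1 := ofReal_mul_cpow hb hk' (1 / 2)
  have e2 := ofReal_mul_cpow hb (div_ne_zero hk' hb') (1 / 2)
  rw [mul_div_cancel₀ _ hb'] at e2
  rw [mul_comm _ (speed v₀ : ℂ), e1, e2, cylK]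
  have h1 := cpow_half_sq (speed v₀)
  have h2 := cpow_half_sq (I * k / speed v₀)
  set x := (speed v₀ : ℂ) ^ (1 / 2 : ℂ)
  set y := (I * k / speed v₀ : ℂ) ^ (1 / 2 : ℂ)
  have h3 : x ^ 2 * y ^ 2 = I * k := by rw [h1, h2]; field_simp
  linear_combination (parA r₀ v₀ : ℂ) / 2 * h3

theorem isGenerating_parabolicCylinder (hw : wedge r₀ v₀ ≠ 0) (hk : k ≠ 0)
    {u w : ℂ → ℂ} {A B : ℂ} (hu : u = parabolicCylinder (cylP k r₀ v₀))
    (hv : w = fun τ => parabolicCylinder (cylP k r₀ v₀) (-τ))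
    (hA : A = coeffFst u w (cylTau k r₀ v₀ 0) 1 (cylK k r₀ v₀))
    (hB : B = coeffSnd u w (cylTau k r₀ v₀ 0) 1 (cylK k r₀ v₀)) :
    IsGenerating (fun _ => k) r₀ v₀ J
      (fun t => A * u (cylTau k r₀ v₀ t) + B * w (cylTau k r₀ v₀ t)) := by
  set p := cylP k r₀ v₀ with hp
  set τ := cylTau k r₀ v₀ with hτ
  set σ := (I * k * speed v₀) ^ (1 / 2 : ℂ) with hσ
  have hW : wronsk u w (τ 0) ≠ 0 := by
    rw [hu, hv]
    exact wronsk_parabolicCylinder_ne_zero (cylP_im_ne_zero hw hk) _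
  have d1 : ∀ t, HasDerivAt (fun t => A * u (τ t) + B * w (τ t))
      (σ * (A * deriv u (τ t) + B * deriv w (τ t))) t := fun t => by
    have h1 := (hasDerivAt_parabolicCylinder p (τ t)).scomp t (hasDerivAt_cylTau k r₀ v₀ t)
    have h2 := (hasDerivAt_parabolicCylinder_neg p (τ t)).scomp t (hasDerivAt_cylTau k r₀ v₀ t)
    rw [hu, hv, (hasDerivAt_parabolicCylinder p (τ t)).deriv,
      (hasDerivAt_parabolicCylinder_neg p (τ t)).deriv]
    refine ((h1.const_mul A).add (h2.const_mul B)).congr_deriv ?_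
    simp only [smul_eq_mul]
    ring
  have e1 : deriv (fun t => A * u (τ t) + B * w (τ t)) = _ := funext fun t => (d1 t).deriv
  have hb : (speed v₀ : ℂ) ≠ 0 := ofReal_ne_zero.2 (speed_pos hw).ne'
  refine ⟨fun t _ => ⟨(d1 t).differentiableAt, ?_⟩, ?_, ?_⟩
  · rw [e1]
    have h1 := (hasDerivAt_parabolicCylinderDeriv p (τ t)).scomp t (hasDerivAt_cylTau k r₀ v₀ t)
    have h2 := (hasDerivAt_parabolicCylinderDeriv_neg p (τ t)).scomp t
      (hasDerivAt_cylTau k r₀ v₀ t)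
    have e2 : deriv w = fun z => -parabolicCylinderDeriv p (-z) := by
      rw [hv]; exact funext fun z => (hasDerivAt_parabolicCylinder_neg p z).deriv
    rw [hu, deriv_parabolicCylinder, e2, hv]
    refine (((h1.const_mul A).add (h2.const_mul B)).const_mul σ).congr_deriv ?_
    have hσ2 : σ ^ 2 = I * k * speed v₀ := cpow_half_sq _
    simp only [smul_eq_mul, deriv_const]
    -- Here σ² = ikb: the term in τ² gives -k²(a+bt)²/4, and -σ²(p + 1/2) gives ibk/2 - k²c²/4. This
    -- is what fixes the value of p.
    have hq : σ ^ 2 * (τ t ^ 2 / 4 - p - 1 / 2) =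
        -(chi r₀ v₀ t : ℂ) * ((k : ℂ) / 2) ^ 2 + I * speed v₀ * k / 2 := by
      rw [hτ, cylTau, ← hσ, mul_pow, hσ2, hp, cylP, chi_eq hw, ← speed_mul_parA hw]
      push_cast
      field_simp
      ring_nf
      simp only [I_sq]
      ring
    rw [← hq]
    push_cast
    ring
  · rw [hA, hB]; exact coeff_value hW _ _
  · rw [e1, ← sqrt_mul_cylK hw hk, ← hσ, hA, hB]
    simp only [coeff_deriv hW]

end ConstantCoefficient

end VectorNewton

/-! ### Whittaker functions. -/

namespace VectorNewton

open Set Filter Topology Complex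

section Whittaker

variable {l m z : ℂ}

/-- The entire factor `e^(-z/2) Φ(m-l+1/2, 2m+1; z)` of `M_{l,m}(z)`. -/
noncomputable def whitP (l m z : ℂ) : ℂ :=
  exp (-z / 2) * kummer (m - l + 1 / 2) (2 * m + 1) z

/-- The derivative of `whitP`. -/
noncomputable def whitP' (l m z : ℂ) : ℂ :=
  exp (-z / 2) * (deriv (kummer (m - l + 1 / 2) (2 * m + 1)) z
    - kummer (m - l + 1 / 2) (2 * m + 1) z / 2)

/-- The second derivative of `whitP`. -/
noncomputable def whitP'' (l m z : ℂ) : ℂ :=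
  exp (-z / 2) * (deriv (deriv (kummer (m - l + 1 / 2) (2 * m + 1))) z
    - deriv (kummer (m - l + 1 / 2) (2 * m + 1)) z + kummer (m - l + 1 / 2) (2 * m + 1) z / 4)

theorem hasDerivAt_exp_neg_half (z : ℂ) :
    HasDerivAt (fun z : ℂ => exp (-z / 2)) (exp (-z / 2) * (-1 / 2)) z :=
  ((hasDerivAt_id z).neg.div_const 2).cexp

theorem hasDerivAt_whitP (l m z : ℂ) : HasDerivAt (whitP l m) (whitP' l m z) z := by
  refine ((hasDerivAt_exp_neg_half z).mul (hasDerivAt_kummer _ _ z)).congr_deriv ?_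
  rw [whitP']
  ring

theorem hasDerivAt_whitP' (l m z : ℂ) : HasDerivAt (whitP' l m) (whitP'' l m z) z := by
  refine ((hasDerivAt_exp_neg_half z).mul ((hasDerivAt_deriv_kummer _ _ z).sub
    ((hasDerivAt_kummer _ _ z).div_const 2))).congr_deriv ?_
  simp only [whitP'', Pi.sub_apply]
  ring

/-- A nonreal m keeps both 2m+1 and -2m+1 away from the exceptional parameters, so M_{l,m} and
M_{l,-m} are both available. -/
theorem two_mul_add_one_ne_neg_nat (hm : m.im ≠ 0) (n : ℕ) : 2 * m + 1 ≠ -n := fun h => hm <| by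
  have := congrArg im h
  simpa using this

/-- Whittaker's equation with the power z^(m+1/2) split off: the remaining factor is entire, and the
equation is Kummer's multiplied by e^(-z/2). -/
theorem whitP_equation (hm : m.im ≠ 0) (l z : ℂ) :
    z * whitP'' l m z + (2 * m + 1) * whitP' l m z + (l - z / 4) * whitP l m z = 0 := by
  have := kummer_equation (a := m - l + 1 / 2) (two_mul_add_one_ne_neg_nat hm) z
  rw [whitP, whitP', whitP'']
  linear_combination exp (-z / 2) * this

theorem whitP_zero (hm : m.im ≠ 0) (l : ℂ) : whitP l m 0 = 1 := by
  simp [whitP, kummer_zero (two_mul_add_one_ne_neg_nat hm)]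

theorem neg_im_ne_zero (hm : m.im ≠ 0) : (-m).im ≠ 0 := by simpa using hm

/-- The Wronskian of `M_{l,m}` and `M_{l,-m}`, in terms of their entire factors. -/
theorem whitP_wronskian (hm : m.im ≠ 0) (l z : ℂ) :
    -2 * m * (whitP l m z * whitP l (-m) z)
      + z * (whitP l m z * whitP' l (-m) z - whitP l (-m) z * whitP' l m z) = -2 * m := by
  have hd : ∀ z, HasDerivAt (fun z => -2 * m * (whitP l m z * whitP l (-m) z)
      + z * (whitP l m z * whitP' l (-m) z - whitP l (-m) z * whitP' l m z)) 0 z := fun z => by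
    have p0 := hasDerivAt_whitP l m z
    have p1 := hasDerivAt_whitP' l m z
    have q0 := hasDerivAt_whitP l (-m) z
    have q1 := hasDerivAt_whitP' l (-m) z
    refine (((p0.mul q0).const_mul (-2 * m)).add
      ((hasDerivAt_id z).mul ((p0.mul q1).sub (q0.mul p1)))).congr_deriv ?_
    have e1 := whitP_equation hm l z
    have e2 := whitP_equation (neg_im_ne_zero hm) l z
    simp only [id, Pi.mul_apply, Pi.sub_apply]
    linear_combination whitP l m z * e2 - whitP l (-m) z * e1
  have := is_const_of_deriv_eq_zero (fun z => (hd z).differentiableAt) (fun z => (hd z).deriv) z 0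
  simpa [whitP_zero hm, whitP_zero (neg_im_ne_zero hm)] using this

theorem whittakerM_eq (l m z : ℂ) : whittakerM l m z = z ^ (m + 1 / 2) * whitP l m z := by
  rw [whittakerM, whitP, mul_assoc]

/-- The derivative of `M_{l,m}`. -/
noncomputable def whittakerM' (l m z : ℂ) : ℂ :=
  z ^ (m + 1 / 2) * ((m + 1 / 2) / z * whitP l m z + whitP' l m z)

theorem mem_slitPlane_of_im_ne_zero (hz : z.im ≠ 0) : z ∈ slitPlane := Or.inr hz

theorem hasDerivAt_cpow_slit (hz : z.im ≠ 0) (s : ℂ) :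
    HasDerivAt (fun z : ℂ => z ^ s) (z ^ s * (s / z)) z := by
  have hz0 : z ≠ 0 := fun h => hz (by simp [h])
  refine ((hasDerivAt_id z).cpow_const (mem_slitPlane_of_im_ne_zero hz)).congr_deriv ?_
  rw [id, cpow_sub _ _ hz0, cpow_one]
  ring

theorem hasDerivAt_whittakerM (hz : z.im ≠ 0) (l m : ℂ) :
    HasDerivAt (whittakerM l m) (whittakerM' l m z) z := by
  rw [show whittakerM l m = _ from funext (whittakerM_eq l m)]
  refine ((hasDerivAt_cpow_slit hz _).mul (hasDerivAt_whitP l m z)).congr_deriv ?_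
  rw [whittakerM']
  ring

theorem hasDerivAt_whittakerM' (hm : m.im ≠ 0) (hz : z.im ≠ 0) (l : ℂ) :
    HasDerivAt (whittakerM' l m)
      (-(1 / 4 * (1 / z ^ 2 - 1) + l / z - m ^ 2 / z ^ 2) * whittakerM l m z) z := by
  have hz0 : z ≠ 0 := fun h => hz (by simp [h])
  have h1 := ((hasDerivAt_const z (m + 1 / 2)).div (hasDerivAt_id z) hz0)
  refine ((hasDerivAt_cpow_slit hz _).mul ((h1.mul (hasDerivAt_whitP l m z)).add
    (hasDerivAt_whitP' l m z))).congr_deriv ?_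
  have he := whitP_equation hm l z
  rw [whittakerM_eq]
  simp only [id, Pi.mul_apply, Pi.add_apply, Pi.div_apply]
  generalize z ^ (m + 1 / 2) = x
  field_simp
  linear_combination 16 * x * z * he

/-- A combination of `M_{l,m}` and `M_{l,-m}`. -/
noncomputable def whitComb (l m c₁ c₂ z : ℂ) : ℂ :=
  c₁ * whittakerM l m z + c₂ * whittakerM l (-m) z

variable {c₁ c₂ d₁ d₂ : ℂ} {y y₁ : ℂ → ℂ}

theorem hasDerivAt_whitComb (hz : z.im ≠ 0) (l m c₁ c₂ : ℂ) :
    HasDerivAt (whitComb l m c₁ c₂) (c₁ * whittakerM' l m z + c₂ * whittakerM' l (-m) z) z :=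
  ((hasDerivAt_whittakerM hz l m).const_mul c₁).add
    ((hasDerivAt_whittakerM hz l (-m)).const_mul c₂)

theorem eventually_im_ne_zero (hz : z.im ≠ 0) : ∀ᶠ x in 𝓝 z, x.im ≠ 0 :=
  continuous_im.continuousAt.eventually_ne hz

theorem whittakerEqAt_of_eventuallyEq (hm : m.im ≠ 0) (hz : z.im ≠ 0)
    (hy : y =ᶠ[𝓝 z] whitComb l m c₁ c₂) : WhittakerEqAt l m y z := by
  have e1 : deriv y =ᶠ[𝓝 z] fun z => c₁ * whittakerM' l m z + c₂ * whittakerM' l (-m) z :=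
    hy.deriv.trans (by
      filter_upwards [eventually_im_ne_zero hz] with x hx
      exact (hasDerivAt_whitComb hx l m c₁ c₂).deriv)
  have e2 := ((hasDerivAt_whittakerM' hm hz l).const_mul c₁).add
    ((hasDerivAt_whittakerM' (neg_im_ne_zero hm) hz l).const_mul c₂)
  rw [WhittakerEqAt, e1.deriv_eq, hy.self_of_nhds, whitComb]
  rw [show deriv (fun z => c₁ * whittakerM' l m z + c₂ * whittakerM' l (-m) z) z = _ from e2.deriv]
  ring

/-- The powers z^(m+1/2) and z^(-m+1/2) multiply to z, so the Wronskian of M_{l,m} and M_{l,-m}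
reduces to that of the entire factors, the constant -2m. Bilinearity supplies the determinant. Local
equality suffices because W_{-l,m}(-z) has different expansions in the two half-planes. -/
theorem wronsk_of_eventuallyEq (hm : m.im ≠ 0) (hz : z.im ≠ 0)
    (hy : y =ᶠ[𝓝 z] whitComb l m c₁ c₂) (hy₁ : y₁ =ᶠ[𝓝 z] whitComb l m d₁ d₂) :
    wronsk y y₁ z = (c₁ * d₂ - c₂ * d₁) * (-2 * m) := by
  have hz0 : z ≠ 0 := fun h => hz (by simp [h])
  have hp : z ^ (m + 1 / 2) * z ^ (-m + 1 / 2) = z := by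
    rw [← cpow_add _ _ hz0]
    convert cpow_one z using 2
    ring
  rw [wronsk, hy.deriv_eq, hy₁.deriv_eq, hy.self_of_nhds, hy₁.self_of_nhds,
    (hasDerivAt_whitComb hz l m c₁ c₂).deriv, (hasDerivAt_whitComb hz l m d₁ d₂).deriv, whitComb,
    whitComb, whittakerM_eq, whittakerM_eq, whittakerM', whittakerM', ← whitP_wronskian hm l z]
  generalize z ^ (m + 1 / 2) = x at *
  generalize z ^ (-m + 1 / 2) = x' at *
  field_simp
  generalize whitP l m z = P
  generalize whitP l (-m) z = Q
  generalize whitP' l m z = P'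
  generalize whitP' l (-m) z = Q'
  linear_combination 2 * (c₁ * d₂ - c₂ * d₁) * (-2 * m * P * Q + z * (P * Q' - Q * P')) * hp

theorem log_neg_of_im_pos (hz : 0 < z.im) : log (-z) = log z - Real.pi * I := by
  rw [log, log, norm_neg, arg_neg_eq_arg_sub_pi_of_im_pos hz]
  push_cast
  ring

theorem log_neg_of_im_neg (hz : z.im < 0) : log (-z) = log z + Real.pi * I := by
  rw [log, log, norm_neg, arg_neg_eq_arg_add_pi_of_im_neg hz]
  push_cast
  ring

theorem neg_cpow_of_im_pos (hz : 0 < z.im) (s : ℂ) :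
    (-z) ^ s = exp (-(Real.pi * I * s)) * z ^ s := by
  have hz0 : z ≠ 0 := fun h => hz.ne' (by simp [h])
  rw [cpow_def_of_ne_zero (neg_ne_zero.2 hz0), cpow_def_of_ne_zero hz0, log_neg_of_im_pos hz,
    ← exp_add]
  congr 1
  ring

theorem neg_cpow_of_im_neg (hz : z.im < 0) (s : ℂ) :
    (-z) ^ s = exp (Real.pi * I * s) * z ^ s := by
  have hz0 : z ≠ 0 := fun h => hz.ne (by simp [h])
  rw [cpow_def_of_ne_zero (neg_ne_zero.2 hz0), cpow_def_of_ne_zero hz0, log_neg_of_im_neg hz,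
    ← exp_add]
  congr 1
  ring

/-- Kummer's transformation. Under (l, z) ↦ (-l, -z) only the power of z changes, by a phase that
depends on the half-plane. -/
theorem whitP_neg (hm : m.im ≠ 0) (l z : ℂ) : whitP (-l) m (-z) = whitP l m z := by
  have h1 := kummer_neg (two_mul_add_one_ne_neg_nat hm) (m - l + 1 / 2) z
  rw [whitP, whitP, ← h1, show 2 * m + 1 - (m - l + 1 / 2) = m - -l + 1 / 2 by ring, ← mul_assoc,
    ← exp_add]
  congr 2
  ring

/-- The coefficients of `W_{l,m}`. -/
noncomputable def whitW₁ (l m : ℂ) : ℂ := Gamma (-2 * m) / Gamma (1 / 2 - m - l)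

/-- The coefficients of `W_{l,m}`. -/
noncomputable def whitW₂ (l m : ℂ) : ℂ := Gamma (2 * m) / Gamma (1 / 2 + m - l)

theorem whittakerW_eq (l m : ℂ) : whittakerW l m = whitComb l m (whitW₁ l m) (whitW₂ l m) := rfl

theorem whittakerW_neg_of_im_pos (hm : m.im ≠ 0) (l : ℂ) (hz : 0 < z.im) :
    whittakerW (-l) m (-z) = whitComb l m
      (whitW₁ (-l) m * exp (-(Real.pi * I * (m + 1 / 2))))
      (whitW₂ (-l) m * exp (-(Real.pi * I * (-m + 1 / 2)))) z := by
  rw [whittakerW_eq, whitComb, whitComb, whittakerM_eq, whittakerM_eq, whittakerM_eq,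
    whittakerM_eq, whitP_neg hm, whitP_neg (neg_im_ne_zero hm), neg_cpow_of_im_pos hz,
    neg_cpow_of_im_pos hz]
  ring

theorem whittakerW_neg_of_im_neg (hm : m.im ≠ 0) (l : ℂ) (hz : z.im < 0) :
    whittakerW (-l) m (-z) = whitComb l m
      (whitW₁ (-l) m * exp (Real.pi * I * (m + 1 / 2)))
      (whitW₂ (-l) m * exp (Real.pi * I * (-m + 1 / 2))) z := by
  rw [whittakerW_eq, whitComb, whitComb, whittakerM_eq, whittakerM_eq, whittakerM_eq,
    whittakerM_eq, whitP_neg hm, whitP_neg (neg_im_ne_zero hm), neg_cpow_of_im_neg hz,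
    neg_cpow_of_im_neg hz]
  ring

/-- Euler's reflection formula for reciprocals; in this form it also holds at the poles. -/
theorem Gamma_half_inv (s : ℂ) :
    (Gamma (1 / 2 - s))⁻¹ * (Gamma (1 / 2 + s))⁻¹ = cos (Real.pi * s) / Real.pi := by
  have h1 := Gamma_mul_Gamma_one_sub (1 / 2 + s)
  rw [show 1 - (1 / 2 + s) = 1 / 2 - s by ring] at h1
  rw [← mul_inv, mul_comm, h1, inv_div, mul_add, add_comm, show (Real.pi : ℂ) * (1 / 2) =
    Real.pi / 2 by ring, sin_add_pi_div_two]

theorem exp_four_pi_ne_one (hm : m.im ≠ 0) : exp (Real.pi * m * I) ^ 4 ≠ 1 := by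
  intro h
  have h1 := congrArg norm h
  rw [norm_pow, norm_exp, norm_one, ← Real.exp_nat_mul, Real.exp_eq_one_iff] at h1
  simp [Real.pi_ne_zero, hm] at h1

/-- The determinant of the coefficients of W_{l,m}(z) and W_{-l,m}(-z) in terms of M_{l,±m}; x and y
stand for the phases picked up by z^(±m+1/2). In each product the two reciprocal Gamma factors
combine to a cosine. -/
theorem whitDet_eq (l m x y : ℂ) :
    whitW₁ l m * (whitW₂ (-l) m * y) - whitW₂ l m * (whitW₁ (-l) m * x) =
      Gamma (2 * m) * Gamma (-2 * m) / Real.pi *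
        (y * cos (Real.pi * (m + l)) - x * cos (Real.pi * (l - m))) := by
  have h1 := Gamma_half_inv (m + l)
  have h2 := Gamma_half_inv (l - m)
  rw [show 1 / 2 - (m + l) = 1 / 2 - m - l by ring,
    show 1 / 2 + (m + l) = 1 / 2 + m - -l by ring] at h1
  rw [show 1 / 2 - (l - m) = 1 / 2 + m - l by ring,
    show 1 / 2 + (l - m) = 1 / 2 - m - -l by ring] at h2
  simp only [whitW₁, whitW₂, div_eq_mul_inv] at *
  linear_combination Gamma (2 * m) * Gamma (-2 * m) * (y * h1 - x * h2)

theorem cos_eq_exp_mul (s t : ℂ) : cos (Real.pi * (s + t)) =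
    (exp (Real.pi * s * I) * exp (Real.pi * t * I)
      + (exp (Real.pi * s * I))⁻¹ * (exp (Real.pi * t * I))⁻¹) / 2 := by
  rw [cos, ← exp_neg, ← exp_neg, ← exp_add, ← exp_add]
  congr 3 <;> ring

theorem Gamma_factor_ne_zero (hm : m.im ≠ 0) :
    Gamma (2 * m) * Gamma (-2 * m) / Real.pi ≠ 0 := by
  refine div_ne_zero (mul_ne_zero (Gamma_ne_zero fun n h => hm ?_)
    (Gamma_ne_zero fun n h => hm ?_)) (by exact_mod_cast Real.pi_ne_zero)
  all_goals simpa using congrArg im h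

/-- With q = e^(iπm) and p = e^(iπl) the bracket collapses to a nonzero factor times p(q⁴ -
1)/(2q²). So l enters only through a nonvanishing exponential, and q⁴ ≠ 1 because |q| ≠ 1. -/
theorem whitDet_ne_zero_of_im_pos (hm : m.im ≠ 0) (l : ℂ) :
    whitW₁ l m * (whitW₂ (-l) m * exp (-(Real.pi * I * (-m + 1 / 2))))
      - whitW₂ l m * (whitW₁ (-l) m * exp (-(Real.pi * I * (m + 1 / 2)))) ≠ 0 := by
  rw [whitDet_eq]
  refine mul_ne_zero (Gamma_factor_ne_zero hm) ?_
  have hy : exp (-(Real.pi * I * (-m + 1 / 2))) =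
      exp (-(Real.pi * I / 2)) * exp (Real.pi * m * I) := by
    rw [← exp_add]; congr 1; ring
  have hx : exp (-(Real.pi * I * (m + 1 / 2))) =
      exp (-(Real.pi * I / 2)) * (exp (Real.pi * m * I))⁻¹ := by
    rw [← exp_neg, ← exp_add]; congr 1; ring
  have hq := exp_four_pi_ne_one hm
  have hq0 := exp_ne_zero (Real.pi * m * I)
  have hp0 := exp_ne_zero (Real.pi * l * I)
  have hm' : exp (Real.pi * -m * I) = (exp (Real.pi * m * I))⁻¹ := by
    rw [← exp_neg]; congr 1; ring
  rw [sub_eq_add_neg l m, cos_eq_exp_mul, cos_eq_exp_mul, hx, hy, hm']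
  generalize exp (Real.pi * m * I) = q at *
  generalize exp (Real.pi * l * I) = p at *
  have : exp (-(Real.pi * I / 2)) * q * ((q * p + q⁻¹ * p⁻¹) / 2)
      - exp (-(Real.pi * I / 2)) * q⁻¹ * ((p * q⁻¹ + p⁻¹ * q⁻¹⁻¹) / 2) =
      exp (-(Real.pi * I / 2)) * (p * (q ^ 4 - 1) / (2 * q ^ 2)) := by
    field_simp
    ring
  rw [this]
  exact mul_ne_zero (exp_ne_zero _) (div_ne_zero (mul_ne_zero hp0 (sub_ne_zero.2 hq))
    (by simp [hq0]))

theorem whitDet_ne_zero_of_im_neg (hm : m.im ≠ 0) (l : ℂ) :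
    whitW₁ l m * (whitW₂ (-l) m * exp (Real.pi * I * (-m + 1 / 2)))
      - whitW₂ l m * (whitW₁ (-l) m * exp (Real.pi * I * (m + 1 / 2))) ≠ 0 := by
  rw [whitDet_eq]
  refine mul_ne_zero (Gamma_factor_ne_zero hm) ?_
  have hy : exp (Real.pi * I * (-m + 1 / 2)) =
      exp (Real.pi * I / 2) * (exp (Real.pi * m * I))⁻¹ := by
    rw [← exp_neg, ← exp_add]; congr 1; ring
  have hx : exp (Real.pi * I * (m + 1 / 2)) =
      exp (Real.pi * I / 2) * exp (Real.pi * m * I) := by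
    rw [← exp_add]; congr 1; ring
  have hq := exp_four_pi_ne_one hm
  have hq0 := exp_ne_zero (Real.pi * m * I)
  have hp0 := exp_ne_zero (Real.pi * l * I)
  have hm' : exp (Real.pi * -m * I) = (exp (Real.pi * m * I))⁻¹ := by
    rw [← exp_neg]; congr 1; ring
  rw [sub_eq_add_neg l m, cos_eq_exp_mul, cos_eq_exp_mul, hx, hy, hm']
  generalize exp (Real.pi * m * I) = q at *
  generalize exp (Real.pi * l * I) = p at *
  have : exp (Real.pi * I / 2) * q⁻¹ * ((q * p + q⁻¹ * p⁻¹) / 2)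
      - exp (Real.pi * I / 2) * q * ((p * q⁻¹ + p⁻¹ * q⁻¹⁻¹) / 2) =
      exp (Real.pi * I / 2) * (-(q ^ 4 - 1) / (2 * q ^ 2 * p)) := by
    field_simp
    ring
  rw [this]
  exact mul_ne_zero (exp_ne_zero _) (div_ne_zero (neg_ne_zero.2 (sub_ne_zero.2 hq))
    (by simp [hq0, hp0]))

/-- Off the real axis, `W_{-l,m}(-z)` is a combination of `M_{l,m}` and `M_{l,-m}` that is
independent of `W_{l,m}`. -/
theorem exists_whittakerW_neg (hm : m.im ≠ 0) (l : ℂ) (hz : z.im ≠ 0) :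
    ∃ d₁ d₂ : ℂ, ((fun z => whittakerW (-l) m (-z)) =ᶠ[𝓝 z] whitComb l m d₁ d₂) ∧
      whitW₁ l m * d₂ - whitW₂ l m * d₁ ≠ 0 := by
  rcases hz.lt_or_gt with h | h
  · refine ⟨_, _, ?_, whitDet_ne_zero_of_im_neg hm l⟩
    filter_upwards [(isOpen_lt continuous_im continuous_const).mem_nhds h] with x hx
    exact whittakerW_neg_of_im_neg hm l hx
  · refine ⟨_, _, ?_, whitDet_ne_zero_of_im_pos hm l⟩
    filter_upwards [(isOpen_lt continuous_const continuous_im).mem_nhds h] with x hx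
    exact whittakerW_neg_of_im_pos hm l hx

theorem whittaker_pair (hm : m.im ≠ 0) (l : ℂ) (hz : z.im ≠ 0) :
    WhittakerEqAt l m (whittakerW l m) z ∧
      WhittakerEqAt l m (fun z => whittakerW (-l) m (-z)) z ∧
      wronsk (whittakerW l m) (fun z => whittakerW (-l) m (-z)) z ≠ 0 := by
  obtain ⟨d₁, d₂, hd, hne⟩ := exists_whittakerW_neg hm l hz
  have hu : whittakerW l m =ᶠ[𝓝 z] whitComb l m (whitW₁ l m) (whitW₂ l m) := .rfl
  refine ⟨whittakerEqAt_of_eventuallyEq hm hz hu, whittakerEqAt_of_eventuallyEq hm hz hd, ?_⟩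
  rw [wronsk_of_eventuallyEq hm hz hu hd]
  have hm0 : m ≠ 0 := fun h => hm (by simp [h])
  exact mul_ne_zero hne (by simp [hm0])

theorem whittaker_combination (hm : m.im ≠ 0) (l A B : ℂ) (hz : z.im ≠ 0) :
    WhittakerEqAt l m (fun z => A * whittakerW l m z + B * whittakerW (-l) m (-z)) z := by
  obtain ⟨d₁, d₂, hd, -⟩ := exists_whittakerW_neg hm l hz
  refine whittakerEqAt_of_eventuallyEq (c₁ := A * whitW₁ l m + B * d₁)
    (c₂ := A * whitW₂ l m + B * d₂) hm hz ?_
  filter_upwards [hd] with x hx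
  rw [hx, whittakerW_eq, whitComb, whitComb, whitComb]
  ring

theorem differentiableAt_whittakerW (l m : ℂ) (hz : z.im ≠ 0) :
    DifferentiableAt ℂ (whittakerW l m) z :=
  (hasDerivAt_whitComb hz l m _ _).differentiableAt

theorem differentiableAt_whittakerW_neg (l m : ℂ) (hz : z.im ≠ 0) :
    DifferentiableAt ℂ (fun z => whittakerW l m (-z)) z :=
  (differentiableAt_whittakerW l m (z := -z) (by simpa using hz)).comp z differentiableAt_id.neg

end Whittaker

end VectorNewton

/-! ### Affine substitutions and the case h = 2k/(1 + 2ωt). -/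

namespace VectorNewton

open Set Filter Topology Complex

section Substitution

variable {J : Set ℝ} {U : Set ℂ} {y : ℂ → ℂ} {z : ℝ → ℂ} {ζ : ℂ}

theorem hasDerivAt_comp_affine (hz : ∀ t, HasDerivAt z ζ t) (hU : IsOpen U)
    (hy : DifferentiableOn ℂ y U) {t : ℝ} (ht : z t ∈ U) :
    HasDerivAt (fun t => y (z t)) (ζ * deriv y (z t)) t :=
  ((hy.differentiableAt (hU.mem_nhds ht)).hasDerivAt.scomp t (hz t)).congr_deriv (by simp)

theorem hasDerivAt_deriv_comp_affine (hz : ∀ t, HasDerivAt z ζ t) (hU : IsOpen U)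
    (hy : DifferentiableOn ℂ y U) {t : ℝ} (ht : z t ∈ U) :
    HasDerivAt (deriv fun t => y (z t)) (ζ ^ 2 * deriv (deriv y) (z t)) t := by
  have h1 := (hasDerivAt_comp_affine hz hU (hy.deriv hU) ht).const_mul ζ
  refine (h1.congr_deriv (by ring)).congr_of_eventuallyEq ?_
  filter_upwards [(hz t).continuousAt.preimage_mem_nhds (hU.mem_nhds ht)] with s hs
  exact (hasDerivAt_comp_affine hz hU hy hs).deriv

end Substitution

section WhittakerCase

variable {J : Set ℝ} {r₀ v₀ : E3} {k ω : ℝ} {h : ℝ → ℝ} {μ : ℂ}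

theorem hasDerivAt_whitZ (k ω : ℝ) (v₀ : E3) (t : ℝ) :
    HasDerivAt (whitZ k ω v₀) (2 * speed v₀ * k * ω / (2 * I * (ω : ℂ) ^ 2)) t := by
  have h1 := ((hasDerivAt_id t).ofReal_comp.const_mul
    (2 * speed v₀ * k * ω : ℂ)).add_const (speed v₀ * k : ℂ)
  exact (h1.div_const (2 * I * (ω : ℂ) ^ 2)).congr_deriv (by simp)

/-- The points z(t) are purely imaginary multiples of 1 + 2ωt, so they avoid 0 and stay off the cuts
of both principal branches. -/
theorem whitZ_im_ne_zero (hw : wedge r₀ v₀ ≠ 0) (hk : k ≠ 0) (hω : ω ≠ 0) {t : ℝ}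
    (ht : 1 + 2 * ω * t ≠ 0) : (whitZ k ω v₀ t).im ≠ 0 := by
  have h1 : whitZ k ω v₀ t = ((-(speed v₀ * k * (1 + 2 * ω * t) / (2 * ω ^ 2)) : ℝ) : ℂ) * I := by
    have : (ω : ℂ) ≠ 0 := ofReal_ne_zero.2 hω
    rw [whitZ]
    push_cast
    field_simp
    ring_nf
    simp only [I_sq]
    ring
  have hb := (speed_pos hw).ne'
  rw [h1, im_ofReal_mul, I_im, mul_one]
  exact neg_ne_zero.2 (div_ne_zero (mul_ne_zero (mul_ne_zero hb hk) ht) (by simp [hω]))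

/-- Up to a positive factor, μ² is -[(b - 2ωa)² + 4ω²c²]. Hence μ is not real, as the Whittaker pair
requires. -/
theorem whitMuSq_neg (hw : wedge r₀ v₀ ≠ 0) (hk : k ≠ 0) (hω : ω ≠ 0) :
    whitMuSq k ω r₀ v₀ < 0 := by
  have hc := parC_pos hw
  have h1 : 4 * beta r₀ v₀ * ω - speed v₀ ^ 2 - 4 * alpha r₀ * ω ^ 2 =
      -((speed v₀ - 2 * ω * parA r₀ v₀) ^ 2 + 4 * ω ^ 2 * parC r₀ v₀ ^ 2) := by
    rw [← speed_mul_parA hw, ← parC_sq_add_parA_sq hw]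
    ring
  rw [whitMuSq, h1]
  refine div_neg_of_neg_of_pos (mul_neg_of_pos_of_neg (by positivity) ?_) (by positivity)
  exact neg_neg_of_pos (by positivity)

theorem im_ne_zero_of_sq_neg {x : ℝ} (hx : x < 0) (hμ : μ ^ 2 = x) : μ.im ≠ 0 := by
  intro h
  have h1 := congrArg re hμ
  rw [sq, mul_re, h, ofReal_re] at h1
  nlinarith [sq_nonneg μ.re]

theorem hasDerivAt_two_mul_div (hh : ∀ t, h t = 2 * k / (1 + 2 * ω * t)) {t : ℝ}
    (ht : 1 + 2 * ω * t ≠ 0) : HasDerivAt h (-(4 * k * ω) / (1 + 2 * ω * t) ^ 2) t := by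
  have h1 : HasDerivAt (fun t : ℝ => 1 + 2 * ω * t) (2 * ω) t := by
    simpa using ((hasDerivAt_id t).const_mul (2 * ω)).const_add 1
  have h2 := (hasDerivAt_const t (2 * k)).div h1 ht
  rw [show h = fun t => 2 * k / (1 + 2 * ω * t) from funext hh]
  exact h2.congr_deriv (by ring)

theorem hasDerivAt_deriv_two_mul_div (hh : ∀ t, h t = 2 * k / (1 + 2 * ω * t)) {t : ℝ}
    (ht : 1 + 2 * ω * t ≠ 0) :
    HasDerivAt (deriv h) (16 * k * ω ^ 2 / (1 + 2 * ω * t) ^ 3) t := by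
  have h1 : ∀ t : ℝ, HasDerivAt (fun t : ℝ => 1 + 2 * ω * t) (2 * ω) t := fun t => by
    simpa using ((hasDerivAt_id t).const_mul (2 * ω)).const_add 1
  have h2 := (hasDerivAt_const t (-(4 * k * ω))).div ((h1 t).pow 2) (pow_ne_zero 2 ht)
  refine (h2.congr_deriv ?_).congr_of_eventuallyEq ?_
  · simp only [Pi.pow_apply]
    field_simp
    ring
  · filter_upwards [(h1 t).continuousAt.eventually_ne ht] with s hs
    exact (hasDerivAt_two_mul_div hh hs).deriv

theorem whittaker_potential (hw : wedge r₀ v₀ ≠ 0) (hk : k ≠ 0) (hω : ω ≠ 0)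
    (hh : ∀ t, h t = 2 * k / (1 + 2 * ω * t)) (hμ : μ ^ 2 = (whitMuSq k ω r₀ v₀ : ℂ)) {t : ℝ}
    (ht : 1 + 2 * ω * t ≠ 0) :
    I * speed v₀ * h t / 2 - (chi r₀ v₀ t : ℂ) * ((h t : ℂ) / 2) ^ 2
        + 3 / 4 * ((deriv h t / h t : ℝ) : ℂ) ^ 2
        - 1 / 2 * ((deriv (deriv h) t / h t : ℝ) : ℂ) =
      -(2 * speed v₀ * k * ω / (2 * I * (ω : ℂ) ^ 2)) ^ 2 *
        (1 / 4 * (1 / whitZ k ω v₀ t ^ 2 - 1) + whitL k ω r₀ v₀ / whitZ k ω v₀ t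
          - μ ^ 2 / whitZ k ω v₀ t ^ 2) := by
  have hb : (speed v₀ : ℂ) ≠ 0 := ofReal_ne_zero.2 (speed_pos hw).ne'
  have hk' : (k : ℂ) ≠ 0 := ofReal_ne_zero.2 hk
  have hω' : (ω : ℂ) ≠ 0 := ofReal_ne_zero.2 hω
  -- In the variable x = 1 + 2ωt, a multiple of z, both sides are combinations of 1, 1/x and 1/x².
  -- The derivatives of h contribute -ω²/x², the source of the term 1/(4z²).
  obtain ⟨x, hx⟩ : ∃ x, x = 1 + 2 * ω * t := ⟨_, rfl⟩
  have hx0 : (x : ℂ) ≠ 0 := ofReal_ne_zero.2 (hx ▸ ht)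
  have htx : t = (x - 1) / (2 * ω) := by rw [hx]; field_simp; ring
  have hz : whitZ k ω v₀ t = speed v₀ * k * x / (2 * I * (ω : ℂ) ^ 2) := by
    rw [whitZ, hx]; push_cast; ring
  rw [hμ, (hasDerivAt_two_mul_div hh ht).deriv, (hasDerivAt_deriv_two_mul_div hh ht).deriv, hh,
    hz, whitMuSq, whitL, chi, ← hx, htx]
  push_cast
  field_simp
  ring_nf
  simp only [I_sq, show I ^ 3 = -I by rw [pow_succ, I_sq]; ring]
  ring

theorem solvesSchroedinger_iff_whittaker (hw : wedge r₀ v₀ ≠ 0) (hk : k ≠ 0)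
    (hω : ω ≠ 0) (hJω : ∀ t ∈ J, 1 + 2 * ω * t ≠ 0)
    (hh : ∀ t, h t = 2 * k / (1 + 2 * ω * t)) (hμ : μ ^ 2 = (whitMuSq k ω r₀ v₀ : ℂ))
    {U : Set ℂ} {y : ℂ → ℂ} (hU : IsOpen U) (hy : DifferentiableOn ℂ y U)
    (hJU : ∀ t ∈ J, whitZ k ω v₀ t ∈ U) :
    SolvesSchroedinger h r₀ v₀ J (fun t => y (whitZ k ω v₀ t)) ↔
      ∀ t ∈ J, WhittakerEqAt (whitL k ω r₀ v₀) μ y (whitZ k ω v₀ t) := by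
  have hb : (speed v₀ : ℂ) ≠ 0 := ofReal_ne_zero.2 (speed_pos hw).ne'
  have hk' : (k : ℂ) ≠ 0 := ofReal_ne_zero.2 hk
  have hω' : (ω : ℂ) ≠ 0 := ofReal_ne_zero.2 hω
  have hζ : (2 * speed v₀ * k * ω / (2 * I * (ω : ℂ) ^ 2)) ^ 2 ≠ 0 := by simp [hb, hk', hω']
  refine forall₂_congr fun t ht => ?_
  have d1 := hasDerivAt_comp_affine (hasDerivAt_whitZ k ω v₀) hU hy (hJU t ht)
  have d2 := hasDerivAt_deriv_comp_affine (hasDerivAt_whitZ k ω v₀) hU hy (hJU t ht)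
  rw [whittaker_potential hw hk hω hh hμ (hJω t ht), WhittakerEqAt]
  refine ⟨fun H => mul_left_cancel₀ hζ ?_, fun H => ⟨d1.differentiableAt, d2.congr_deriv ?_⟩⟩
  · linear_combination d2.unique H.2
  · linear_combination (2 * speed v₀ * k * ω / (2 * I * (ω : ℂ) ^ 2)) ^ 2 * H

theorem isGenerating_whittaker (hJ : IsOpen J) (hJ0 : (0 : ℝ) ∈ J) (hw : wedge r₀ v₀ ≠ 0)
    (hk : k ≠ 0) (hω : ω ≠ 0) (hJω : ∀ t ∈ J, 1 + 2 * ω * t ≠ 0)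
    (hh : ∀ t, h t = 2 * k / (1 + 2 * ω * t)) (hμ : μ ^ 2 = (whitMuSq k ω r₀ v₀ : ℂ))
    {u w : ℂ → ℂ} {A B y : ℂ} (hu : u = whittakerW (whitL k ω r₀ v₀) μ)
    (hv : w = fun z => whittakerW (-whitL k ω r₀ v₀) μ (-z))
    (hy : y = phiDerivInit h r₀ v₀ * (Complex.I * ω / (speed v₀ * k)))
    (hA : A = coeffFst u w (whitZ k ω v₀ 0) (phiInit h) y)
    (hB : B = coeffSnd u w (whitZ k ω v₀ 0) (phiInit h) y) :
    IsGenerating h r₀ v₀ J (fun t => (h t : ℂ) ^ (1 / 2 : ℂ) *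
      (A * u (whitZ k ω v₀ t) + B * w (whitZ k ω v₀ t))) := by
  have hm := im_ne_zero_of_sq_neg (whitMuSq_neg hw hk hω) hμ
  have hzim : ∀ t ∈ J, (whitZ k ω v₀ t).im ≠ 0 := fun t ht =>
    whitZ_im_ne_zero hw hk hω (hJω t ht)
  have hU : IsOpen {z : ℂ | z.im ≠ 0} := isOpen_ne_fun continuous_im continuous_const
  have du : ∀ z : ℂ, z.im ≠ 0 → DifferentiableAt ℂ u z := fun z hz => by
    rw [hu]; exact differentiableAt_whittakerW _ _ hz
  have dw : ∀ z : ℂ, z.im ≠ 0 → DifferentiableAt ℂ w z := fun z hz => by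
    rw [hv]; exact differentiableAt_whittakerW_neg _ _ hz
  have hW : wronsk u w (whitZ k ω v₀ 0) ≠ 0 := by
    rw [hu, hv]; exact (whittaker_pair hm _ (hzim 0 hJ0)).2.2
  have hd : DifferentiableOn ℂ (fun z => A * u z + B * w z) {z : ℂ | z.im ≠ 0} := fun z hz =>
    (((du z hz).const_mul A).add ((dw z hz).const_mul B)).differentiableWithinAt
  have hh' : ∀ t ∈ J, DifferentiableAt ℝ h t ∧ DifferentiableAt ℝ (deriv h) t ∧ h t ≠ 0 :=
    fun t ht => ⟨(hasDerivAt_two_mul_div hh (hJω t ht)).differentiableAt,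
      (hasDerivAt_deriv_two_mul_div hh (hJω t ht)).differentiableAt, by
        rw [hh]; exact div_ne_zero (mul_ne_zero two_ne_zero hk) (hJω t ht)⟩
  refine (isGenerating_iff_solvesSchroedinger hJ hh' (fun t _ => rfl) hJ0).2 ⟨?_, ?_, ?_⟩
  · refine (solvesSchroedinger_iff_whittaker hw hk hω hJω hh hμ hU hd hzim).2 fun t ht => ?_
    rw [hu, hv]
    exact whittaker_combination hm _ A B (hzim t ht)
  · rw [hA, hB]; exact coeff_value hW _ _
  -- Since dz/dt = bk/(iω), the factor iω/(bk) in y converts φ̇(0) to the derivative in z.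
  · rw [(hasDerivAt_comp_affine (hasDerivAt_whitZ k ω v₀) hU hd (hzim 0 hJ0)).deriv,
      deriv_fun_add ((du _ (hzim 0 hJ0)).const_mul A) ((dw _ (hzim 0 hJ0)).const_mul B),
      deriv_const_mul _ (du _ (hzim 0 hJ0)), deriv_const_mul _ (dw _ (hzim 0 hJ0)), hA, hB,
      coeff_deriv hW, hy]
    have hb : (speed v₀ : ℂ) ≠ 0 := ofReal_ne_zero.2 (speed_pos hw).ne'
    have hk' : (k : ℂ) ≠ 0 := ofReal_ne_zero.2 hk
    have hω' : (ω : ℂ) ≠ 0 := ofReal_ne_zero.2 hω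
    field_simp

end WhittakerCase

end VectorNewton

/-! ### Euler's integral on the cut plane. -/

namespace VectorNewton

open Set Filter Topology Complex Metric MeasureTheory
open scoped Nat Interval

section EulerIntegral

variable {u v s z : ℂ}

/-- The complement of the cut `[1, ∞)`. -/
def cutPlane : Set ℂ := {z | 1 - z ∈ slitPlane}

theorem isOpen_cutPlane : IsOpen cutPlane :=
  isOpen_slitPlane.preimage (continuous_const.sub continuous_id)

theorem zero_mem_cutPlane : (0 : ℂ) ∈ cutPlane := by simp [cutPlane]

theorem one_sub_mul_mem_slitPlane (hz : z ∈ cutPlane) {x : ℝ} (hx : x ∈ Icc (0 : ℝ) 1) :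
    1 - z * x ∈ slitPlane := by
  have h := StarConvex.add_smul_mem starConvex_one_slitPlane (y := -z)
    (by rw [← sub_eq_add_neg]; exact hz) hx.1 hx.2
  rwa [real_smul, show (1 : ℂ) + x * -z = 1 - z * x by ring] at h

theorem isPreconnected_cutPlane : IsPreconnected cutPlane := by
  have h : StarConvex ℝ (0 : ℂ) cutPlane := fun z hz a b ha hb hab => by
    have := one_sub_mul_mem_slitPlane hz (x := b) ⟨hb, by linarith⟩
    simpa [cutPlane, mul_comm] using this
  exact (h.isPathConnected zero_mem_cutPlane).isConnected.isPreconnected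

theorem ball_subset_cutPlane : ball (0 : ℂ) 1 ⊆ cutPlane := fun z hz => by
  have h1 : ‖-z‖ < 1 := by simpa using hz
  simpa [cutPlane, sub_eq_add_neg] using mem_slitPlane_of_norm_lt_one h1

/-- Euler's integral `∫₀¹ x^(u-1) (1-x)^(v-1) (1-zx)^(-s) dx`. -/
noncomputable def eulerIntegral (u v s z : ℂ) : ℂ :=
  ∫ x : ℝ in 0..1, (x : ℂ) ^ (u - 1) * (1 - (x : ℂ)) ^ (v - 1) * (1 - z * x) ^ (-s)

theorem continuousOn_one_sub_mul_cpow (hz : z ∈ cutPlane) (s : ℂ) :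
    ContinuousOn (fun x : ℝ => (1 - z * (x : ℂ)) ^ s) (Icc 0 1) := by
  refine ContinuousOn.cpow_const ?_ fun x hx => one_sub_mul_mem_slitPlane hz hx
  exact (continuous_const.sub (continuous_const.mul continuous_ofReal)).continuousOn

theorem hasDerivAt_one_sub_mul_cpow (hz : z ∈ cutPlane) (s : ℂ) {x : ℝ}
    (hx : x ∈ Icc (0 : ℝ) 1) : HasDerivAt (fun z : ℂ => (1 - z * (x : ℂ)) ^ (-s))
      (s * x * (1 - z * (x : ℂ)) ^ (-(s + 1))) z := by
  have h1 : HasDerivAt (fun z : ℂ => 1 - z * (x : ℂ)) (-x) z := by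
    simpa using ((hasDerivAt_id z).mul_const (x : ℂ)).const_sub 1
  refine (h1.cpow_const (one_sub_mul_mem_slitPlane hz hx)).congr_deriv ?_
  rw [show -s - 1 = -(s + 1) by ring]
  ring

/-- Differentiation under the integral: the extra factor sx raises u and s by one. On a closed ball
in the cut plane the remaining kernel is bounded by compactness, so a multiple of the beta integrand
dominates. -/
theorem hasDerivAt_eulerIntegral (hu : 0 < u.re) (hv : 0 < v.re) (s : ℂ) (hz : z ∈ cutPlane) :
    HasDerivAt (eulerIntegral u v s) (s * eulerIntegral (u + 1) v (s + 1) z) z := by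
  obtain ⟨ε, hε, hball⟩ := Metric.nhds_basis_closedBall.mem_iff.1 (isOpen_cutPlane.mem_nhds hz)
  have hw := betaIntegral_convergent hu hv
  have hIcc : uIcc (0 : ℝ) 1 = Icc 0 1 := uIcc_of_le zero_le_one
  have hsub : Ι (0 : ℝ) 1 ⊆ Icc 0 1 := by
    rw [uIoc_of_le zero_le_one]; exact Ioc_subset_Icc_self
  have hcont : ContinuousOn (fun p : ℂ × ℝ => s * p.2 * (1 - p.1 * (p.2 : ℂ)) ^ (-(s + 1)))
      (closedBall z ε ×ˢ Icc 0 1) := by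
    refine ContinuousOn.mul (by fun_prop) (ContinuousOn.cpow_const (by fun_prop) ?_)
    exact fun p hp => one_sub_mul_mem_slitPlane (hball hp.1) hp.2
  obtain ⟨M, hM⟩ := ((isCompact_closedBall z ε).prod isCompact_Icc).exists_bound_of_continuousOn
    hcont
  have hF_int : ∀ y ∈ cutPlane, IntervalIntegrable (fun x : ℝ => (x : ℂ) ^ (u - 1) *
      (1 - (x : ℂ)) ^ (v - 1) * (1 - y * x) ^ (-s)) volume 0 1 := fun y hy =>
    hw.mul_continuousOn (by rw [hIcc]; exact continuousOn_one_sub_mul_cpow hy _)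
  have hF_int' : IntervalIntegrable (fun x : ℝ => (x : ℂ) ^ (u - 1) *
      (1 - (x : ℂ)) ^ (v - 1) * (s * x * (1 - z * x) ^ (-(s + 1)))) volume 0 1 := by
    refine hw.mul_continuousOn ?_
    rw [hIcc]
    exact (by fun_prop : ContinuousOn (fun x : ℝ => s * (x : ℂ)) (Icc 0 1)).mul
      (continuousOn_one_sub_mul_cpow hz _)
  have key := intervalIntegral.hasDerivAt_integral_of_dominated_loc_of_deriv_le
    (μ := volume) (a := 0) (b := 1) (x₀ := z) (s := closedBall z ε)
    (F := fun y (x : ℝ) => (x : ℂ) ^ (u - 1) * (1 - (x : ℂ)) ^ (v - 1) * (1 - y * x) ^ (-s))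
    (F' := fun y (x : ℝ) => (x : ℂ) ^ (u - 1) * (1 - (x : ℂ)) ^ (v - 1) *
      (s * x * (1 - y * x) ^ (-(s + 1))))
    (bound := fun x : ℝ => ‖(x : ℂ) ^ (u - 1) * (1 - (x : ℂ)) ^ (v - 1)‖ * M)
    (closedBall_mem_nhds z hε)
    (by
      filter_upwards [isOpen_cutPlane.mem_nhds hz] with y hy
      exact (hF_int y hy).def'.aestronglyMeasurable)
    (hF_int z hz) hF_int'.def'.aestronglyMeasurable
    (ae_of_all _ fun x hx y hy => by
      rw [norm_mul]
      exact mul_le_mul_of_nonneg_left (hM (y, x) ⟨hy, hsub hx⟩) (norm_nonneg _))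
    (hw.norm.mul_const M)
    (ae_of_all _ fun x hx y hy =>
      (hasDerivAt_one_sub_mul_cpow (hball hy) s (hsub hx)).const_mul _)
  refine key.2.congr_deriv ?_
  rw [eulerIntegral, ← intervalIntegral.integral_const_mul]
  refine intervalIntegral.integral_congr fun x _ => ?_
  have hu0 : u ≠ 0 := fun h => hu.ne' (by simp [h])
  have hx : (x : ℂ) ^ (u + 1 - 1) = (x : ℂ) ^ (u - 1) * x := by
    rcases eq_or_ne (x : ℂ) 0 with h | h
    · simp [h, hu0]
    · rw [add_sub_cancel_right, cpow_sub _ _ h, cpow_one, div_mul_cancel₀ _ h]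
  simp only [hx]
  ring

theorem differentiableOn_eulerIntegral (hu : 0 < u.re) (hv : 0 < v.re) (s : ℂ) :
    DifferentiableOn ℂ (eulerIntegral u v s) cutPlane := fun _ hz =>
  (hasDerivAt_eulerIntegral hu hv s hz).differentiableAt.differentiableWithinAt

theorem eulerIntegral_zero (u v s : ℂ) : eulerIntegral u v s 0 = betaIntegral u v := by
  simp [eulerIntegral, betaIntegral]

theorem betaIntegral_ne_zero (hu : 0 < u.re) (hv : 0 < v.re) : betaIntegral u v ≠ 0 := fun h => by
  have h1 := Gamma_mul_Gamma_eq_betaIntegral hu hv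
  rw [h, mul_zero] at h1
  exact mul_ne_zero (Gamma_ne_zero_of_re_pos hu) (Gamma_ne_zero_of_re_pos hv) h1

theorem betaIntegral_add_one (hu : 0 < u.re) (hv : 0 < v.re) :
    (u + v) * betaIntegral (u + 1) v = u * betaIntegral u v := by
  have hu0 : u ≠ 0 := fun h => hu.ne' (by simp [h])
  have huv : 0 < (u + v).re := by rw [add_re]; exact add_pos hu hv
  have huv0 : u + v ≠ 0 := fun h => huv.ne' (by simp [h])
  have h1 := Gamma_mul_Gamma_eq_betaIntegral hu hv
  have h2 := Gamma_mul_Gamma_eq_betaIntegral (s := u + 1) (t := v)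
    (by simp only [add_re, one_re]; linarith) hv
  rw [show u + 1 + v = u + v + 1 by ring, Gamma_add_one _ hu0, Gamma_add_one _ huv0] at h2
  refine mul_left_cancel₀ (Gamma_ne_zero_of_re_pos huv) ?_
  linear_combination u * h1 - h2

theorem taylorCoeff_const_mul (s : ℂ) (f : ℂ → ℂ) (n : ℕ) :
    taylorCoeff (fun z => s * f z) n = s * taylorCoeff f n := by
  rw [taylorCoeff, taylorCoeff, iteratedDeriv_const_mul_field, mul_div_assoc]

theorem taylorCoeff_eulerIntegral_succ (hu : 0 < u.re) (hv : 0 < v.re) (s : ℂ) (n : ℕ) :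
    (n + 1) * taylorCoeff (eulerIntegral u v s) (n + 1) =
      s * taylorCoeff (eulerIntegral (u + 1) v (s + 1)) n := by
  rw [← taylorCoeff_deriv, ← taylorCoeff_const_mul]
  refine taylorCoeff_congr ?_ n
  filter_upwards [isOpen_cutPlane.mem_nhds zero_mem_cutPlane] with z hz
  exact (hasDerivAt_eulerIntegral hu hv s hz).deriv

/-- The hypergeometric recursion without expanding the integrand. The derivative is s times the
integral at (u+1, s+1), so the relation passes from n there to n+1 here; the case n = 0 is the
recursion of the beta integral. -/
theorem taylorCoeff_eulerIntegral (hu : 0 < u.re) (hv : 0 < v.re) (s : ℂ) (n : ℕ) :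
    (n + 1) * (n + (u + v)) * taylorCoeff (eulerIntegral u v s) (n + 1) =
      (n + u) * (n + s) * taylorCoeff (eulerIntegral u v s) n := by
  induction n generalizing u s with
  | zero =>
    have h1 := taylorCoeff_eulerIntegral_succ hu hv s 0
    have h2 := betaIntegral_add_one hu hv
    rw [taylorCoeff_zero, eulerIntegral_zero] at *
    push_cast at *
    linear_combination (u + v) * h1 + s * h2
  | succ n ih =>
    have hu' : 0 < (u + 1).re := by simp only [add_re, one_re]; linarith
    have h1 := taylorCoeff_eulerIntegral_succ hu hv s n
    have h2 := taylorCoeff_eulerIntegral_succ hu hv s (n + 1)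
    have h3 := ih hu' (s + 1)
    refine mul_left_cancel₀ (Nat.cast_add_one_ne_zero n : (n : ℂ) + 1 ≠ 0) ?_
    push_cast at *
    linear_combination (n + 1) * (n + 1 + u + v) * h2 + s * h3 - (n + 1 + u) * (n + 1 + s) * h1

end EulerIntegral

/-! ### The Gauss function F(-p, 1+p; 1; z) for imaginary p and its continuation. -/

section Gauss

variable {p z : ℂ}

/-- For imaginary p ≠ 0 neither upper parameter is a non-positive integer, so the series does not
terminate. That the radius is exactly 1 is used later to exclude an entire continuation. -/
theorem radius_ordinaryHypergeometricSeries (hp : p.re = 0) (hp0 : p ≠ 0) :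
    (ordinaryHypergeometricSeries ℂ (-p) (1 + p) 1).radius = 1 := by
  refine ordinaryHypergeometricSeries_radius_eq_one ℂ _ _ _ fun n => ⟨?_, ?_, ?_⟩
  · intro h
    rw [neg_neg] at h
    have h1 := congrArg re h
    rw [hp, natCast_re] at h1
    exact hp0 (by rw [← h, show n = 0 by exact_mod_cast h1]; simp)
  · intro h
    have h1 := congrArg re h
    simp only [natCast_re, neg_re, add_re, one_re, hp] at h1
    linarith [n.cast_nonneg (α := ℝ)]
  · intro h
    have h1 := congrArg re h
    simp only [natCast_re, neg_re, one_re] at h1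
    linarith [n.cast_nonneg (α := ℝ)]

theorem hasFPowerSeriesOnBall_ordinaryHypergeometric (hp : p.re = 0) (hp0 : p ≠ 0) :
    HasFPowerSeriesOnBall (ordinaryHypergeometric (𝔸 := ℂ) (-p) (1 + p) 1)
      (ordinaryHypergeometricSeries ℂ (-p) (1 + p) 1) 0 1 := by
  have hr := radius_ordinaryHypergeometricSeries hp hp0
  have := (ordinaryHypergeometricSeries ℂ (-p) (1 + p) 1).hasFPowerSeriesOnBall
    (by rw [hr]; exact one_pos)
  rwa [hr] at this

theorem differentiableOn_ordinaryHypergeometric (hp : p.re = 0) (hp0 : p ≠ 0) :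
    DifferentiableOn ℂ (ordinaryHypergeometric (𝔸 := ℂ) (-p) (1 + p) 1) (ball 0 1) := by
  have := (hasFPowerSeriesOnBall_ordinaryHypergeometric hp hp0).differentiableOn
  rwa [← ENNReal.ofReal_one, eball_ofReal] at this

theorem taylorCoeff_ordinaryHypergeometric (hp : p.re = 0) (hp0 : p ≠ 0) (n : ℕ) :
    (n + 1) * (n + 1) * taylorCoeff (ordinaryHypergeometric (𝔸 := ℂ) (-p) (1 + p) 1) (n + 1) =
      (n + -p) * (n + (1 + p)) *
        taylorCoeff (ordinaryHypergeometric (𝔸 := ℂ) (-p) (1 + p) 1) n := by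
  have hs := (hasFPowerSeriesOnBall_ordinaryHypergeometric hp hp0).hasFPowerSeriesAt
  have hn : (n : ℂ) + 1 ≠ 0 := Nat.cast_add_one_ne_zero n
  have hf : (n ! : ℂ) ≠ 0 := Nat.cast_ne_zero.2 n.factorial_ne_zero
  rw [taylorCoeff_eq_coeff hs, taylorCoeff_eq_coeff hs, ordinaryHypergeometricSeries,
    FormalMultilinearSeries.coeff_ofScalars, FormalMultilinearSeries.coeff_ofScalars,
    ordinaryHypergeometricCoefficient, ordinaryHypergeometricCoefficient]
  simp only [ascPochhammer_succ_eval, ascPochhammer_eval_one, Nat.factorial_succ]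
  push_cast
  rw [add_comm (1 : ℂ) n]
  field_simp
  ring

theorem ordinaryHypergeometric_equation (hp : p.re = 0) (hp0 : p ≠ 0) (hz : z ∈ ball (0 : ℂ) 1) :
    z * (1 - z) * deriv (deriv (ordinaryHypergeometric (-p) (1 + p) 1)) z
      + (1 - 2 * z) * deriv (ordinaryHypergeometric (-p) (1 + p) 1) z
      = -p * (1 + p) * ordinaryHypergeometric (-p) (1 + p) 1 z := by
  have h1 := hasSum_gauss_operator (differentiableOn_ordinaryHypergeometric hp hp0) hz (-p)
    (1 + p) 1
  simp only [taylorCoeff_ordinaryHypergeometric hp hp0, sub_self, zero_mul] at h1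
  linear_combination h1.unique hasSum_zero

theorem eqOn_cutPlane_of_eqOn_ball {f g : ℂ → ℂ} (hf : DifferentiableOn ℂ f cutPlane)
    (hg : DifferentiableOn ℂ g cutPlane) (h : EqOn f g (ball 0 1)) : EqOn f g cutPlane :=
  (hf.analyticOnNhd isOpen_cutPlane).eqOn_of_preconnected_of_eventuallyEq
    (hg.analyticOnNhd isOpen_cutPlane) isPreconnected_cutPlane zero_mem_cutPlane
    (h.eventuallyEq_of_mem (ball_mem_nhds 0 one_pos))

/-- Analytic continuation of `F(-p, 1+p; 1; ·)` to the cut plane, with its differential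
equation. -/
theorem exists_isGaussHypergeometric (hp : p.re = 0) (hp0 : p ≠ 0) :
    ∃ F : ℂ → ℂ, IsGaussHypergeometric (-p) (1 + p) 1 F ∧ ∀ z ∈ cutPlane,
      z * (1 - z) * deriv (deriv F) z + (1 - 2 * z) * deriv F z = -p * (1 + p) * F z := by
  set S : ℂ → ℂ := ordinaryHypergeometric (-p) (1 + p) 1 with hS
  have hu : 0 < (1 - p).re := by simp [hp]
  have hv : 0 < (1 + p).re := by simp [hp]
  have hB := betaIntegral_ne_zero hu hv
  have hp1 : 1 + p ≠ 0 := fun h => hv.ne' (by simp [h])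
  have hq : -p * (1 + p) ≠ 0 := mul_ne_zero (neg_ne_zero.2 hp0) hp1
  -- Euler's integral does not converge for F itself, where an exponent has real part -1. It does
  -- for F' = -p(1+p) F(1-p, 2+p; 2; z), with u = 1-p, v = 1+p, s = 2+p.
  set G : ℂ → ℂ := fun z => -p * (1 + p) / betaIntegral (1 - p) (1 + p) *
    eulerIntegral (1 - p) (1 + p) (2 + p) z with hG
  have hGd : DifferentiableOn ℂ G cutPlane :=
    (differentiableOn_eulerIntegral hu hv _).const_mul _
  have hSd : DifferentiableOn ℂ S (ball 0 1) := differentiableOn_ordinaryHypergeometric hp hp0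
  have hGS : EqOn G (deriv S) (ball 0 1) := by
    refine eqOn_ball_of_taylorCoeff_eq (hGd.mono ball_subset_cutPlane) (hSd.deriv isOpen_ball)
      fun n => ?_
    induction n with
    | zero =>
      have h1 := taylorCoeff_ordinaryHypergeometric hp hp0 0
      rw [taylorCoeff_zero (ordinaryHypergeometric _ _ _), ordinaryHypergeometric_zero] at h1
      rw [taylorCoeff_deriv, taylorCoeff_zero, hG]
      simp only [eulerIntegral_zero]
      rw [div_mul_cancel₀ _ hB]
      push_cast at *
      linear_combination -h1
    | succ n ih =>
      have h1 := taylorCoeff_eulerIntegral hu hv (2 + p) n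
      have h2 := taylorCoeff_ordinaryHypergeometric hp hp0 (n + 1)
      rw [taylorCoeff_deriv, hG, taylorCoeff_const_mul] at ih ⊢
      have hn : (n : ℂ) + 1 ≠ 0 := Nat.cast_add_one_ne_zero n
      have hn' : (n : ℂ) + 2 ≠ 0 := by exact_mod_cast (n + 1).succ_ne_zero
      refine mul_left_cancel₀ (mul_ne_zero hn hn') ?_
      push_cast at *
      linear_combination (-p * (1 + p) / betaIntegral (1 - p) (1 + p)) * h1
        + (n + (1 - p)) * (n + (2 + p)) * ih - (n + 1) * h2
  -- The continuation of F is recovered from G = F' by solving the differential equation for F, not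
  -- by integration. It remains to see that F' = G on the cut plane, by the identity theorem.
  set F : ℂ → ℂ := fun z => (z * (1 - z) * deriv G z + (1 - 2 * z) * G z) / (-p * (1 + p)) with hF
  have hFd : DifferentiableOn ℂ F cutPlane := by
    have := hGd.deriv isOpen_cutPlane
    have h1 : DifferentiableOn ℂ (fun z : ℂ => z * (1 - z)) cutPlane := by fun_prop
    have h2 : DifferentiableOn ℂ (fun z : ℂ => 1 - 2 * z) cutPlane := by fun_prop
    exact ((h1.mul this).add (h2.mul hGd)).div_const _
  have hFS : EqOn F S (ball 0 1) := fun z hz => by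
    have h1 : deriv G z = deriv (deriv S) z :=
      (hGS.eventuallyEq_of_mem (isOpen_ball.mem_nhds hz)).deriv_eq
    simp only [hF]
    rw [h1, hGS hz, ordinaryHypergeometric_equation hp hp0 hz, mul_div_cancel_left₀ _ hq]
  have hFG : EqOn (deriv F) G cutPlane :=
    eqOn_cutPlane_of_eqOn_ball (hFd.deriv isOpen_cutPlane) hGd fun z hz => by
      rw [hGS hz]
      exact (hFS.eventuallyEq_of_mem (isOpen_ball.mem_nhds hz)).deriv_eq
  refine ⟨F, ⟨hFd, fun z hz => hFS (by simpa using hz)⟩, fun z hz => ?_⟩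
  have h1 : deriv (deriv F) z = deriv G z :=
    (hFG.eventuallyEq_of_mem (isOpen_cutPlane.mem_nhds hz)).deriv_eq
  rw [h1, hFG hz, hF]
  field_simp

end Gauss

end VectorNewton

/-! ### The pair F(z), F(1-z) and its Wronskian. -/

namespace VectorNewton

open Set Filter Topology Complex Metric

section GaussPair

variable {p z : ℂ} {F : ℂ → ℂ}

/-- The complement of the two cuts `(-∞, 0]` and `[1, ∞)`. -/
def doubleCutPlane : Set ℂ := slitPlane ∩ cutPlane

theorem isOpen_doubleCutPlane : IsOpen doubleCutPlane := isOpen_slitPlane.inter isOpen_cutPlane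

theorem one_sub_mem_cutPlane (hz : z ∈ slitPlane) : 1 - z ∈ cutPlane := by
  simpa [cutPlane] using hz

theorem one_sub_mem_doubleCutPlane (hz : z ∈ doubleCutPlane) : 1 - z ∈ doubleCutPlane :=
  ⟨hz.2, one_sub_mem_cutPlane hz.1⟩

theorem isPreconnected_doubleCutPlane : IsPreconnected doubleCutPlane := by
  have h1 : StarConvex ℝ ((1 / 2 : ℝ) : ℂ) slitPlane := starConvex_ofReal_slitPlane (by norm_num)
  have h2 : StarConvex ℝ ((1 / 2 : ℝ) : ℂ) cutPlane := fun z hz a b ha hb hab => by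
    have := h1 hz ha hb hab
    rw [cutPlane, mem_ofPred_eq]
    convert this using 1
    have hab' : (a : ℂ) + b = 1 := by exact_mod_cast hab
    simp only [real_smul]
    push_cast
    linear_combination -hab'
  have h3 : ((1 / 2 : ℝ) : ℂ) ∈ doubleCutPlane :=
    ⟨Or.inl (by norm_num), Or.inl (by simp; norm_num)⟩
  exact ((h1.inter h2).isPathConnected h3).isConnected.isPreconnected

theorem deriv_one_sub (F : ℂ → ℂ) : deriv (fun z => F (1 - z)) = fun z => -deriv F (1 - z) :=
  funext fun z => deriv_comp_const_sub F 1 z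

theorem deriv_deriv_one_sub (F : ℂ → ℂ) :
    deriv (deriv fun z => F (1 - z)) = fun z => deriv (deriv F) (1 - z) := by
  rw [deriv_one_sub]
  funext z
  rw [deriv.fun_neg, deriv_comp_const_sub, neg_neg]

theorem hasDerivAt_one_sub (hF : DifferentiableOn ℂ F cutPlane) (hz : z ∈ slitPlane) :
    HasDerivAt (fun z => F (1 - z)) (-deriv F (1 - z)) z := by
  have h1 := (hF.differentiableAt (isOpen_cutPlane.mem_nhds
    (one_sub_mem_cutPlane hz))).hasDerivAt.comp z ((hasDerivAt_id z).const_sub 1)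
  exact h1.congr_deriv (by simp)

/-- Abel's identity for the pair `F(z)`, `F(1 - z)`. -/
theorem mul_wronsk_eq (hF : DifferentiableOn ℂ F cutPlane)
    (hE : ∀ z ∈ cutPlane, z * (1 - z) * deriv (deriv F) z + (1 - 2 * z) * deriv F z =
      -p * (1 + p) * F z) {x y : ℂ} (hx : x ∈ doubleCutPlane) (hy : y ∈ doubleCutPlane) :
    x * (1 - x) * wronsk F (fun z => F (1 - z)) x =
      y * (1 - y) * wronsk F (fun z => F (1 - z)) y := by
  have hd : ∀ z ∈ doubleCutPlane,
      HasDerivAt (fun z => z * (1 - z) * wronsk F (fun z => F (1 - z)) z) 0 z := fun z hz => by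
    have hF' := hF.deriv isOpen_cutPlane
    have f0 := (hF.differentiableAt (isOpen_cutPlane.mem_nhds hz.2)).hasDerivAt
    have f1 := (hF'.differentiableAt (isOpen_cutPlane.mem_nhds hz.2)).hasDerivAt
    have g0 := hasDerivAt_one_sub hF hz.1
    have g1 := (hasDerivAt_one_sub hF' hz.1).neg
    have hq := (hasDerivAt_id z).mul ((hasDerivAt_id z).const_sub 1)
    have hW : (fun z => z * (1 - z) * wronsk F (fun z => F (1 - z)) z) =
        fun z => z * (1 - z) * (F z * -deriv F (1 - z) - F (1 - z) * deriv F z) := by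
      funext z
      rw [wronsk, deriv_one_sub]
    rw [hW]
    refine (hq.mul ((f0.mul g1).sub (g0.mul f1))).congr_deriv ?_
    have e1 := hE z hz.2
    have e2 := hE (1 - z) (one_sub_mem_doubleCutPlane hz).2
    simp only [id, Pi.mul_apply, Pi.sub_apply, Pi.neg_apply]
    linear_combination F z * e2 - F (1 - z) * e1
  exact isOpen_doubleCutPlane.is_const_of_deriv_eq_zero isPreconnected_doubleCutPlane
    (fun z hz => (hd z hz).differentiableAt.differentiableWithinAt) (fun z hz => (hd z hz).deriv)
    hx hy

/-- No continuation of `F(-p, 1+p; 1; ·)` is entire. -/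
theorem not_differentiable_of_eqOn_ball (hp : p.re = 0) (hp0 : p ≠ 0) {H : ℂ → ℂ}
    (hH : ∀ z : ℂ, ‖z‖ < 1 → H z = ordinaryHypergeometric (-p) (1 + p) 1 z) :
    ¬ Differentiable ℂ H := fun hd => by
  -- The value R = 1 only selects the circle for Cauchy's coefficients; the expansion of an entire
  -- function converges everywhere, against the radius 1.
  have h1 := hd.hasFPowerSeriesOnBall 0 (R := 1) one_pos
  have h2 := (hasFPowerSeriesOnBall_ordinaryHypergeometric hp hp0).hasFPowerSeriesAt
  have h3 : H =ᶠ[𝓝 0] ordinaryHypergeometric (-p) (1 + p) 1 := by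
    filter_upwards [ball_mem_nhds (0 : ℂ) one_pos] with z hz
    exact hH z (by simpa using hz)
  have h4 := h1.hasFPowerSeriesAt.eq_formalMultilinearSeries (h2.congr h3.symm)
  have h5 := h1.r_le
  rw [h4, radius_ordinaryHypergeometricSeries hp hp0] at h5
  simp at h5

/-- If the Wronskian vanishes at one point, it vanishes everywhere by Abel's identity. As F(0) = 1,
the quotient F(1-z)/F(z) is then constant on a small ball near 0, so F(1-z) = cF(z) on the doubly
cut plane. Hence F(z) = cF(1-z), which continues F across the cut [1, ∞) to an entire function. -/
theorem wronsk_gauss_ne_zero (hp : p.re = 0) (hp0 : p ≠ 0)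
    (hF : IsGaussHypergeometric (-p) (1 + p) 1 F)
    (hE : ∀ z ∈ cutPlane, z * (1 - z) * deriv (deriv F) z + (1 - 2 * z) * deriv F z =
      -p * (1 + p) * F z) (hz : z ∈ doubleCutPlane) :
    wronsk F (fun z => F (1 - z)) z ≠ 0 := fun h0 => by
  have hFd : DifferentiableOn ℂ F cutPlane := hF.1
  have hne : ∀ x ∈ doubleCutPlane, x * (1 - x) ≠ 0 := fun x hx =>
    mul_ne_zero (slitPlane_ne_zero hx.1) (slitPlane_ne_zero hx.2)
  have hW : ∀ x ∈ doubleCutPlane, wronsk F (fun z => F (1 - z)) x = 0 := fun x hx => by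
    have := mul_wronsk_eq hFd hE hx hz
    rw [h0, mul_zero] at this
    exact (mul_eq_zero.1 this).resolve_left (hne x hx)
  have hF0 : F 0 ≠ 0 := by rw [hF.2 0 (by simp), ordinaryHypergeometric_zero]; exact one_ne_zero
  have hcont : ContinuousAt F 0 :=
    (hFd.differentiableAt (isOpen_cutPlane.mem_nhds zero_mem_cutPlane)).continuousAt
  obtain ⟨ε, hε, hball⟩ := Metric.mem_nhds_iff.1
    (inter_mem (hcont.eventually_ne hF0) (isOpen_cutPlane.mem_nhds zero_mem_cutPlane))
  obtain ⟨x, hxε, hxD⟩ : ∃ x ∈ ball (0 : ℂ) ε, x ∈ doubleCutPlane := by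
    refine ⟨((ε / 2 : ℝ) : ℂ), ?_, ?_, ?_⟩
    · rw [mem_ball_zero_iff, norm_real, Real.norm_of_nonneg (by positivity)]
      linarith
    · exact Or.inl (by simpa using hε)
    · refine (hball ?_).2
      rw [mem_ball_zero_iff, norm_real, Real.norm_of_nonneg (by positivity)]
      linarith
  obtain ⟨δ, hδ, hδball⟩ := Metric.mem_nhds_iff.1
    (inter_mem (isOpen_ball.mem_nhds hxε) (isOpen_doubleCutPlane.mem_nhds hxD))
  have hq : ∀ y ∈ ball x δ, HasDerivAt (fun z => F (1 - z) / F z) 0 y := fun y hy => by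
    obtain ⟨hy1, hy2⟩ := hδball hy
    have hFy : F y ≠ 0 := (hball hy1).1
    have d1 := (hFd.differentiableAt (isOpen_cutPlane.mem_nhds hy2.2)).hasDerivAt
    refine ((hasDerivAt_one_sub hFd hy2.1).div d1 hFy).congr_deriv ?_
    have := hW y hy2
    rw [wronsk, deriv_one_sub] at this
    rw [div_eq_zero_iff]
    left
    linear_combination this
  obtain ⟨c, hc⟩ := isOpen_ball.exists_is_const_of_deriv_eq_zero
    (convex_ball x δ).isPreconnected
    (fun y hy => (hq y hy).differentiableAt.differentiableWithinAt) (fun y hy => (hq y hy).deriv)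
  have hDd : DifferentiableOn ℂ (fun z => F (1 - z)) doubleCutPlane := fun y hy =>
    (hasDerivAt_one_sub hFd hy.1).differentiableAt.differentiableWithinAt
  have hrel : EqOn (fun z => F (1 - z)) (fun z => c * F z) doubleCutPlane := by
    refine (hDd.analyticOnNhd isOpen_doubleCutPlane).eqOn_of_preconnected_of_eventuallyEq
      (((hFd.mono inter_subset_right).const_mul c).analyticOnNhd isOpen_doubleCutPlane)
      isPreconnected_doubleCutPlane hxD ?_
    filter_upwards [ball_mem_nhds x hδ] with y hy
    exact (div_eq_iff (hball (hδball hy).1).1).1 (hc y hy)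
  classical
  -- The two cut planes cover ℂ, and the two branches agree on their intersection.
  set H : ℂ → ℂ := fun z => if z ∈ cutPlane then F z else c * F (1 - z) with hH
  have hHF : ∀ y ∈ cutPlane, H y = F y := fun y hy => if_pos hy
  have hHF' : ∀ y ∈ slitPlane, H y = c * F (1 - y) := fun y hy => by
    by_cases h : y ∈ cutPlane
    · rw [hHF y h]
      simpa using hrel (one_sub_mem_doubleCutPlane ⟨hy, h⟩)
    · exact if_neg h
  refine not_differentiable_of_eqOn_ball hp hp0 (H := H) (fun y hy => ?_) fun y => ?_
  · rw [hHF y (ball_subset_cutPlane (by simpa using hy)), hF.2 y hy]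
  · by_cases h : y ∈ cutPlane
    · refine (hFd.differentiableAt (isOpen_cutPlane.mem_nhds h)).congr_of_eventuallyEq ?_
      filter_upwards [isOpen_cutPlane.mem_nhds h] with x hx using hHF x hx
    · have hy : y ∈ slitPlane := by
        rw [cutPlane, mem_ofPred_eq, mem_slitPlane_iff, not_or] at h
        simp only [sub_re, one_re] at h
        exact Or.inl (by linarith [h.1])
      refine ((hasDerivAt_one_sub hFd hy).differentiableAt.const_mul c).congr_of_eventuallyEq ?_
      filter_upwards [isOpen_slitPlane.mem_nhds hy] with x hx using hHF' x hx

end GaussPair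

/-! ### The case ĥ = k/r². -/

section InverseSquareCase

variable {J : Set ℝ} {r₀ v₀ : E3} {k : ℝ}

theorem hasDerivAt_hypZ (r₀ v₀ : E3) (t : ℝ) : HasDerivAt (hypZ r₀ v₀)
    (-(speed v₀ : ℂ) ^ 2 / (2 * I * speed v₀ * parC r₀ v₀)) t := by
  have h1 := (((hasDerivAt_id t).ofReal_comp.const_mul ((speed v₀ : ℂ) ^ 2)).const_sub
    (I * speed v₀ * parC r₀ v₀ - beta r₀ v₀)).div_const (2 * I * speed v₀ * parC r₀ v₀)
  exact h1.congr_deriv (by simp)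

theorem hypZ_eq (hw : wedge r₀ v₀ ≠ 0) (t : ℝ) : hypZ r₀ v₀ t =
    1 / 2 + I * ((parA r₀ v₀ + speed v₀ * t) / (2 * parC r₀ v₀)) := by
  have hb : (speed v₀ : ℂ) ≠ 0 := ofReal_ne_zero.2 (speed_pos hw).ne'
  have hc : (parC r₀ v₀ : ℂ) ≠ 0 := ofReal_ne_zero.2 (parC_pos hw).ne'
  rw [hypZ, ← speed_mul_parA hw]
  push_cast
  field_simp
  ring_nf
  simp only [I_sq]
  ring

theorem hypZ_re (hw : wedge r₀ v₀ ≠ 0) (t : ℝ) : (hypZ r₀ v₀ t).re = 1 / 2 := by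
  rw [hypZ_eq hw, show ((parA r₀ v₀ : ℂ) + speed v₀ * t) / (2 * parC r₀ v₀) =
    (((parA r₀ v₀ + speed v₀ * t) / (2 * parC r₀ v₀) : ℝ) : ℂ) by push_cast; ring]
  rw [add_re, mul_comm, re_ofReal_mul, I_re]
  norm_num

theorem hypZ_mem (hw : wedge r₀ v₀ ≠ 0) (t : ℝ) : hypZ r₀ v₀ t ∈ doubleCutPlane := by
  have h := hypZ_re hw t
  exact ⟨Or.inl (by rw [h]; norm_num), Or.inl (by rw [sub_re, h]; norm_num)⟩

theorem hasDerivAt_div_chi (hw : wedge r₀ v₀ ≠ 0) (k t : ℝ) :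
    HasDerivAt (fun t => k / chi r₀ v₀ t)
      (-(k * deriv (chi r₀ v₀) t) / chi r₀ v₀ t ^ 2) t := by
  have h1 := (hasDerivAt_const t k).div (hasDerivAt_chi r₀ v₀ t).differentiableAt.hasDerivAt
    (chi_pos hw t).ne'
  exact h1.congr_deriv (by ring)

/-- In terms of z one has a + bt = -ic(2z - 1) and χ = 4c²z(1-z): the complex zeros of χ become the
singular points 0 and 1. -/
theorem solvesLinear_iff_hypEqAt (hw : wedge r₀ v₀ ≠ 0) (hk : k ≠ 0)
    {U : Set ℂ} {y : ℂ → ℂ} (hU : IsOpen U) (hy : DifferentiableOn ℂ y U)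
    (hJU : ∀ t ∈ J, hypZ r₀ v₀ t ∈ U) :
    SolvesLinear (fun t => k / chi r₀ v₀ t) r₀ v₀ J (fun t => y (hypZ r₀ v₀ t)) ↔
      ∀ t ∈ J, HypEqAt k (speed v₀) y (hypZ r₀ v₀ t) := by
  have hb : (speed v₀ : ℂ) ≠ 0 := ofReal_ne_zero.2 (speed_pos hw).ne'
  have hc : (parC r₀ v₀ : ℂ) ≠ 0 := ofReal_ne_zero.2 (parC_pos hw).ne'
  have hk' : (k : ℂ) ≠ 0 := ofReal_ne_zero.2 hk
  refine forall₂_congr fun t ht => ?_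
  have d1 := hasDerivAt_comp_affine (hasDerivAt_hypZ r₀ v₀) hU hy (hJU t ht)
  have d2 := hasDerivAt_deriv_comp_affine (hasDerivAt_hypZ r₀ v₀) hU hy (hJU t ht)
  have hχ : (chi r₀ v₀ t : ℂ) ≠ 0 := ofReal_ne_zero.2 (chi_pos hw t).ne'
  set z := hypZ r₀ v₀ t with hz
  set ζ : ℂ := -(speed v₀ : ℂ) ^ 2 / (2 * I * speed v₀ * parC r₀ v₀) with hζ
  have hζ' : ζ = I * speed v₀ / (2 * parC r₀ v₀) := by
    rw [hζ]
    field_simp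
    rw [I_sq]
  have hs : (parA r₀ v₀ : ℂ) + speed v₀ * t = -I * parC r₀ v₀ * (2 * z - 1) := by
    rw [hz, hypZ_eq hw]
    field_simp
    ring_nf
    simp only [I_sq]
    ring
  have hχz : (chi r₀ v₀ t : ℂ) = 4 * (parC r₀ v₀ : ℂ) ^ 2 * (z * (1 - z)) := by
    rw [chi_eq hw]
    push_cast
    rw [hs]
    ring_nf
    simp only [I_sq]
    ring
  have hχ' : ((deriv (chi r₀ v₀) t : ℝ) : ℂ) =
      2 * speed v₀ * (-I * parC r₀ v₀ * (2 * z - 1)) := by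
    rw [← hs, deriv_chi, ← speed_mul_parA hw]
    push_cast
    ring
  have hzz : z * (1 - z) ≠ 0 := fun h => hχ (by rw [hχz, h, mul_zero])
  -- The two equations differ by the nonzero factor -b²/χ, so this one identity serves both
  -- directions.
  have key : ζ ^ 2 * deriv (deriv y) z
      - (((deriv (fun t => k / chi r₀ v₀ t) t / (k / chi r₀ v₀ t) : ℝ) : ℂ) *
          deriv (fun t => y (hypZ r₀ v₀ t)) t
        + (-(chi r₀ v₀ t : ℂ) * (((k / chi r₀ v₀ t : ℝ) : ℂ) / 2) ^ 2
          + I * speed v₀ * ((k / chi r₀ v₀ t : ℝ) : ℂ) / 2) * y z) =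
      -(speed v₀ : ℂ) ^ 2 / chi r₀ v₀ t *
        (z * (1 - z) * deriv (deriv y) z + (1 - 2 * z) * deriv y z
          - k * (k - 2 * I * speed v₀) * ((2 * speed v₀ : ℂ) ^ 2)⁻¹ * y z) := by
    rw [d1.deriv, (hasDerivAt_div_chi hw k t).deriv]
    push_cast
    rw [hχ', hχz, hζ']
    have hz0 : z ≠ 0 := left_ne_zero_of_mul hzz
    have hz1 : 1 - z ≠ 0 := right_ne_zero_of_mul hzz
    field_simp
    ring_nf
    simp only [I_sq]
    ring
  have hfac : -(speed v₀ : ℂ) ^ 2 / chi r₀ v₀ t ≠ 0 := by simp [hb, hχ]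
  rw [HypEqAt]
  refine ⟨fun H => mul_left_cancel₀ hfac ?_, fun H => ⟨d1.differentiableAt, d2.congr_deriv ?_⟩⟩
  · rw [← key, mul_zero, sub_eq_zero]
    exact d2.unique H.2
  · rw [H, mul_zero, sub_eq_zero] at key
    exact key

theorem hypEqAt_of_equation {p : ℂ} {F : ℂ → ℂ} {z : ℂ} {b : ℝ} (hb : b ≠ 0)
    (hp : p = I * k / (2 * b))
    (hE : z * (1 - z) * deriv (deriv F) z + (1 - 2 * z) * deriv F z = -p * (1 + p) * F z) :
    HypEqAt k b F z := by
  have hb' : (b : ℂ) ≠ 0 := ofReal_ne_zero.2 hb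
  have hq : -p * (1 + p) = k * (k - 2 * I * b) * ((2 * b : ℂ) ^ 2)⁻¹ := by
    rw [hp]
    field_simp
    ring_nf
    simp only [I_sq]
    ring
  rw [HypEqAt, hE, hq, sub_self]

theorem HypEqAt.one_sub {b : ℝ} {F : ℂ → ℂ} {z : ℂ} (h : HypEqAt k b F (1 - z)) :
    HypEqAt k b (fun z => F (1 - z)) z := by
  rw [HypEqAt] at h ⊢
  rw [deriv_deriv_one_sub, deriv_one_sub]
  linear_combination h

theorem HypEqAt.combination {b : ℝ} {u w : ℂ → ℂ} {z : ℂ} {U : Set ℂ} (hU : IsOpen U)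
    (hz : z ∈ U) (hu : DifferentiableOn ℂ u U) (hw : DifferentiableOn ℂ w U)
    (h₁ : HypEqAt k b u z) (h₂ : HypEqAt k b w z) (A B : ℂ) :
    HypEqAt k b (fun z => A * u z + B * w z) z := by
  have e1 : ∀ x ∈ U, HasDerivAt (fun z => A * u z + B * w z) (A * deriv u x + B * deriv w x) x :=
    fun x hx => ((hu.differentiableAt (hU.mem_nhds hx)).hasDerivAt.const_mul A).add
      ((hw.differentiableAt (hU.mem_nhds hx)).hasDerivAt.const_mul B)
  have e2 : HasDerivAt (deriv fun z => A * u z + B * w z)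
      (A * deriv (deriv u) z + B * deriv (deriv w) z) z := by
    have := (((hu.deriv hU).differentiableAt (hU.mem_nhds hz)).hasDerivAt.const_mul A).add
      (((hw.deriv hU).differentiableAt (hU.mem_nhds hz)).hasDerivAt.const_mul B)
    refine this.congr_of_eventuallyEq ?_
    filter_upwards [hU.mem_nhds hz] with x hx using (e1 x hx).deriv
  rw [HypEqAt] at *
  rw [e2.deriv, (e1 z hz).deriv]
  linear_combination A * h₁ + B * h₂

theorem isGenerating_gauss (hw : wedge r₀ v₀ ≠ 0) (hk : k ≠ 0)
    {u w : ℂ → ℂ} (hu : DifferentiableOn ℂ u doubleCutPlane)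
    (hv : DifferentiableOn ℂ w doubleCutPlane)
    (hpair : ∀ z ∈ doubleCutPlane, HypEqAt k (speed v₀) u z ∧ HypEqAt k (speed v₀) w z ∧
      wronsk u w z ≠ 0) {A B y : ℂ}
    (hy : y = parA r₀ v₀ * parC r₀ v₀ * k / (speed v₀ * alpha r₀))
    (hA : A = coeffFst u w (hypZ r₀ v₀ 0) 1 y) (hB : B = coeffSnd u w (hypZ r₀ v₀ 0) 1 y) :
    IsGenerating (fun t => k / chi r₀ v₀ t) r₀ v₀ J
      (fun t => A * u (hypZ r₀ v₀ t) + B * w (hypZ r₀ v₀ t)) := by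
  have hD := isOpen_doubleCutPlane
  have hW := (hpair _ (hypZ_mem hw 0)).2.2
  have hd : DifferentiableOn ℂ (fun z => A * u z + B * w z) doubleCutPlane :=
    (hu.const_mul A).add (hv.const_mul B)
  refine ⟨(solvesLinear_iff_hypEqAt hw hk hD hd fun t _ => hypZ_mem hw t).2 fun t _ => ?_, ?_, ?_⟩
  · obtain ⟨h1, h2, -⟩ := hpair _ (hypZ_mem hw t)
    exact h1.combination hD (hypZ_mem hw t) hu hv h2 A B
  · rw [hA, hB]; exact coeff_value hW _ _
  · have hz := hD.mem_nhds (hypZ_mem hw 0)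
    rw [(hasDerivAt_comp_affine (hasDerivAt_hypZ r₀ v₀) hD hd (hypZ_mem hw 0)).deriv,
      deriv_fun_add ((hu.differentiableAt hz).const_mul A) ((hv.differentiableAt hz).const_mul B),
      deriv_const_mul _ (hu.differentiableAt hz), deriv_const_mul _ (hv.differentiableAt hz), hA,
      hB, coeff_deriv hW, hy]
    -- Since dz/dt = ib/(2c) and h(0) = k/α, the value y = ack/(bα) gives ḟ(0) = iah(0)/2.
    simp only [chi_zero]
    have hb : (speed v₀ : ℂ) ≠ 0 := ofReal_ne_zero.2 (speed_pos hw).ne'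
    have hc : (parC r₀ v₀ : ℂ) ≠ 0 := ofReal_ne_zero.2 (parC_pos hw).ne'
    have hα : (alpha r₀ : ℂ) ≠ 0 := by
      rw [← chi_zero r₀ v₀]; exact ofReal_ne_zero.2 (chi_pos hw 0).ne'
    push_cast
    field_simp
    ring_nf
    simp only [I_sq]
    ring

/-- The two hypergeometric solutions and the representation of the generating function. -/
theorem exists_gauss_representation (hJ : IsOpen J) (hJc : J.OrdConnected) (hJ0 : (0 : ℝ) ∈ J)
    (hw : wedge r₀ v₀ ≠ 0) (hk : k ≠ 0) :
    ∃ F : ℂ → ℂ,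
      IsGaussHypergeometric (-I * k / (2 * speed v₀)) (1 + I * k / (2 * speed v₀)) 1 F ∧
      (∀ z ∈ slitPlane, 1 - z ∈ slitPlane →
        HypEqAt k (speed v₀) F z ∧ HypEqAt k (speed v₀) (fun z => F (1 - z)) z ∧
        wronsk F (fun z => F (1 - z)) z ≠ 0) ∧
      ∀ A B y : ℂ, y = parA r₀ v₀ * parC r₀ v₀ * k / (speed v₀ * alpha r₀) →
        A = coeffFst F (fun z => F (1 - z)) (hypZ r₀ v₀ 0) 1 y →
        B = coeffSnd F (fun z => F (1 - z)) (hypZ r₀ v₀ 0) 1 y →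
        ∀ f : ℝ → ℂ, IsGenerating (fun t => k / chi r₀ v₀ t) r₀ v₀ J f ↔
          ∀ t ∈ J, f t = A * F (hypZ r₀ v₀ t) + B * F (1 - hypZ r₀ v₀ t) := by
  have hb := (speed_pos hw).ne'
  obtain ⟨p, hp⟩ : ∃ p : ℂ, p = I * k / (2 * speed v₀) := ⟨_, rfl⟩
  have hpI : p = ((k / (2 * speed v₀) : ℝ) : ℂ) * I := by rw [hp]; push_cast; ring
  have hp_re : p.re = 0 := by rw [hpI, re_ofReal_mul, I_re, mul_zero]
  have hp0 : p ≠ 0 := by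
    rw [hpI]
    exact mul_ne_zero (ofReal_ne_zero.2 (div_ne_zero hk (mul_ne_zero two_ne_zero hb))) I_ne_zero
  obtain ⟨F, hF, hE⟩ := exists_isGaussHypergeometric hp_re hp0
  have hFd : DifferentiableOn ℂ F cutPlane := hF.1
  have hpair : ∀ z ∈ doubleCutPlane, HypEqAt k (speed v₀) F z ∧
      HypEqAt k (speed v₀) (fun z => F (1 - z)) z ∧ wronsk F (fun z => F (1 - z)) z ≠ 0 :=
    fun z hz => ⟨hypEqAt_of_equation hb hp (hE z hz.2),
      (hypEqAt_of_equation hb hp (hE _ (one_sub_mem_cutPlane hz.1))).one_sub,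
      wronsk_gauss_ne_zero hp_re hp0 hF hE hz⟩
  refine ⟨F, ?_, fun z h1 h2 => hpair z ⟨h1, h2⟩, fun A B y hy hA hB f => ?_⟩
  · rw [show -I * k / (2 * speed v₀) = -p by rw [hp]; ring, ← hp]
    exact hF
  · refine isGenerating_iff_eqOn hJ hJc hJ0 hw (fun t _ => ?_) (isGenerating_gauss hw hk
      (hFd.mono inter_subset_right) (fun z hz =>
        (hasDerivAt_one_sub hFd hz.1).differentiableAt.differentiableWithinAt) hpair hy hA hB) f
    exact ⟨(hasDerivAt_div_chi hw k t).differentiableAt, div_ne_zero hk (chi_pos hw t).ne'⟩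

end InverseSquareCase

end VectorNewton
-- Assembly of the theorem.
theorem mainTheorem6 (J : Set ℝ) (hJ : IsOpen J) (hJc : J.OrdConnected) (hJ0 : (0 : ℝ) ∈ J)
    (r₀ v₀ : E3) :
    -- conservation laws
    (∀ (H : ℝ → ℝ → ℝ) (r : ℝ → E3), IsMotion H J r → r 0 = r₀ → deriv r 0 = v₀ →
      ∀ t ∈ J, ‖deriv r t‖ = speed v₀ ∧ ‖r t‖ ^ 2 = chi r₀ v₀ t ∧
        inner ℝ (r t) (deriv r t) = beta r₀ v₀ + speed v₀ ^ 2 * t) ∧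
    -- representation of the motion through three solutions of the third-order equation
    (∀ (H : ℝ → ℝ → ℝ) (h : ℝ → ℝ), (∀ t, h t = H t (chi r₀ v₀ t)) →
      (∀ t ∈ J, DifferentiableAt ℝ h t ∧ h t ≠ 0) →
      (∃ F₀ F₁ F₂ : ℝ → ℝ, SolvesThirdOrder h r₀ v₀ J 1 0 0 F₀ ∧
        SolvesThirdOrder h r₀ v₀ J 0 1 0 F₁ ∧ SolvesThirdOrder h r₀ v₀ J 0 0 (h 0) F₂) ∧
      ∀ F₀ F₁ F₂ : ℝ → ℝ, SolvesThirdOrder h r₀ v₀ J 1 0 0 F₀ →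
        SolvesThirdOrder h r₀ v₀ J 0 1 0 F₁ → SolvesThirdOrder h r₀ v₀ J 0 0 (h 0) F₂ →
        ∀ r : ℝ → E3, (IsMotion H J r ∧ r 0 = r₀ ∧ deriv r 0 = v₀) ↔
          ∀ t ∈ J, r t = F₀ t • r₀ + F₁ t • v₀ + F₂ t • wedge r₀ v₀) ∧
    -- the three solutions expressed through `f`
    (wedge r₀ v₀ ≠ 0 →
      ∀ (H : ℝ → ℝ → ℝ) (h : ℝ → ℝ), (∀ t, h t = H t (chi r₀ v₀ t)) →
      (∀ t ∈ J, DifferentiableAt ℝ h t ∧ h t ≠ 0) →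
      (∃ f : ℝ → ℂ, IsGenerating h r₀ v₀ J f) ∧
      (∀ f₁ f₂ : ℝ → ℂ, IsGenerating h r₀ v₀ J f₁ → IsGenerating h r₀ v₀ J f₂ →
        Set.EqOn f₁ f₂ J) ∧
      (∀ f g : ℝ → ℂ, SolvesSystem h r₀ v₀ J f g ↔
        IsGenerating h r₀ v₀ J f ∧ Set.EqOn g (companion h r₀ v₀ f) J) ∧
      ∀ f : ℝ → ℂ, IsGenerating h r₀ v₀ J f →
        ∀ g : ℝ → ℂ, g = companion h r₀ v₀ f →
        (∀ t ∈ J, g t * (starRingEnd ℂ) (g t) = 1 - f t * (starRingEnd ℂ) (f t)) ∧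
        ∃ F₀ F₁ F₂ : ℝ → ℝ,
          (∀ t ∈ J, (F₀ t : ℂ) = pairF0 r₀ v₀ t (f t) (g t) ∧
            (F₁ t : ℂ) = pairF1 r₀ v₀ t (f t) (g t) ∧
            (F₂ t : ℂ) = pairF2 r₀ v₀ t (f t) (g t) ∧
            (F₀ t : ℂ) = singleF0 r₀ v₀ t (h t) (f t) (deriv f t) ∧
            (F₁ t : ℂ) = singleF1 r₀ v₀ t (h t) (f t) (deriv f t) ∧
            (F₂ t : ℂ) = singleF2 r₀ v₀ t (h t) (f t) (deriv f t)) ∧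
          SolvesThirdOrder h r₀ v₀ J 1 0 0 F₀ ∧ SolvesThirdOrder h r₀ v₀ J 0 1 0 F₁ ∧
          SolvesThirdOrder h r₀ v₀ J 0 0 (h 0) F₂ ∧
          ∀ r : ℝ → E3, (IsMotion H J r ∧ r 0 = r₀ ∧ deriv r 0 = v₀) ↔
            ∀ t ∈ J, r t = F₀ t • r₀ + F₁ t • v₀ + F₂ t • wedge r₀ v₀) ∧
    -- the equivalent equation of Schrödinger type
    (∀ h : ℝ → ℝ,
      (∀ t ∈ J, DifferentiableAt ℝ h t ∧ DifferentiableAt ℝ (deriv h) t ∧ h t ≠ 0) →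
      ∀ f φ : ℝ → ℂ, (∀ t ∈ J, f t = (h t : ℂ) ^ (1 / 2 : ℂ) * φ t) →
        (IsGenerating h r₀ v₀ J f ↔
          SolvesSchroedinger h r₀ v₀ J φ ∧ φ 0 = phiInit h ∧ deriv φ 0 = phiDerivInit h r₀ v₀)) ∧
    -- `ĥ = k`: parabolic cylinder functions
    (∀ k : ℝ, wedge r₀ v₀ ≠ 0 → k ≠ 0 →
      ∀ (u w : ℂ → ℂ) (A B : ℂ),
        u = parabolicCylinder (cylP k r₀ v₀) →
        w = (fun τ => parabolicCylinder (cylP k r₀ v₀) (-τ)) →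
        A = coeffFst u w (cylTau k r₀ v₀ 0) 1 (cylK k r₀ v₀) →
        B = coeffSnd u w (cylTau k r₀ v₀ 0) 1 (cylK k r₀ v₀) →
        (∀ τ, wronsk u w τ ≠ 0) ∧
        ∀ f : ℝ → ℂ, IsGenerating (fun _ => k) r₀ v₀ J f ↔
          ∀ t ∈ J, f t = A * u (cylTau k r₀ v₀ t) + B * w (cylTau k r₀ v₀ t)) ∧
    -- `ĥ = k / r²`: hypergeometric functions
    (∀ k : ℝ, wedge r₀ v₀ ≠ 0 → k ≠ 0 →
      (∀ (U : Set ℂ) (fh : ℂ → ℂ), IsOpen U → DifferentiableOn ℂ fh U →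
        (∀ t ∈ J, hypZ r₀ v₀ t ∈ U) →
        (SolvesLinear (fun t => k / chi r₀ v₀ t) r₀ v₀ J (fun t => fh (hypZ r₀ v₀ t)) ↔
          ∀ t ∈ J, HypEqAt k (speed v₀) fh (hypZ r₀ v₀ t))) ∧
      ∃ F : ℂ → ℂ,
        IsGaussHypergeometric (-Complex.I * k / (2 * speed v₀))
          (1 + Complex.I * k / (2 * speed v₀)) 1 F ∧
        (∀ z ∈ Complex.slitPlane, 1 - z ∈ Complex.slitPlane →
          HypEqAt k (speed v₀) F z ∧ HypEqAt k (speed v₀) (fun z => F (1 - z)) z ∧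
          wronsk F (fun z => F (1 - z)) z ≠ 0) ∧
        ∀ A B y : ℂ,
          y = parA r₀ v₀ * parC r₀ v₀ * k / (speed v₀ * alpha r₀) →
          A = coeffFst F (fun z => F (1 - z)) (hypZ r₀ v₀ 0) 1 y →
          B = coeffSnd F (fun z => F (1 - z)) (hypZ r₀ v₀ 0) 1 y →
          ∀ f : ℝ → ℂ, IsGenerating (fun t => k / chi r₀ v₀ t) r₀ v₀ J f ↔
            ∀ t ∈ J, f t = A * F (hypZ r₀ v₀ t) + B * F (1 - hypZ r₀ v₀ t)) ∧
    -- `h = 2 k / (1 + 2 ω t)`: Whittaker functions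
    (∀ k ω : ℝ, wedge r₀ v₀ ≠ 0 → k ≠ 0 → ω ≠ 0 → (∀ t ∈ J, 1 + 2 * ω * t ≠ 0) →
      ∀ h : ℝ → ℝ, (∀ t, h t = 2 * k / (1 + 2 * ω * t)) →
      ∀ μ : ℂ, μ ^ 2 = (whitMuSq k ω r₀ v₀ : ℂ) →
      (∀ (U : Set ℂ) (φh : ℂ → ℂ), IsOpen U → DifferentiableOn ℂ φh U →
        (∀ t ∈ J, whitZ k ω v₀ t ∈ U) →
        (SolvesSchroedinger h r₀ v₀ J (fun t => φh (whitZ k ω v₀ t)) ↔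
          ∀ t ∈ J, WhittakerEqAt (whitL k ω r₀ v₀) μ φh (whitZ k ω v₀ t))) ∧
      ∀ (u w : ℂ → ℂ) (A B y : ℂ),
        u = whittakerW (whitL k ω r₀ v₀) μ →
        w = (fun z => whittakerW (-whitL k ω r₀ v₀) μ (-z)) →
        y = phiDerivInit h r₀ v₀ * (Complex.I * ω / (speed v₀ * k)) →
        A = coeffFst u w (whitZ k ω v₀ 0) (phiInit h) y →
        B = coeffSnd u w (whitZ k ω v₀ 0) (phiInit h) y →
        (∀ z : ℂ, z.im ≠ 0 →
          WhittakerEqAt (whitL k ω r₀ v₀) μ u z ∧ WhittakerEqAt (whitL k ω r₀ v₀) μ w z ∧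
          wronsk u w z ≠ 0) ∧
        ∀ f : ℝ → ℂ, IsGenerating h r₀ v₀ J f ↔
          ∀ t ∈ J, f t = (h t : ℂ) ^ (1 / 2 : ℂ) *
            (A * u (whitZ k ω v₀ t) + B * w (whitZ k ω v₀ t))) := by
  have hk_diff : ∀ k : ℝ, k ≠ 0 → ∀ t ∈ J, DifferentiableAt ℝ (fun _ : ℝ => k) t ∧ k ≠ 0 :=
    fun k hk t _ => ⟨differentiableAt_const k, hk⟩
  refine ⟨fun H r hr h0 h1 => motion_conservation hJc hJ0 hr h0 h1, fun H h hH hh => ⟨?_, ?_⟩,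
    fun hw H h hH hh => ⟨?_, ?_, fun f g => solvesSystem_iff hJ hJ0 hw hh f g, ?_⟩,
    fun h hh f φ hfφ => isGenerating_iff_solvesSchroedinger hJ hh hfφ hJ0, ?_,
    fun k hw hk => ⟨fun U y hU hy hJU => solvesLinear_iff_hypEqAt hw hk hU hy hJU,
      exists_gauss_representation hJ hJc hJ0 hw hk⟩, ?_⟩
  · obtain ⟨F₀, hF₀⟩ := exists_solvesThirdOrder hJ hJc hJ0 hh 1 0 0
    obtain ⟨F₁, hF₁⟩ := exists_solvesThirdOrder hJ hJc hJ0 hh 0 1 0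
    obtain ⟨F₂, hF₂⟩ := exists_solvesThirdOrder hJ hJc hJ0 hh 0 0 (h 0)
    exact ⟨F₀, F₁, F₂, hF₀, hF₁, hF₂⟩
  · exact fun F₀ F₁ F₂ hF₀ hF₁ hF₂ r => motion_iff hJ hJc hJ0 hH hh hF₀ hF₁ hF₂ r
  · obtain ⟨f, g, hfg⟩ := exists_solvesSystem (r₀ := r₀) (v₀ := v₀) hJ hJc hJ0
      (fun t ht => (hh t ht).1.continuousAt.continuousWithinAt)
    exact ⟨f, ((solvesSystem_iff hJ hJ0 hw hh f g).1 hfg).1⟩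
  · exact fun f₁ f₂ h₁ h₂ => h₁.eqOn hJ hJc hJ0 hw hh h₂
  · intro f hf g hg
    obtain ⟨hn, F₀, F₁, F₂, hform, hF₀, hF₁, hF₂⟩ :=
      hf.basic_solutions hJ hJc hJ0 hw hh hg
    exact ⟨hn, F₀, F₁, F₂, hform, hF₀, hF₁, hF₂,
      fun r => motion_iff hJ hJc hJ0 hH hh hF₀ hF₁ hF₂ r⟩
  · intro k hw hk u w A B hu hv hA hB
    refine ⟨fun τ => ?_, fun f => isGenerating_iff_eqOn hJ hJc hJ0 hw (hk_diff k hk)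
      (isGenerating_parabolicCylinder hw hk hu hv hA hB) f⟩
    rw [hu, hv]
    exact wronsk_parabolicCylinder_ne_zero (cylP_im_ne_zero hw hk) τ
  · intro k ω hw hk hω hJω h hh μ hμ
    refine ⟨fun U y hU hy hJU => solvesSchroedinger_iff_whittaker hw hk hω hJω hh hμ hU hy hJU,
      fun u w A B y hu hv hy hA hB => ⟨fun z hz => ?_, fun f => ?_⟩⟩
    · rw [hu, hv]
      exact whittaker_pair (im_ne_zero_of_sq_neg (whitMuSq_neg hw hk hω) hμ) _ hz
    · refine isGenerating_iff_eqOn hJ hJc hJ0 hw (fun t ht => ⟨?_, ?_⟩)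
        (isGenerating_whittaker hJ hJ0 hw hk hω hJω hh hμ hu hv hy hA hB) f
      · exact (hasDerivAt_two_mul_div hh (hJω t ht)).differentiableAt
      · rw [hh]
        exact div_ne_zero (mul_ne_zero two_ne_zero hk) (hJω t ht)
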